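/- **Setting.** Let $\mathbb V$ be a separable complex Hilbert space with inner product linear in the first argument, let $d\ge 1$ and let $k\ge 0$ be an integer. Let $\mathbb T$ be the Banach space of trace-class operators on $\mathbb V$ with the trace norm, and $\mathbb T_+$ the set of positive operators in $\mathbb T$. A finite $\mathbb T_+$-valued measure is a map from a Borel $\sigma$-field to $\mathbb T_+$ that is countably additive in trace norm. For $f,g\in\mathbb V$ let $(f\otimes g)h=\langle h,g\rangle f$. For $r>0$ and a bounded operator $\mathcal A$ let $r^{\mathcal A}=\exp(\log(r)\mathcal A)$. Let $\Lambda_k$ be the space of finitely supported complex measures $\lambda=\sum_j c_j\delta_{t_j}$ on $\mathbb R^d$ that annihilate all polynomials of degree at most $k$; put $w+\lambda=\sum_j c_j\delta_{w+t_j}$ and $c\cdot\lambda=\sum_j c_j\delta_{ct_j}$. An IRF$_k$ is a process $Y=\{Y(\lambda),\lambda\in\Lambda_k\}$ with values in $\mathbb V$, linear in $\lambda$, with $\mathbb E Y(\lambda)=0$, $\mathbb E\|Y(\lambda)\|^2<\infty$, whose covariance $\mathcal C_Y(\lambda,\mu)=\mathbb E[Y(\lambda)\otimes Y(\mu)]\in\mathbb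 T$ (a Bochner integral in trace norm) satisfies $\mathcal C_Y(w+\lambda,w+\mu)=\mathcal C_Y(\lambda,\mu)$ for all $w\in\mathbb R^d$. It is mean-square continuous if $t\mapsto Y(\lambda_t)$ is continuous in $L^2$, where $\lambda_t=\delta_t-(\delta_{t_1},\dots,\delta_{t_M})B^{-1}b(t)\in\Lambda_k$; here $b(t)$ is the vector of the $M=\binom{k+d}{k}$ monomials of degree at most $k$ at $t$, and $t_1,\dots,t_M$ are any points for which $B=(b(t_1),\dots,b(t_M))$ is invertible. It is covariance $\mathcal H$-self-similar if, for all $c>0$, the processes $\{Y(c\cdot\lambda)\}$ and $\{c^{\mathcal H}Y(\lambda)\}$ have the same covariance function. It has spectral characteristics $(\chi,\mathcal Q)$, with spectral measure $\chi$, if $\chi$ is a finite $\mathbb T_+$-valued Borel measure on $\mathbb R^d$ with $\chi(\{0\})=0$, $\mathcal Q$ is a $\mathbb T$-valued polynomial of degree at most $2k+2$ that is conditionally positive definite of degree $k$ (that is, $\sum_{j,j'}c_j\overline{c_{j'}}\mathcal Q(t_j-t_{j'})\ge0$ for all $\sum_jc_j\delta_{t_j}\in\Lambda_k$), and for every bounded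 Borel neighborhood $U$ of $0$ the kernel $$\mathcal K(h)=\int_{\mathbb R^d}\frac{e^{\mathrm i u^\top h}-1_U(u)\sum_{j=0}^{2k+1}(\mathrm i u^\top h)^j/j!}{1\wedge\|u\|^{2k+2}}\,\chi(du)+\mathcal Q(h)$$ is well defined and satisfies $\mathcal C_Y(\lambda,\mu)=\sum_{j,i}c_j\overline{d_i}\,\mathcal K(t_j-s_i)$ for all $\lambda=\sum_j c_j\delta_{t_j}$ and $\mu=\sum_i d_i\delta_{s_i}$ in $\Lambda_k$. **Proposition.** Let $\mathcal H$ be a bounded linear operator on $\mathbb V$ with $\Re(\mathrm{sp}(\mathcal H))\subset(0,k+1)$. Then, for every finite $\mathbb T_+$-valued Borel measure $\sigma$ on the unit sphere $\mathbb S$ of $\mathbb R^d$, the formula $$\chi(dr\,d\theta)=(1\wedge r^{2k+2})\,r^{-\mathcal H}\sigma(d\theta)\,r^{-\mathcal H^*}\,r^{-1}dr,$$ that is, for every Borel set $D\subset\mathbb R^d$, $$\chi(D)=\int_0^\infty(1\wedge r^{2k+2})\,r^{-\mathcal H}\,\sigma(\{\theta\in\mathbb S: r\theta\in D\})\,r^{-\mathcal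 H^*}\,\frac{dr}{r},$$ where the integrals converge as Bochner integrals in trace norm, defines a finite $\mathbb T_+$-valued measure on $\mathbb R^d$ without mass at $0$, and $\chi$ is the spectral measure of a covariance $\mathcal H$-self-similar IRF$_k$. More precisely, there is, on some probability space, a mean-square continuous, covariance $\mathcal H$-self-similar IRF$_k$ with spectral characteristics $(\chi,0)$. -/

import Mathlib

open scoped ENNReal Topology

set_option linter.unusedSectionVars false

noncomputable section

namespace HilbertTrace

variable {V : Type*} [NormedAddCommGroup V] [InnerProductSpace ℂ V] [CompleteSpace V]

/-- The (possibly infinite) sum `∑ ⟨|A| e_j, e_j⟩` over a complete orthonormal system `e`,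
where `|A| = (A* A)^{1/2}`. -/
def traceSum {ι : Type*} (e : HilbertBasis ι ℂ V) (A : V →L[ℂ] V) : ℝ≥0∞ :=
  ∑' j, ENNReal.ofReal (inner ℂ (e j) (CFC.abs A (e j))).re

/-- A complete orthonormal system of `V`, fixed once and for all; nothing depends on the choice
(see `traceSum_eq`). -/
def cons (V : Type*) [NormedAddCommGroup V] [InnerProductSpace ℂ V] [CompleteSpace V] :
    HilbertBasis (exists_hilbertBasis ℂ V).choose ℂ V :=
  (exists_hilbertBasis ℂ V).choose_spec.choose

/-- The trace norm of a bounded operator, with value `∞` if it is not of trace class. -/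
def eTraceNorm (A : V →L[ℂ] V) : ℝ≥0∞ := traceSum (cons V) A

theorem tsum_enorm_inner_sq {ι : Type*} (e : HilbertBasis ι ℂ V) (x : V) :
    ∑' j, ‖inner ℂ (e j) x‖ₑ ^ 2 = ‖x‖ₑ ^ 2 := by
  have h := e.hasSum_inner_mul_inner x x
  have h2 : HasSum (fun j => ‖inner ℂ (e j) x‖ ^ 2) (‖x‖ ^ 2) := by
    have h3 := Complex.hasSum_re h
    have e1 : ∀ j, (inner ℂ x (e j) * inner ℂ (e j) x).re = ‖inner ℂ (e j) x‖ ^ 2 := by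
      intro j
      rw [← inner_conj_symm x (e j), ← Complex.normSq_eq_conj_mul_self, Complex.ofReal_re,
        Complex.normSq_eq_norm_sq]
    have e2 : (inner ℂ x x).re = ‖x‖ ^ 2 := by
      have := inner_self_eq_norm_sq (𝕜 := ℂ) x
      simpa using this
    simpa only [e1, e2] using h3
  have h4 := h2.summable
  have : ∀ y : ℂ, ‖y‖ₑ ^ 2 = ENNReal.ofReal (‖y‖ ^ 2) := fun y => by
    rw [ENNReal.ofReal_pow (norm_nonneg _), ofReal_norm]
  simp_rw [this]
  rw [← ENNReal.ofReal_tsum_of_nonneg (fun j => by positivity) h4, h2.tsum_eq,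
    ENNReal.ofReal_pow (norm_nonneg _), ofReal_norm]

theorem tsum_enorm_sq_adjoint {ι κ : Type*} (e : HilbertBasis ι ℂ V) (f : HilbertBasis κ ℂ V)
    (S : V →L[ℂ] V) :
    ∑' j, ‖S (e j)‖ₑ ^ 2 = ∑' i, ‖ContinuousLinearMap.adjoint S (f i)‖ₑ ^ 2 := by
  simp_rw [← tsum_enorm_inner_sq f (S _), ← tsum_enorm_inner_sq e (ContinuousLinearMap.adjoint S _)]
  rw [ENNReal.tsum_comm]
  refine tsum_congr fun i => tsum_congr fun j => ?_
  rw [ContinuousLinearMap.adjoint_inner_right, ← inner_conj_symm, RCLike.enorm_conj]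

theorem tsum_enorm_sq_comp_le {ι : Type*} (e : HilbertBasis ι ℂ V) (S C : V →L[ℂ] V) :
    ∑' j, ‖S (C (e j))‖ₑ ^ 2 ≤ ‖C‖ₑ ^ 2 * ∑' j, ‖S (e j)‖ₑ ^ 2 := by
  have h := tsum_enorm_sq_adjoint e e (S.comp C)
  have h' := tsum_enorm_sq_adjoint e e S
  simp only [ContinuousLinearMap.comp_apply] at h
  rw [h, h', ← ENNReal.tsum_mul_left]
  refine ENNReal.tsum_le_tsum fun j => ?_
  rw [ContinuousLinearMap.adjoint_comp, ContinuousLinearMap.comp_apply, ← mul_pow]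
  gcongr
  refine (ContinuousLinearMap.le_opENorm _ _).trans ?_
  gcongr
  rw [← ofReal_norm, ← ofReal_norm, LinearIsometryEquiv.norm_map]

/-- The positive square root of `|A|`. -/
def sqrtAbs (A : V →L[ℂ] V) : V →L[ℂ] V := CFC.sqrt (CFC.abs A)

theorem sqrtAbs_sq (A : V →L[ℂ] V) : sqrtAbs A * sqrtAbs A = CFC.abs A :=
  CFC.sqrt_mul_sqrt_self _ (CFC.abs_nonneg A)

theorem adjoint_sqrtAbs (A : V →L[ℂ] V) : ContinuousLinearMap.adjoint (sqrtAbs A) = sqrtAbs A :=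
  (CFC.sqrt_nonneg (CFC.abs A)).isSelfAdjoint.star_eq

theorem inner_abs (A : V →L[ℂ] V) (x : V) :
    (inner ℂ x (CFC.abs A x)).re = ‖sqrtAbs A x‖ ^ 2 := by
  rw [← sqrtAbs_sq, mul_apply_eq_comp, ← adjoint_sqrtAbs,
    ContinuousLinearMap.adjoint_inner_right, adjoint_sqrtAbs]
  simpa using inner_self_eq_norm_sq (𝕜 := ℂ) (sqrtAbs A x)

theorem traceSum_eq_tsum {ι : Type*} (e : HilbertBasis ι ℂ V) (A : V →L[ℂ] V) :
    traceSum e A = ∑' j, ‖sqrtAbs A (e j)‖ₑ ^ 2 := by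
  unfold traceSum
  refine tsum_congr fun j => ?_
  rw [inner_abs, ENNReal.ofReal_pow (norm_nonneg _), ofReal_norm]

/-- The trace norm does not depend on the complete orthonormal system. -/
theorem traceSum_eq {ι : Type*} (e : HilbertBasis ι ℂ V) (A : V →L[ℂ] V) :
    traceSum e A = eTraceNorm A := by
  rw [eTraceNorm, traceSum_eq_tsum, traceSum_eq_tsum, tsum_enorm_sq_adjoint e (cons V),
    adjoint_sqrtAbs]

theorem norm_abs_apply (A : V →L[ℂ] V) (x : V) : ‖CFC.abs A x‖ = ‖A x‖ := by
  have h : ∀ y, ‖y‖ ^ 2 = (inner ℂ y y).re := fun y : V => by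
    simpa using (inner_self_eq_norm_sq (𝕜 := ℂ) y).symm
  have hs : ContinuousLinearMap.adjoint (CFC.abs A) = CFC.abs A :=
    (CFC.abs_nonneg A).isSelfAdjoint.star_eq
  have : ‖CFC.abs A x‖ ^ 2 = ‖A x‖ ^ 2 := by
    rw [h, h, ← ContinuousLinearMap.adjoint_inner_right, hs, ← mul_apply_eq_comp,
      CFC.abs_mul_abs, mul_apply_eq_comp, ContinuousLinearMap.star_eq_adjoint,
      ContinuousLinearMap.adjoint_inner_right]
  exact (sq_eq_sq₀ (norm_nonneg _) (norm_nonneg _)).1 this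

/-- Polar decomposition. -/
theorem exists_polar (A : V →L[ℂ] V) : ∃ U : V →L[ℂ] V, ‖U‖ ≤ 1 ∧
    (∀ x, U (CFC.abs A x) = A x) ∧
    ∀ x, ContinuousLinearMap.adjoint U (A x) = CFC.abs A x := by
  let K : Submodule ℂ V := (LinearMap.range (CFC.abs A).toLinearMap).topologicalClosure
  have hK : ∀ x, (CFC.abs A).toLinearMap x ∈ K := fun x =>
    Submodule.le_topologicalClosure _ (LinearMap.mem_range_self _ x)
  let e : V →ₗ[ℂ] K := (CFC.abs A).toLinearMap.codRestrict K hK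
  have hd : DenseRange e := by
    intro y
    rw [closure_subtype]
    have hy : (y : V) ∈ closure (Set.range fun x => CFC.abs A x) := y.2
    convert hy using 2
    ext z
    constructor
    · rintro ⟨_, ⟨x, rfl⟩, rfl⟩
      exact ⟨x, rfl⟩
    · rintro ⟨x, rfl⟩
      exact ⟨e x, ⟨x, rfl⟩, rfl⟩
  have hn : ∀ x, ‖A.toLinearMap x‖ ≤ 1 * ‖e x‖ := fun x => by
    rw [one_mul]
    exact (norm_abs_apply A x).ge
  let W : K →L[ℂ] V := A.toLinearMap.extendOfNorm e
  have hW : ∀ x, W (e x) = A x := fun x => LinearMap.extendOfNorm_eq hd ⟨1, hn⟩ x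
  have hWn : ‖W‖ ≤ 1 := ContinuousLinearMap.opNorm_le_bound _ zero_le_one fun x =>
    LinearMap.norm_extendOfNorm_apply_le hd 1 hn x
  have : CompleteSpace K :=
    (Submodule.isClosed_topologicalClosure _).completeSpace_coe
  let U : V →L[ℂ] V := W.comp K.orthogonalProjectionOnto
  have hU : ‖U‖ ≤ 1 := by
    refine (ContinuousLinearMap.opNorm_comp_le _ _).trans ?_
    exact mul_le_one₀ hWn (norm_nonneg _) (Submodule.orthogonalProjectionOnto_norm_le K)
  have hUA : ∀ x, U (CFC.abs A x) = A x := fun x => by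
    have : K.orthogonalProjectionOnto (CFC.abs A x) = e x :=
      Submodule.orthogonalProjectionOnto_mem_subspace_eq_self (e x)
    simp only [U, ContinuousLinearMap.comp_apply, this, hW]
  refine ⟨U, hU, hUA, fun x => ?_⟩
  have h1 : ‖ContinuousLinearMap.adjoint U (A x) - CFC.abs A x‖ ^ 2 ≤ 0 := by
    rw [norm_sub_sq (𝕜 := ℂ), ContinuousLinearMap.adjoint_inner_left, hUA,
      inner_self_eq_norm_sq, norm_abs_apply]
    have : ‖ContinuousLinearMap.adjoint U (A x)‖ ≤ ‖A x‖ := by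
      refine (ContinuousLinearMap.le_opNorm _ _).trans ?_
      rw [LinearIsometryEquiv.norm_map]
      exact mul_le_of_le_one_left (norm_nonneg _) hU
    nlinarith [norm_nonneg (ContinuousLinearMap.adjoint U (A x))]
  have h2 : ‖ContinuousLinearMap.adjoint U (A x) - CFC.abs A x‖ = 0 := by
    nlinarith [norm_nonneg (ContinuousLinearMap.adjoint U (A x) - CFC.abs A x)]
  exact sub_eq_zero.1 (norm_eq_zero.1 h2)

theorem tsum_inner_le {ι : Type*} (e : HilbertBasis ι ℂ V) (A X Y : V →L[ℂ] V) :
    ∑' j, ‖inner ℂ (X (e j)) (A (Y (e j)))‖ₑ ≤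
      (‖X‖ₑ ^ 2 + ‖Y‖ₑ ^ 2) / 2 * eTraceNorm A := by
  obtain ⟨W, hW, hWA, -⟩ := exists_polar A
  have hW' : ‖ContinuousLinearMap.adjoint W‖ ≤ 1 := by rwa [LinearIsometryEquiv.norm_map]
  set Z := (ContinuousLinearMap.adjoint W).comp X with hZ
  have hZX : ‖Z‖ₑ ≤ ‖X‖ₑ := by
    rw [← ofReal_norm, ← ofReal_norm]
    refine ENNReal.ofReal_le_ofReal ((ContinuousLinearMap.opNorm_comp_le _ _).trans ?_)
    exact mul_le_of_le_one_left (norm_nonneg _) hW'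
  have key : ∀ x, ‖inner ℂ (X x) (A (Y x))‖ₑ ≤
      (‖sqrtAbs A (Z x)‖ₑ ^ 2 + ‖sqrtAbs A (Y x)‖ₑ ^ 2) / 2 := by
    intro x
    have e1 : inner ℂ (X x) (A (Y x)) = inner ℂ (sqrtAbs A (Z x)) (sqrtAbs A (Y x)) := by
      rw [← hWA, ← ContinuousLinearMap.adjoint_inner_left, ← sqrtAbs_sq,
        mul_apply_eq_comp]
      conv_lhs => rw [← adjoint_sqrtAbs A]
      rw [ContinuousLinearMap.adjoint_inner_right, adjoint_sqrtAbs]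
      rfl
    have e2 : ‖inner ℂ (X x) (A (Y x))‖ ≤
        (‖sqrtAbs A (Z x)‖ ^ 2 + ‖sqrtAbs A (Y x)‖ ^ 2) / 2 := by
      rw [e1]
      refine (norm_inner_le_norm _ _).trans ?_
      nlinarith [sq_nonneg (‖sqrtAbs A (Z x)‖ - ‖sqrtAbs A (Y x)‖)]
    rw [← ofReal_norm, ← ofReal_norm, ← ofReal_norm,
      ← ENNReal.ofReal_pow (norm_nonneg _), ← ENNReal.ofReal_pow (norm_nonneg _),
      ← ENNReal.ofReal_add (by positivity) (by positivity),
      ← ENNReal.ofReal_ofNat 2, ← ENNReal.ofReal_div_of_pos two_pos]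
    exact ENNReal.ofReal_le_ofReal e2
  calc ∑' j, ‖inner ℂ (X (e j)) (A (Y (e j)))‖ₑ
      ≤ ∑' j, (‖sqrtAbs A (Z (e j))‖ₑ ^ 2 + ‖sqrtAbs A (Y (e j))‖ₑ ^ 2) / 2 :=
        ENNReal.tsum_le_tsum fun j => key _
    _ = (∑' j, ‖sqrtAbs A (Z (e j))‖ₑ ^ 2 + ∑' j, ‖sqrtAbs A (Y (e j))‖ₑ ^ 2) / 2 := by
        simp_rw [div_eq_mul_inv]
        rw [ENNReal.tsum_mul_right, ENNReal.tsum_add]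
    _ ≤ (‖X‖ₑ ^ 2 * eTraceNorm A + ‖Y‖ₑ ^ 2 * eTraceNorm A) / 2 := by
        rw [← traceSum_eq e A, traceSum_eq_tsum]
        gcongr
        · refine (tsum_enorm_sq_comp_le e _ _).trans ?_
          gcongr
        · exact tsum_enorm_sq_comp_le e _ _
    _ = _ := by rw [← add_mul, div_eq_mul_inv, div_eq_mul_inv]; ring

theorem eTraceNorm_eq_of_polar {A U : V →L[ℂ] V}
    (h : ∀ x, ContinuousLinearMap.adjoint U (A x) = CFC.abs A x) :
    eTraceNorm A = ∑' j, ‖inner ℂ (U (cons V j)) (A (cons V j))‖ₑ := by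
  refine tsum_congr fun j => ?_
  rw [← ContinuousLinearMap.adjoint_inner_right, h, ← ofReal_norm]
  congr 1
  have hs : ContinuousLinearMap.adjoint (sqrtAbs A) = sqrtAbs A := adjoint_sqrtAbs A
  have : inner ℂ (cons V j) (CFC.abs A (cons V j)) = ((‖sqrtAbs A (cons V j)‖ ^ 2 : ℝ) : ℂ) := by
    rw [← sqrtAbs_sq, mul_apply_eq_comp]
    conv_lhs => rw [← hs]
    rw [ContinuousLinearMap.adjoint_inner_right, hs, inner_self_eq_norm_sq_to_K]
    simp
  rw [this, Complex.ofReal_re, Complex.norm_real, Real.norm_of_nonneg (by positivity)]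

theorem tsum_inner_le_of_le_one (A X Y : V →L[ℂ] V) (hX : ‖X‖ ≤ 1) (hY : ‖Y‖ ≤ 1) :
    ∑' j, ‖inner ℂ (X (cons V j)) (A (Y (cons V j)))‖ₑ ≤ eTraceNorm A := by
  refine (tsum_inner_le (cons V) A X Y).trans ?_
  have h1 : ∀ Z : V →L[ℂ] V, ‖Z‖ ≤ 1 → ‖Z‖ₑ ^ 2 ≤ 1 := fun Z hZ => by
    rw [← ofReal_norm]
    exact pow_le_one' (ENNReal.ofReal_le_one.2 hZ) 2
  calc (‖X‖ₑ ^ 2 + ‖Y‖ₑ ^ 2) / 2 * eTraceNorm A ≤ (1 + 1) / 2 * eTraceNorm A := by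
        gcongr
        · exact h1 X hX
        · exact h1 Y hY
    _ = eTraceNorm A := by
        rw [one_add_one_eq_two, ENNReal.div_self two_ne_zero ENNReal.ofNat_ne_top, one_mul]

theorem norm_one_le : ‖(1 : V →L[ℂ] V)‖ ≤ 1 := ContinuousLinearMap.norm_id_le

theorem eTraceNorm_add_le (A B : V →L[ℂ] V) :
    eTraceNorm (A + B) ≤ eTraceNorm A + eTraceNorm B := by
  obtain ⟨U, hU, -, h⟩ := exists_polar (A + B)
  rw [eTraceNorm_eq_of_polar h]
  calc ∑' j, ‖inner ℂ (U (cons V j)) ((A + B) (cons V j))‖ₑ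
      ≤ ∑' j, (‖inner ℂ (U (cons V j)) (A (cons V j))‖ₑ +
          ‖inner ℂ (U (cons V j)) (B (cons V j))‖ₑ) := by
        refine ENNReal.tsum_le_tsum fun j => ?_
        rw [add_apply, inner_add_right]
        exact enorm_add_le _ _
    _ ≤ _ := by
        rw [ENNReal.tsum_add]
        exact add_le_add (tsum_inner_le_of_le_one A U 1 hU norm_one_le)
          (tsum_inner_le_of_le_one B U 1 hU norm_one_le)

theorem eTraceNorm_smul (c : ℂ) (A : V →L[ℂ] V) :
    eTraceNorm (c • A) = ‖c‖ₑ * eTraceNorm A := by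
  unfold eTraceNorm traceSum
  rw [← ENNReal.tsum_mul_left]
  refine tsum_congr fun j => ?_
  rw [CFC.abs_smul, ← ofReal_norm, ← ENNReal.ofReal_mul (norm_nonneg _)]
  congr 1
  rw [smul_apply, inner_smul_right_eq_smul]
  simp

theorem enorm_le_eTraceNorm (A : V →L[ℂ] V) : ‖A‖ₑ ≤ eTraceNorm A := by
  by_cases hA : eTraceNorm A = ∞
  · simp [hA]
  have hS : ‖sqrtAbs A‖ ^ 2 ≤ (eTraceNorm A).toReal := by
    have : ‖sqrtAbs A‖ ≤ √(eTraceNorm A).toReal := by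
      refine ContinuousLinearMap.opNorm_le_bound _ (Real.sqrt_nonneg _) fun x => ?_
      rw [← sq_le_sq₀ (norm_nonneg _) (by positivity), mul_pow, Real.sq_sqrt (by positivity)]
      have h1 : ‖sqrtAbs A x‖ₑ ^ 2 ≤ eTraceNorm A * ‖x‖ₑ ^ 2 := by
        rw [← tsum_enorm_inner_sq (cons V), ← traceSum_eq (cons V) A, traceSum_eq_tsum,
          ← ENNReal.tsum_mul_right]
        refine ENNReal.tsum_le_tsum fun j => ?_
        rw [← adjoint_sqrtAbs, ContinuousLinearMap.adjoint_inner_right, adjoint_sqrtAbs, ← mul_pow]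
        gcongr
        rw [← ofReal_norm, ← ofReal_norm, ← ofReal_norm,
          ← ENNReal.ofReal_mul (norm_nonneg _)]
        exact ENNReal.ofReal_le_ofReal (norm_inner_le_norm _ _)
      have h2 := ENNReal.toReal_mono
        (ENNReal.mul_ne_top hA (ENNReal.pow_ne_top enorm_ne_top)) h1
      simpa [ENNReal.toReal_mul, ENNReal.toReal_pow] using h2
    calc ‖sqrtAbs A‖ ^ 2 ≤ √(eTraceNorm A).toReal ^ 2 := by gcongr
      _ = _ := Real.sq_sqrt (by positivity)
  have h3 : ‖A‖ ≤ (eTraceNorm A).toReal := by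
    rw [← CFC.norm_abs, ← sqrtAbs_sq]
    refine (norm_mul_le _ _).trans ?_
    rwa [← sq]
  rw [← ofReal_norm]
  exact ENNReal.ofReal_le_of_le_toReal h3

theorem eTraceNorm_eq_zero {A : V →L[ℂ] V} (h : eTraceNorm A = 0) : A = 0 := by
  have := enorm_le_eTraceNorm A
  rw [h] at this
  simpa using this

theorem eTraceNorm_zero : eTraceNorm (0 : V →L[ℂ] V) = 0 := by
  simp [eTraceNorm, traceSum]

theorem eTraceNorm_conj_lt_top {A : V →L[ℂ] V} (hA : eTraceNorm A < ∞) (B C : V →L[ℂ] V) :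
    eTraceNorm (B * A * C) < ∞ := by
  obtain ⟨U, hU, -, h⟩ := exists_polar (B * A * C)
  rw [eTraceNorm_eq_of_polar h]
  refine lt_of_le_of_lt (le_of_eq ?_) (lt_of_le_of_lt
    (tsum_inner_le (cons V) A ((ContinuousLinearMap.adjoint B).comp U) C) ?_)
  · refine tsum_congr fun j => ?_
    rw [ContinuousLinearMap.comp_apply, ContinuousLinearMap.adjoint_inner_left]
    rfl
  · refine ENNReal.mul_lt_top (ENNReal.div_lt_top ?_ two_ne_zero) hA
    exact ENNReal.add_ne_top.2 ⟨ENNReal.pow_ne_top enorm_ne_top, ENNReal.pow_ne_top enorm_ne_top⟩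

theorem eTraceNorm_rankOne_lt_top (f g : V) :
    eTraceNorm (InnerProductSpace.rankOne ℂ f g) < ∞ := by
  obtain ⟨U, hU, -, h⟩ := exists_polar (InnerProductSpace.rankOne ℂ f g)
  rw [eTraceNorm_eq_of_polar h]
  have key : ∀ j, ‖inner ℂ (U (cons V j)) (InnerProductSpace.rankOne ℂ f g (cons V j))‖ₑ ≤
      ‖inner ℂ (cons V j) g‖ₑ ^ 2 + ‖inner ℂ (cons V j) (ContinuousLinearMap.adjoint U f)‖ₑ ^ 2 := by
    intro j
    rw [InnerProductSpace.rankOne_apply, inner_smul_right,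
      ContinuousLinearMap.adjoint_inner_right, ← inner_conj_symm g]
    rw [← ofReal_norm, ← ofReal_norm, ← ofReal_norm,
      ← ENNReal.ofReal_pow (norm_nonneg _), ← ENNReal.ofReal_pow (norm_nonneg _),
      ← ENNReal.ofReal_add (by positivity) (by positivity), norm_mul, RCLike.norm_conj]
    refine ENNReal.ofReal_le_ofReal ?_
    nlinarith [sq_nonneg (‖inner ℂ (cons V j) g‖ - ‖inner ℂ (U (cons V j)) f‖),
      sq_nonneg (‖inner ℂ (cons V j) g‖), sq_nonneg (‖inner ℂ (U (cons V j)) f‖)]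
  refine lt_of_le_of_lt (ENNReal.tsum_le_tsum key) ?_
  rw [ENNReal.tsum_add, tsum_enorm_inner_sq, tsum_enorm_inner_sq]
  exact ENNReal.add_lt_top.2 ⟨by simp, by simp⟩

/-- The trace-class operators, as a subspace of the bounded operators. -/
def traceClassSubmodule (V : Type*) [NormedAddCommGroup V] [InnerProductSpace ℂ V]
    [CompleteSpace V] : Submodule ℂ (V →L[ℂ] V) where
  carrier := {A | eTraceNorm A < ∞}
  add_mem' hA hB := (eTraceNorm_add_le _ _).trans_lt (ENNReal.add_lt_top.2 ⟨hA, hB⟩)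
  zero_mem' := by simp [eTraceNorm_zero]
  smul_mem' c A hA := by
    simp only [Set.mem_ofPred_eq, eTraceNorm_smul]
    exact ENNReal.mul_lt_top enorm_lt_top hA

end HilbertTrace

open HilbertTrace

/-- The space of trace-class operators on `V`; it carries the trace norm. -/
def TraceClass (V : Type*) [NormedAddCommGroup V] [InnerProductSpace ℂ V]
    [CompleteSpace V] : Type _ := traceClassSubmodule V

namespace TraceClass

variable {V : Type*} [NormedAddCommGroup V] [InnerProductSpace ℂ V] [CompleteSpace V]

instance : AddCommGroup (TraceClass V) := inferInstanceAs (AddCommGroup (traceClassSubmodule V))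

instance : Module ℂ (TraceClass V) := inferInstanceAs (Module ℂ (traceClassSubmodule V))

/-- The underlying bounded operator. -/
def toCLM : TraceClass V →ₗ[ℂ] (V →L[ℂ] V) := (traceClassSubmodule V).subtype

theorem toCLM_injective : Function.Injective (toCLM : TraceClass V → (V →L[ℂ] V)) :=
  Subtype.val_injective

/-- An operator of finite trace norm as an element of the space of trace-class operators. -/
def ofCLM (A : V →L[ℂ] V) (hA : eTraceNorm A < ∞) : TraceClass V := ⟨A, hA⟩

@[simp]
theorem toCLM_ofCLM (A : V →L[ℂ] V) (hA : eTraceNorm A < ∞) : toCLM (ofCLM A hA) = A := rfl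

theorem eTraceNorm_lt_top (A : TraceClass V) : eTraceNorm (toCLM A) < ∞ := A.2

/-- The trace norm. -/
instance : Norm (TraceClass V) := ⟨fun A => (eTraceNorm (toCLM A)).toReal⟩

theorem norm_def (A : TraceClass V) : ‖A‖ = (eTraceNorm (toCLM A)).toReal := rfl

theorem normedSpaceCore : NormedSpace.Core ℂ (TraceClass V) where
  norm_nonneg _ := ENNReal.toReal_nonneg
  norm_smul c A := by
    rw [norm_def, norm_def, map_smul, eTraceNorm_smul, ENNReal.toReal_mul, toReal_enorm]
  norm_triangle A B := by
    rw [norm_def, norm_def, norm_def, map_add,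
      ← ENNReal.toReal_add (eTraceNorm_lt_top A).ne (eTraceNorm_lt_top B).ne]
    exact ENNReal.toReal_mono
      (ENNReal.add_ne_top.2 ⟨(eTraceNorm_lt_top A).ne, (eTraceNorm_lt_top B).ne⟩)
      (eTraceNorm_add_le _ _)
  norm_eq_zero_iff A := by
    rw [norm_def, ENNReal.toReal_eq_zero_iff]
    constructor
    · rintro (h | h)
      · exact toCLM_injective (by rw [eTraceNorm_eq_zero h, map_zero])
      · exact absurd h (eTraceNorm_lt_top A).ne
    · rintro rfl
      left
      rw [map_zero, eTraceNorm_zero]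

instance : NormedAddCommGroup (TraceClass V) := NormedAddCommGroup.ofCore normedSpaceCore

instance : NormedSpace ℂ (TraceClass V) := NormedSpace.ofCore normedSpaceCore

theorem enorm_def (A : TraceClass V) : ‖A‖ₑ = eTraceNorm (toCLM A) := by
  rw [← ofReal_norm, norm_def, ENNReal.ofReal_toReal (eTraceNorm_lt_top A).ne]

instance : CompleteSpace (TraceClass V) := by
  refine Metric.complete_of_cauchySeq_tendsto fun u hu => ?_
  have hop : ∀ A : TraceClass V, ‖toCLM A‖ ≤ ‖A‖ := fun A => by
    have h := enorm_le_eTraceNorm (toCLM A)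
    rw [← enorm_def] at h
    simpa using ENNReal.toReal_mono enorm_ne_top h
  have hc : CauchySeq fun n => toCLM (u n) := by
    rw [Metric.cauchySeq_iff] at hu ⊢
    intro ε hε
    obtain ⟨N, hN⟩ := hu ε hε
    refine ⟨N, fun m hm n hn => lt_of_le_of_lt ?_ (hN m hm n hn)⟩
    rw [dist_eq_norm, dist_eq_norm, ← map_sub]
    exact hop _
  obtain ⟨A, hA⟩ := cauchySeq_tendsto_of_complete hc
  have key : ∀ ε : ℝ, 0 < ε → ∃ N, ∀ n ≥ N, eTraceNorm (A - toCLM (u n)) ≤ ENNReal.ofReal ε := by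
    intro ε hε
    obtain ⟨N, hN⟩ := Metric.cauchySeq_iff.1 hu ε hε
    refine ⟨N, fun n hn => ?_⟩
    obtain ⟨U, hU, -, h⟩ := exists_polar (A - toCLM (u n))
    rw [eTraceNorm_eq_of_polar h]
    rw [ENNReal.tsum_eq_iSup_sum]
    refine iSup_le fun F => ?_
    have hlim : Filter.Tendsto
        (fun m => ∑ j ∈ F, ‖inner ℂ (U (cons V j)) ((toCLM (u m) - toCLM (u n)) (cons V j))‖ₑ)
        Filter.atTop
        (𝓝 (∑ j ∈ F, ‖inner ℂ (U (cons V j)) ((A - toCLM (u n)) (cons V j))‖ₑ)) := by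
      refine tendsto_finsetSum _ fun j _ => ?_
      have h1 : Filter.Tendsto (fun m => (toCLM (u m) - toCLM (u n)) (cons V j)) Filter.atTop
          (𝓝 ((A - toCLM (u n)) (cons V j))) :=
        ((ContinuousLinearMap.apply ℂ V (cons V j)).continuous.tendsto _).comp
          (hA.sub_const (toCLM (u n)))
      exact (tendsto_const_nhds.inner h1).enorm
    refine le_of_tendsto hlim (Filter.eventually_atTop.2 ⟨N, fun m hm => ?_⟩)
    refine (ENNReal.sum_le_tsum F).trans
      ((tsum_inner_le_of_le_one (toCLM (u m) - toCLM (u n)) U 1 hU norm_one_le).trans ?_)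
    rw [← map_sub, ← enorm_def, ← ofReal_norm]
    have := hN m hm n hn
    rw [dist_eq_norm] at this
    exact ENNReal.ofReal_le_ofReal this.le
  have hAt : eTraceNorm A < ∞ := by
    obtain ⟨N, hN⟩ := key 1 one_pos
    have h1 := eTraceNorm_add_le (A - toCLM (u N)) (toCLM (u N))
    rw [sub_add_cancel] at h1
    exact h1.trans_lt (ENNReal.add_lt_top.2
      ⟨(hN N le_rfl).trans_lt ENNReal.ofReal_lt_top, eTraceNorm_lt_top _⟩)
  refine ⟨ofCLM A hAt, Metric.tendsto_atTop.2 fun ε hε => ?_⟩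
  obtain ⟨N, hN⟩ := key (ε / 2) (half_pos hε)
  refine ⟨N, fun n hn => ?_⟩
  rw [dist_comm, dist_eq_norm, norm_def, map_sub, toCLM_ofCLM]
  exact (ENNReal.toReal_le_of_le_ofReal (half_pos hε).le (hN n hn)).trans_lt (half_lt_self hε)

/-- The operator `B A C`, which is of trace class whenever `A` is. -/
def conj (B : V →L[ℂ] V) (A : TraceClass V) (C : V →L[ℂ] V) : TraceClass V :=
  ofCLM (B * toCLM A * C) (eTraceNorm_conj_lt_top (eTraceNorm_lt_top A) B C)

/-- The operator `f ⊗ g`, that is, `h ↦ ⟨h, g⟩ f` with an inner product which is linear in its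
first argument. -/
def outer (f g : V) : TraceClass V :=
  ofCLM (InnerProductSpace.rankOne ℂ f g) (eTraceNorm_rankOne_lt_top f g)

end TraceClass


open MeasureTheory Filter

/-- The Euclidean space `ℝ^d`. -/
abbrev Rd (d : ℕ) : Type := EuclideanSpace ℝ (Fin d)

/-! ### Finitely supported measures and the spaces `Λ_k` -/

/-- Complex measures on `ℝ^d` with finite support: `λ = ∑ c_i δ_{t_i}` is the finitely supported
function with `λ t_i = c_i`. -/
abbrev FinMeas (d : ℕ) : Type := Rd d →₀ ℂ

/-- The value of a polynomial in `d` variables at a point of `ℝ^d`. -/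
def polyEval {d : ℕ} (p : MvPolynomial (Fin d) ℂ) (t : Rd d) : ℂ :=
  MvPolynomial.eval (fun i => (t i : ℂ)) p

/-- The space `Λ_k` of the finitely supported complex measures that annihilate all polynomials of
degree at most `k`. -/
def Lam (d k : ℕ) : Submodule ℂ (FinMeas d) where
  carrier := {l | ∀ p : MvPolynomial (Fin d) ℂ, p.totalDegree ≤ k →
    (l.sum fun t c => c * polyEval p t) = 0}
  add_mem' {a b} ha hb p hp := by
    rw [Finsupp.sum_add_index' (by simp) (by intros; ring), ha p hp, hb p hp, add_zero]
  zero_mem' p hp := by simp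
  smul_mem' c a ha p hp := by
    rw [Finsupp.sum_smul_index (by simp)]
    simp_rw [mul_assoc]
    rw [← Finsupp.mul_sum, ha p hp, mul_zero]

theorem totalDegree_bind_le {d : ℕ} (f : Fin d → MvPolynomial (Fin d) ℂ)
    (hf : ∀ i, (f i).totalDegree ≤ 1) (p : MvPolynomial (Fin d) ℂ) :
    (MvPolynomial.bind₁ f p).totalDegree ≤ p.totalDegree := by
  rw [MvPolynomial.bind₁, MvPolynomial.aeval_def, MvPolynomial.eval₂_eq]
  refine MvPolynomial.totalDegree_finsetSum_le fun m hm => ?_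
  refine (MvPolynomial.totalDegree_mul _ _).trans ?_
  rw [MvPolynomial.algebraMap_eq, MvPolynomial.totalDegree_C, zero_add]
  refine (MvPolynomial.totalDegree_finsetProd _ _).trans ?_
  refine le_trans (Finset.sum_le_sum fun i _ => ?_) (MvPolynomial.le_totalDegree hm)
  exact (MvPolynomial.totalDegree_pow _ _).trans (mul_le_of_le_one_right (Nat.zero_le _) (hf i))

theorem mapDomain_mem_Lam {d k : ℕ} {l : FinMeas d} (hl : l ∈ Lam d k) (g : Rd d → Rd d)
    (f : Fin d → MvPolynomial (Fin d) ℂ) (hf : ∀ i, (f i).totalDegree ≤ 1)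
    (hfg : ∀ i t, polyEval (f i) t = (g t i : ℂ)) : l.mapDomain g ∈ Lam d k := by
  intro p hp
  rw [Finsupp.sum_mapDomain_index (by simp) (by intros; ring),
    ← hl (MvPolynomial.bind₁ f p) ((totalDegree_bind_le f hf p).trans hp)]
  refine Finsupp.sum_congr fun t _ => ?_
  have : polyEval (MvPolynomial.bind₁ f p) t = polyEval p (g t) := by
    unfold polyEval
    rw [← MvPolynomial.coe_aeval_eq_eval, RingHom.coe_coe, MvPolynomial.aeval_bind₁,
      ← MvPolynomial.coe_aeval_eq_eval, RingHom.coe_coe]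
    congr 2
    ext i
    have := hfg i t
    rwa [polyEval, ← MvPolynomial.coe_aeval_eq_eval, RingHom.coe_coe] at this
  rw [this]

/-- The translated measure `w + λ = ∑ c_i δ_{w + t_i}`. -/
def shiftMeas {d k : ℕ} (w : Rd d) (l : Lam d k) : Lam d k :=
  ⟨l.1.mapDomain fun t => w + t, mapDomain_mem_Lam l.2 _
    (fun i => MvPolynomial.C (w i : ℂ) + MvPolynomial.X i)
    (fun i => (MvPolynomial.totalDegree_add _ _).trans (by simp))
    (fun i t => by simp [polyEval])⟩

/-- The scaleMeasd measure `c · λ = ∑ c_i δ_{c t_i}`. -/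
def scaleMeas {d k : ℕ} (c : ℝ) (l : Lam d k) : Lam d k :=
  ⟨l.1.mapDomain fun t => c • t, mapDomain_mem_Lam l.2 _
    (fun i => MvPolynomial.C (c : ℂ) * MvPolynomial.X i)
    (fun i => (MvPolynomial.totalDegree_mul _ _).trans (by simp))
    (fun i t => by simp [polyEval])⟩

/-- The exponents of the monomials of degree at most `k` in `d` variables. -/
abbrev Exponents (d k : ℕ) : Type := {m : Fin d → Fin (k + 1) // ∑ i, (m i : ℕ) ≤ k}

/-- The monomial `t ↦ t_1 ^ m_1 ⋯ t_d ^ m_d`. -/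
def monomialFun {d k : ℕ} (m : Exponents d k) (t : Rd d) : ℝ := ∏ i, t i ^ (m.1 i : ℕ)

/-- The matrix of the values of the monomials of degree at most `k` at the points `pt`. -/
def monomialMatrix {d k : ℕ} (pt : Exponents d k → Rd d) :
    Matrix (Exponents d k) (Exponents d k) ℝ :=
  Matrix.of fun m j => monomialFun m (pt j)

/-- The coefficients `B⁻¹ b(t)`, where `B` is the matrix of the monomials at the points `pt` and
`b(t)` is the vector of the monomials at `t`. -/
def monomialCoeff {d k : ℕ} (pt : Exponents d k → Rd d) (t : Rd d) : Exponents d k → ℝ :=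
  (monomialMatrix pt)⁻¹.mulVec fun m => monomialFun m t

theorem mem_Lam_of_monomialFun {d k : ℕ} {l : FinMeas d}
    (h : ∀ m : Exponents d k, (l.sum fun t c => c * (monomialFun m t : ℂ)) = 0) :
    l ∈ Lam d k := by
  intro p hp
  have e : ∀ t, polyEval p t = ∑ m ∈ p.support, p.coeff m * ∏ i, (t i : ℂ) ^ m i := fun t => by
    rw [polyEval, MvPolynomial.eval_eq']
  simp_rw [e, Finset.mul_sum]
  rw [Finsupp.sum, Finset.sum_comm]
  refine Finset.sum_eq_zero fun m hm => ?_
  have hdeg : ∑ i, m i ≤ k := by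
    refine le_trans ?_ ((MvPolynomial.le_totalDegree hm).trans hp)
    rw [Finsupp.sum_fintype _ _ (by simp)]
  have hle : ∀ i, m i < k + 1 := fun i => Nat.lt_succ_of_le
    ((Finset.single_le_sum (f := fun i => m i) (fun _ _ => Nat.zero_le _) (Finset.mem_univ i)).trans
      hdeg)
  have := h ⟨fun i => ⟨m i, hle i⟩, hdeg⟩
  rw [Finsupp.sum] at this
  calc ∑ t ∈ l.support, l t * (p.coeff m * ∏ i, (t i : ℂ) ^ m i)
      = p.coeff m * ∑ t ∈ l.support, l t * ∏ i, (t i : ℂ) ^ m i := by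
        rw [Finset.mul_sum]
        exact Finset.sum_congr rfl fun t _ => by ring
    _ = 0 := by
        simp only [monomialFun, Complex.ofReal_prod, Complex.ofReal_pow] at this
        rw [this, mul_zero]

/-- The measure `λ_t = δ_t - (δ_{t_1}, …, δ_{t_M}) B⁻¹ b(t)`, for points `t_1, …, t_M` at which the
matrix `B` of the monomials of degree at most `k` is invertible. -/
def evalMeas {d k : ℕ} (pt : Exponents d k → Rd d) (hpt : (monomialMatrix pt).det ≠ 0)
    (t : Rd d) : Lam d k :=
  ⟨Finsupp.single t 1 - ∑ j, Finsupp.single (pt j) (monomialCoeff pt t j : ℂ), by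
    refine mem_Lam_of_monomialFun fun m => ?_
    have hlin : ∀ a b : FinMeas d, ((a - b).sum fun t c => c * (monomialFun m t : ℂ)) =
        (a.sum fun t c => c * (monomialFun m t : ℂ)) -
          b.sum fun t c => c * (monomialFun m t : ℂ) := fun a b =>
      Finsupp.sum_sub_index (by intros; ring)
    rw [hlin, ← Finsupp.sum_finsetSum_index (by simp) (by intros; ring)]
    have hs : ∀ (t : Rd d) (c : ℂ), ((Finsupp.single t c : FinMeas d).sum
        fun t c => c * (monomialFun m t : ℂ)) = c * (monomialFun m t : ℂ) := fun t c =>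
      Finsupp.sum_single_index (zero_mul _)
    simp_rw [hs]
    have h1 : (monomialMatrix pt).mulVec (monomialCoeff pt t) = fun m => monomialFun m t := by
      rw [monomialCoeff, Matrix.mulVec_mulVec, Matrix.mul_nonsing_inv _ hpt.isUnit,
        Matrix.one_mulVec]
    have h2 := congrFun h1 m
    simp only [Matrix.mulVec, dotProduct, monomialMatrix, Matrix.of_apply] at h2
    rw [← h2, one_mul, sub_eq_zero]
    push_cast
    exact Finset.sum_congr rfl fun j _ => mul_comm _ _⟩

theorem linearIndependent_monomialFun (d k : ℕ) :
    LinearIndependent ℝ (fun m : Exponents d k => monomialFun m) := by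
  rw [Fintype.linearIndependent_iff]
  intro a ha m0
  let e : Exponents d k → (Fin d →₀ ℕ) := fun m => Finsupp.equivFunOnFinite.symm fun i => (m.1 i : ℕ)
  have he : Function.Injective e := by
    intro m m' h
    apply Subtype.ext
    funext i
    apply Fin.ext
    exact DFunLike.congr_fun h i
  let p : MvPolynomial (Fin d) ℝ := ∑ m, MvPolynomial.monomial (e m) (a m)
  have hp : p = 0 := by
    refine MvPolynomial.funext fun x => ?_
    have h := congrFun ha (WithLp.toLp 2 x)
    simp only [Finset.sum_apply, Pi.smul_apply, smul_eq_mul, Pi.zero_apply, monomialFun] at h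
    rw [map_zero, ← h, map_sum]
    refine Finset.sum_congr rfl fun m _ => ?_
    rw [MvPolynomial.eval_monomial, Finsupp.prod_fintype _ _ (by simp)]
    rfl
  have h0 : MvPolynomial.coeff (e m0) p = 0 := by rw [hp, MvPolynomial.coeff_zero]
  simp only [p, MvPolynomial.coeff_sum, MvPolynomial.coeff_monomial, he.eq_iff] at h0
  simpa using h0

/-- Points at which the matrix of the monomials is invertible exist. -/
theorem exists_det_monomialMatrix_ne_zero (d k : ℕ) :
    ∃ pt : Exponents d k → Rd d, (monomialMatrix pt).det ≠ 0 := by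
  let v : Rd d → (Exponents d k → ℝ) := fun t m => monomialFun m t
  have hspan : Submodule.span ℝ (Set.range v) = ⊤ := by
    by_contra hne
    obtain ⟨f, hf0, hf⟩ := Submodule.exists_le_ker_of_lt_top _ (lt_top_iff_ne_top.2 hne)
    apply hf0
    have h0 := Fintype.linearIndependent_iff.1 (linearIndependent_monomialFun d k)
      (fun m => f (Pi.single m 1)) (by
        funext t
        have ht : f (v t) = 0 := hf (Submodule.subset_span ⟨t, rfl⟩)
        rw [Pi.zero_apply, ← ht, pi_eq_sum_univ' (v t), map_sum]
        simp only [Finset.sum_apply, Pi.smul_apply, smul_eq_mul, map_smul, v]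
        exact Finset.sum_congr rfl fun m _ => mul_comm _ _)
    refine LinearMap.pi_ext' fun m => LinearMap.ext_ring ?_
    simpa using h0 m
  obtain ⟨κ, a, ha, hsp, hli⟩ := exists_linearIndependent' ℝ v
  rw [hspan] at hsp
  let b : Module.Basis κ ℝ (Exponents d k → ℝ) := Module.Basis.mk hli hsp.ge
  let ε : κ ≃ Exponents d k := b.indexEquiv (Pi.basisFun ℝ (Exponents d k))
  refine ⟨fun j => a (ε.symm j), ?_⟩
  have hli' : LinearIndependent ℝ fun j => (v ∘ a) (ε.symm j) :=
    hli.comp _ ε.symm.injective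
  have := (Matrix.linearIndependent_rows_iff_isUnit
    (A := (monomialMatrix fun j => a (ε.symm j)).transpose)).1 hli'
  rw [Matrix.isUnit_iff_isUnit_det, Matrix.det_transpose] at this
  exact this.ne_zero

/-! ### Operator-valued measures, covariances, intrinsic random functions -/

section IRF

variable {V : Type*} [NormedAddCommGroup V] [InnerProductSpace ℂ V] [CompleteSpace V]

/-- A measure with values in the trace-class operators (countably additive in trace norm, hence
finite) is positive if all its values are positive operators. -/
def IsPositiveMeasure {X : Type*} [MeasurableSpace X] (μ : VectorMeasure X (TraceClass V)) :
    Prop :=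
  ∀ A, (TraceClass.toCLM (μ A)).IsPositive

/-- The operator `r^A = exp(log(r) A)`. -/
def opPow (r : ℝ) (A : V →L[ℂ] V) : V →L[ℂ] V := NormedSpace.exp ((Real.log r : ℂ) • A)

/-- The cross-covariance operator `𝔼[X ⊗ Z]`, a Bochner integral in the trace norm. -/
def crossCov {Ω : Type*} [MeasurableSpace Ω] (P : Measure Ω) (X Z : Ω → V) : TraceClass V :=
  ∫ ω, TraceClass.outer (X ω) (Z ω) ∂P

variable {d k : ℕ} {Ω : Type*} [MeasurableSpace Ω]

/-- A second-order process indexed by `Λ_k` with linear paths: all its values have mean zero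
and a finite second moment. -/
def IsSecondOrder (P : Measure Ω) (Y : Ω → Lam d k →ₗ[ℂ] V) : Prop :=
  ∀ l, StronglyMeasurable (fun ω => Y ω l) ∧ MemLp (fun ω => Y ω l) 2 P ∧ ∫ ω, Y ω l ∂P = 0

/-- The operator cross-covariance function of a process indexed by `Λ_k`. -/
def covFun (P : Measure Ω) (Y : Ω → Lam d k →ₗ[ℂ] V) (l m : Lam d k) : TraceClass V :=
  crossCov P (fun ω => Y ω l) (fun ω => Y ω m)

/-- An intrinsic random function of order `k`: a second-order process indexed by `Λ_k` whose
covariance function is invariant under translations. -/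
def IsIRF (P : Measure Ω) (Y : Ω → Lam d k →ₗ[ℂ] V) : Prop :=
  IsSecondOrder P Y ∧
    ∀ (w : Rd d) (l m : Lam d k), covFun P Y l m = covFun P Y (shiftMeas w l) (shiftMeas w m)

/-- Mean-square continuity of a process indexed by `Λ_k`: its representation `t ↦ Y(λ_t)` is
continuous in `L²`. The measures `λ_t` depend on a choice of points; such points exist by
`exists_det_monomialMatrix_ne_zero`, and all of them are allowed here. -/
def IsMeanSquareContinuous (P : Measure Ω) (Y : Ω → Lam d k →ₗ[ℂ] V) : Prop :=
  ∀ (pt : Exponents d k → Rd d) (hpt : (monomialMatrix pt).det ≠ 0) (t : Rd d),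
    Tendsto (fun s => ∫⁻ ω, ‖Y ω (evalMeas pt hpt s) - Y ω (evalMeas pt hpt t)‖ₑ ^ 2 ∂P)
      (𝓝 t) (𝓝 0)

/-- `{Y(c · λ)}` and `{c^H Y(λ)}` have the same operator cross-covariance function for all
`c > 0`. -/
def IsCovSelfSimilar (H : V →L[ℂ] V) (P : Measure Ω) (Y : Ω → Lam d k →ₗ[ℂ] V) : Prop :=
  ∀ c : ℝ, 0 < c → ∀ l m : Lam d k,
    covFun P Y (scaleMeas c l) (scaleMeas c m) =
      crossCov P (fun ω => opPow c H (Y ω l)) (fun ω => opPow c H (Y ω m))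

/-- For `λ = ∑ c_j δ_{t_j}` and `μ = ∑ d_i δ_{s_i}`, the operator
`K(λ * μ̃) = ∑_j ∑_i c_j (conj d_i) K(t_j - s_i)`. -/
def kernelForm (K : Rd d → TraceClass V) (l m : FinMeas d) : TraceClass V :=
  l.sum fun t c => m.sum fun s e => (c * (starRingEnd ℂ) e) • K (t - s)

/-- `K` is a generalized covariance of the process `Y` indexed by `Λ_k`. -/
def IsGeneralizedCov (P : Measure Ω) (Y : Ω → Lam d k →ₗ[ℂ] V) (K : Rd d → TraceClass V) :
    Prop :=
  ∀ l m : Lam d k, covFun P Y l m = kernelForm K l.1 m.1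

/-- Conditional positive definiteness of degree `k`. -/
def IsCondPosDef (k : ℕ) (K : Rd d → TraceClass V) : Prop :=
  ∀ l : Lam d k, (TraceClass.toCLM (kernelForm K l.1 l.1)).IsPositive

/-- A polynomial of degree at most `n` on `ℝ^d` with trace-class operators as coefficients. -/
def IsOpPolynomial (n : ℕ) (Q : Rd d → TraceClass V) : Prop :=
  ∃ a : Exponents d n → TraceClass V, ∀ h, Q h = ∑ m, monomialFun m h • a m

/-- The function `u ↦ (e^{i u·h} - 1_B(u) P(u·h)) / (1 ∧ ‖u‖^{2k+2})`, where
`P(x) = ∑_{j ≤ 2k+1} (i x)^j / j!`. -/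
def spectralIntegrand (k : ℕ) (B : Set (Rd d)) (h u : Rd d) : ℂ :=
  (Complex.exp (Complex.I * (inner ℝ u h : ℝ)) -
      B.indicator (fun v => ∑ j ∈ Finset.range (2 * k + 2),
        (Complex.I * (inner ℝ v h : ℝ)) ^ j / (j.factorial : ℂ)) u) /
    (min 1 (‖u‖ ^ (2 * k + 2)) : ℝ)

/-- The kernel
`K(h) = ∫ (e^{i u·h} - 1_B(u) P(u·h)) / (1 ∧ ‖u‖^{2k+2}) χ(du) + Q(h)`. -/
def spectralKernel (k : ℕ) (B : Set (Rd d)) (χ : VectorMeasure (Rd d) (TraceClass V))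
    (Q : Rd d → TraceClass V) (h : Rd d) : TraceClass V :=
  χ.integral (spectralIntegrand k B h) (ContinuousLinearMap.lsmul ℝ ℂ) + Q h

/-- `(χ, Q)` are the spectral characteristics of the process `Y` indexed by `Λ_k`; the measure `χ`
is then the spectral measure of `Y`. -/
structure HasSpectralCharacteristics (P : Measure Ω) (Y : Ω → Lam d k →ₗ[ℂ] V)
    (χ : VectorMeasure (Rd d) (TraceClass V)) (Q : Rd d → TraceClass V) : Prop where
  pos : IsPositiveMeasure χ
  no_atom : χ {0} = 0
  polynomial : IsOpPolynomial (2 * k + 2) Q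
  condPosDef : IsCondPosDef k Q
  integrable : ∀ B : Set (Rd d), MeasurableSet B → Bornology.IsBounded B → B ∈ 𝓝 0 →
    ∀ h, χ.Integrable (spectralIntegrand k B h)
  cov : ∀ B : Set (Rd d), MeasurableSet B → Bornology.IsBounded B → B ∈ 𝓝 0 →
    IsGeneralizedCov P Y (spectralKernel k B χ Q)

/-- The integrand `(1 ∧ r^{2k+2}) r^{-H} σ{θ : r θ ∈ D} r^{-H*} r^{-1}`. -/
def polarIntegrand (k : ℕ) (H : V →L[ℂ] V)
    (σ : VectorMeasure (Metric.sphere (0 : Rd d) 1) (TraceClass V)) (D : Set (Rd d)) (r : ℝ) :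
    TraceClass V :=
  (min 1 (r ^ (2 * k + 2)) * r⁻¹) •
    TraceClass.conj (opPow r (-H)) (σ {θ | r • (θ : Rd d) ∈ D})
      (opPow r (-ContinuousLinearMap.adjoint H))

/-- `χ(dr dθ) = (1 ∧ r^{2k+2}) r^{-H} σ(dθ) r^{-H*} r^{-1} dr` in polar coordinates on
`ℝ^d \ {0}`, with no mass at the origin; the integrals are Bochner integrals in the trace norm. -/
def IsPolarMeasure (k : ℕ) (H : V →L[ℂ] V)
    (σ : VectorMeasure (Metric.sphere (0 : Rd d) 1) (TraceClass V))
    (χ : VectorMeasure (Rd d) (TraceClass V)) : Prop :=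
  ∀ D : Set (Rd d), MeasurableSet D →
    IntegrableOn (polarIntegrand k H σ D) (Set.Ioi 0) ∧
      χ D = ∫ r in Set.Ioi (0 : ℝ), polarIntegrand k H σ D r

end IRF

end

/-! Convergence. The spectrum of `H` is compact, so it keeps a positive distance `ε` from both edges
of the open strip. The growth of `exp(s a)` is controlled by the real parts of the spectrum of `a`
(`exists_norm_exp_smul_le`), hence `‖r^{-H}‖` is `O(r^{-(k+1-ε)})` as `r → 0` and `O(r^{-ε})` as `r
→ ∞`. Therefore `(1 ∧ r^{2k+2}) r^{-1} ‖r^{-H}‖²` is integrable on `(0, ∞)`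
(`integrableOn_weight_mul_norm_opPow_sq`), and this single function dominates all radial integrals.
Positivity of `χ` holds because `r^{-H} A r^{-H*}` has the form `B A B*`. For a positive measure the
trace is a finite scalar measure dominating the norms, so the variation is finite and bounded
measurable functions are integrable.

Covariance. Elements of `Λ_k` annihilate polynomials of degree at most `k`, so the Taylor correction
in the spectral kernel drops out of the double sum. What remains is `C(l, m) = ∫ \hat l \bar{\hat m}
/ (1 ∧ ‖u‖^{2k+2}) χ(du)`, whatever the neighborhood of `0` (`kernelForm_spectralKernel`). In this
form translation invariance is immediate, since characters are unimodular, and positive definiteness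
follows from that of `χ` (`posSemidef_covKer`).

Existence of the process. Only the first two moments are prescribed, so a discrete probability space
is enough. The reproducing kernel Hilbert space of `C` gives a factorization `C(l, m) = W(l) W(m)*`
with `W` linear in `l` (`kernelFactor_comp_adjoint`), and this space is separable. With a sequence
`f_n` satisfying Parseval's identity, a random index `n` of probability `2^{-(n+1)}` and an
independent random sign, the process `Y(l) = ± 2^{(n+1)/2} W(l) f_n` is centered with covariance `∑
W(l) f_n ⊗ W(m) f_n = C(l, m)` (`crossCov_signedSeq`).

Self-similarity. In polar coordinates the weight `1 ∧ r^{2k+2}` cancels, and `C(l, m)` is the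
integral of `r^{-H} (∫ \hat l(rθ) \bar{\hat m}(rθ) σ(dθ)) r^{-H*}` against `dr/r`. Scaling `l` and
`m` by `c` replaces `rθ` by `crθ`. Since `r^{-H} = c^H (cr)^{-H}` and `dr/r` is invariant under
dilations, the factors `c^H` and `c^{H*}` come out (`covKer_polarMeasure_scaleMeas`). -/

open MeasureTheory Filter HilbertTrace

/-! ### Growth of one-parameter groups in terms of the spectrum -/

section Growth

variable {𝒜 : Type*} [NormedRing 𝒜] [NormedAlgebra ℂ 𝒜] [CompleteSpace 𝒜]

/-- Powers grow at most geometrically, at any rate above the moduli of the spectrum. -/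
theorem exists_norm_pow_le_of_spectrum_lt (a : 𝒜) {r : ℝ} (hr : 0 < r)
    (h : ∀ z ∈ spectrum ℂ a, ‖z‖ < r) : ∃ M : ℝ, 0 < M ∧ ∀ n : ℕ, ‖a ^ n‖ ≤ M * r ^ n := by
  rcases subsingleton_or_nontrivial 𝒜 with hs | hn
  · refine ⟨1, one_pos, fun n => ?_⟩
    rw [Subsingleton.elim (a ^ n) 0, norm_zero]
    positivity
  have h1 : spectralRadius ℂ a < (r.toNNReal : ℝ≥0∞) :=
    spectrum.spectralRadius_lt_of_forall_lt a fun z hz => by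
      rw [← NNReal.coe_lt_coe, coe_nnnorm, Real.coe_toNNReal _ hr.le]
      exact h z hz
  have h2 : ∀ᶠ n : ℕ in atTop, ‖a ^ n‖ ≤ r ^ n := by
    filter_upwards [(spectrum.pow_norm_pow_one_div_tendsto_nhds_spectralRadius a).eventually
      (gt_mem_nhds h1), eventually_gt_atTop 0] with n hn h0
    have h3 : ‖a ^ n‖ ^ (1 / n : ℝ) < r := by
      have := (ENNReal.ofReal_lt_ofReal_iff hr).1 (hn : ENNReal.ofReal _ < ENNReal.ofReal r)
      exact this
    have h4 : (‖a ^ n‖ ^ (1 / n : ℝ)) ^ n ≤ r ^ n :=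
      pow_le_pow_left₀ (by positivity) h3.le n
    rwa [one_div, Real.rpow_inv_natCast_pow (norm_nonneg _) h0.ne'] at h4
  obtain ⟨N, hN⟩ := eventually_atTop.1 h2
  -- Gelfand's formula gives the bound with constant `1` from `N` on; the sum takes care of the
  -- finitely many earlier powers.
  refine ⟨1 + ∑ n ∈ Finset.range N, ‖a ^ n‖ / r ^ n, by positivity, fun n => ?_⟩
  have hs : 0 ≤ ∑ n ∈ Finset.range N, ‖a ^ n‖ / r ^ n := by positivity
  rcases le_or_gt N n with hn | hn
  · refine (hN n hn).trans (le_mul_of_one_le_left (by positivity) (by linarith))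
  · have := Finset.single_le_sum (f := fun n => ‖a ^ n‖ / r ^ n) (fun i _ => by positivity)
      (Finset.mem_range.2 hn)
    rw [← div_le_iff₀ (by positivity)]
    linarith

/-- Binomial expansion. The factor `1 + ‖1‖` covers `b ^ 0`, because the norm of the unit is not
assumed to be `1`. -/
theorem norm_add_pow_le_of_commute {a b : 𝒜} (hab : Commute a b) {M r : ℝ}
    (h : ∀ n : ℕ, ‖a ^ n‖ ≤ M * r ^ n) (n : ℕ) :
    ‖(a + b) ^ n‖ ≤ M * (1 + ‖(1 : 𝒜)‖) * (r + ‖b‖) ^ n := by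
  have hM : ∀ n, 0 ≤ M * r ^ n := fun n => (norm_nonneg _).trans (h n)
  have hb : ∀ m : ℕ, ‖b ^ m‖ ≤ (1 + ‖(1 : 𝒜)‖) * ‖b‖ ^ m := fun m => by
    rcases m with _ | m
    · simp
    · exact (norm_pow_le' b m.succ_pos).trans
        (le_mul_of_one_le_left (by positivity) (by linarith [norm_nonneg (1 : 𝒜)]))
  rw [hab.add_pow, add_pow, Finset.mul_sum]
  refine (norm_sum_le _ _).trans (Finset.sum_le_sum fun m _ => ?_)
  have hc : ‖a ^ m * b ^ (n - m) * (n.choose m : 𝒜)‖ ≤ ‖a ^ m‖ * ‖b ^ (n - m)‖ * n.choose m := by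
    rw [← nsmul_eq_mul']
    refine (norm_nsmul_le).trans ?_
    rw [mul_comm]
    gcongr
    exact norm_mul_le _ _
  refine hc.trans ?_
  calc ‖a ^ m‖ * ‖b ^ (n - m)‖ * n.choose m
      ≤ (M * r ^ m) * ((1 + ‖(1 : 𝒜)‖) * ‖b‖ ^ (n - m)) * n.choose m := by
        gcongr
        · exact hM m
        · exact h m
        · exact hb _
    _ = _ := by ring

theorem exp_smul_pow (a : 𝒜) (t : ℝ) (n : ℕ) :
    NormedSpace.exp ((t : ℂ) • a) ^ n = NormedSpace.exp (((n * t : ℝ) : ℂ) • a) := by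
  let _ : NormedAlgebra ℚ 𝒜 := NormedAlgebra.restrictScalars ℚ ℂ 𝒜
  rw [← NormedSpace.exp_nsmul, ← Nat.cast_smul_eq_nsmul ℂ, smul_smul]
  push_cast
  rfl

theorem exp_add_smul (a : 𝒜) (s t : ℝ) : NormedSpace.exp (((s + t : ℝ) : ℂ) • a) =
    NormedSpace.exp ((s : ℂ) • a) * NormedSpace.exp ((t : ℂ) • a) := by
  let _ : NormedAlgebra ℚ 𝒜 := NormedAlgebra.restrictScalars ℚ ℂ 𝒜
  rw [Complex.ofReal_add, add_smul, NormedSpace.exp_add_of_commute]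
  exact (Commute.refl a).smul_left _ |>.smul_right _

theorem continuous_exp_smul (a : 𝒜) : Continuous fun t : ℝ => NormedSpace.exp ((t : ℂ) • a) := by
  let _ : NormedAlgebra ℚ 𝒜 := NormedAlgebra.restrictScalars ℚ ℂ 𝒜
  exact NormedSpace.exp_continuous.comp (by fun_prop)

/-- The growth of `exp(s a)` is governed by the real parts of the spectrum of `a`. -/
theorem exists_norm_exp_smul_le (a : 𝒜) {ω : ℝ} (h : ∀ z ∈ spectrum ℂ a, z.re < ω) :
    ∃ M : ℝ, 0 < M ∧ ∀ s : ℝ, 0 ≤ s →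
      ‖NormedSpace.exp ((s : ℂ) • a)‖ ≤ M * Real.exp (ω * s) := by
  -- a rate slightly below `ω`
  obtain ⟨ω', hω', h'⟩ : ∃ ω' < ω, ∀ z ∈ spectrum ℂ a, z.re ≤ ω' := by
    rcases (spectrum ℂ a).eq_empty_or_nonempty with he | hne
    · exact ⟨ω - 1, by linarith, by simp [he]⟩
    · obtain ⟨z, hz, hmax⟩ := (spectrum.isCompact a).exists_isMaxOn hne
        Complex.continuous_re.continuousOn
      exact ⟨z.re, h z hz, fun w hw => hmax hw⟩
  -- The rate `δ` is spent twice: once on the spectral radius of `1 + t a`, once on the remainder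
  -- `exp(t a) - (1 + t a)`. This leaves the rate `ω' + 2δ`, which is below `ω`.
  set δ := (ω - ω') / 4 with hδ
  have hδ0 : 0 < δ := by simp only [hδ]; linarith
  have hder : HasDerivAt (fun t : ℂ => NormedSpace.exp (t • a)) a 0 := by
    simpa using hasDerivAt_exp_smul_const a (0 : ℂ)
  have hder' : ∀ᶠ t : ℝ in 𝓝 0,
      ‖NormedSpace.exp ((t : ℂ) • a) - (1 + (t : ℂ) • a)‖ ≤ δ * |t| := by
    have h1 := (hasDerivAt_iff_isLittleO.1 hder).bound hδ0
    have h2 : Tendsto (fun t : ℝ => (t : ℂ)) (𝓝 0) (𝓝 0) := by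
      simpa using Complex.continuous_ofReal.tendsto 0
    filter_upwards [h2.eventually h1] with t ht
    simpa [sub_sub] using ht
  obtain ⟨R, hR⟩ : ∃ R : ℝ, ∀ z ∈ spectrum ℂ a, ‖z‖ ≤ R :=
    ⟨‖a‖ * ‖(1 : 𝒜)‖, fun z hz => spectrum.norm_le_norm_mul_of_mem hz⟩
  -- The step `t` is so small that `1 + t ω'` and `1 + t (ω' + δ)` are positive, the quadratic term
  -- `t² ‖w‖²` is at most `t δ` on the spectrum, and `exp(t a)` is within `δ t` of `1 + t a`. The
  -- spectrum of the affine element `1 + t a` is explicit, so it can replace that of the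
  -- exponential.
  have hev : ∀ᶠ t : ℝ in 𝓝[>] 0, t * |ω'| < 1 / 2 ∧ t * |ω' + δ| < 1 / 2 ∧
      t * (R ^ 2 + 1) < δ ∧ ‖NormedSpace.exp ((t : ℂ) • a) - (1 + (t : ℂ) • a)‖ ≤ δ * |t| := by
    have ht0 : ∀ c : ℝ, ∀ ε > 0, ∀ᶠ t : ℝ in 𝓝[>] 0, t * c < ε := fun c ε hε => by
      have : Tendsto (fun t : ℝ => t * c) (𝓝[>] 0) (𝓝 (0 * c)) :=
        ((continuous_id.mul continuous_const).tendsto 0).mono_left nhdsWithin_le_nhds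
      rw [zero_mul] at this
      exact this.eventually (gt_mem_nhds hε)
    filter_upwards [ht0 |ω'| _ one_half_pos, ht0 |ω' + δ| _ one_half_pos, ht0 (R ^ 2 + 1) δ hδ0,
      hder'.filter_mono nhdsWithin_le_nhds] with t h1 h2 h3 h4 using ⟨h1, h2, h3, h4⟩
  obtain ⟨t, ⟨ht1, ht2, ht3, ht4⟩, ht0⟩ := (hev.and self_mem_nhdsWithin).exists
  replace ht0 : 0 < t := ht0
  have habs : ∀ x : ℝ, t * |x| < 1 / 2 → 0 < 1 + t * x := fun x hx => by
    nlinarith [neg_abs_le x, mul_le_mul_of_nonneg_left (neg_abs_le x) ht0.le]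
  have hpos := habs _ ht1
  have hpos' := habs _ ht2
  -- the spectrum of `1 + t a`
  have hsp : ∀ z ∈ spectrum ℂ (1 + (t : ℂ) • a), ‖z‖ < 1 + t * (ω' + δ) := by
    intro z hz
    have hz1 : ((t : ℂ)⁻¹ * (z - 1)) ∈ spectrum ℂ a := by
      rw [spectrum.mem_iff] at hz ⊢
      contrapose! hz
      have ht0' : (t : ℂ) ≠ 0 := by exact_mod_cast ht0.ne'
      have e : algebraMap ℂ 𝒜 z - (1 + (t : ℂ) • a) =
          algebraMap ℂ 𝒜 t * (algebraMap ℂ 𝒜 ((t : ℂ)⁻¹ * (z - 1)) - a) := by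
        rw [mul_sub, ← map_mul, mul_inv_cancel_left₀ ht0', map_sub, map_one, Algebra.smul_def]
        abel
      rw [e]
      exact ((IsUnit.mk0 _ ht0').map (algebraMap ℂ 𝒜)).mul hz
    set w := (t : ℂ)⁻¹ * (z - 1) with hw
    have hzw : z = 1 + t * w := by
      rw [hw, mul_inv_cancel_left₀ (by exact_mod_cast ht0.ne')]
      ring
    have h1 := h' w hz1
    have h2 := hR w hz1
    have h3 : ‖z‖ ^ 2 < (1 + t * (ω' + δ)) ^ 2 := by
      have e1 : ‖z‖ ^ 2 = 1 + 2 * t * w.re + t ^ 2 * ‖w‖ ^ 2 := by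
        rw [hzw, ← Complex.normSq_eq_norm_sq, ← Complex.normSq_eq_norm_sq, Complex.normSq_apply,
          Complex.normSq_apply]
        simp
        ring
      rw [e1]
      have e2 : ‖w‖ ^ 2 ≤ R ^ 2 := pow_le_pow_left₀ (norm_nonneg _) h2 2
      have e3 : t ^ 2 * ‖w‖ ^ 2 ≤ t * δ := by
        have : t * ‖w‖ ^ 2 ≤ δ := by nlinarith
        nlinarith
      nlinarith [mul_le_mul_of_nonneg_left h1 ht0.le, mul_pos ht0 hδ0,
        sq_nonneg (t * (ω' + δ))]
    exact lt_of_pow_lt_pow_left₀ 2 hpos'.le h3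
  obtain ⟨M, hM0, hM⟩ := exists_norm_pow_le_of_spectrum_lt _ hpos' hsp
  set b := NormedSpace.exp ((t : ℂ) • a) - (1 + (t : ℂ) • a) with hb
  have hcomm : Commute (1 + (t : ℂ) • a) b := by
    let _ : NormedAlgebra ℚ 𝒜 := NormedAlgebra.restrictScalars ℚ ℂ 𝒜
    have : Commute (1 + (t : ℂ) • a) (NormedSpace.exp ((t : ℂ) • a)) :=
      (Commute.one_left _).add_left (Commute.refl ((t : ℂ) • a)).exp_right
    exact this.sub_right (Commute.refl _)
  -- `exp(n t a)` is the `n`-th power of `(1 + t a) + b`, where `b` commutes with `1 + t a` and has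
  -- norm at most `δ t`.
  have hpow : ∀ n : ℕ, ‖NormedSpace.exp (((n * t : ℝ) : ℂ) • a)‖ ≤
      M * (1 + ‖(1 : 𝒜)‖) * Real.exp (ω * (n * t)) := by
    intro n
    have h1 := norm_add_pow_le_of_commute hcomm hM n
    rw [hb, add_sub_cancel, exp_smul_pow, ← hb] at h1
    refine h1.trans ?_
    have h2 : 1 + t * (ω' + δ) + ‖b‖ ≤ Real.exp (ω * t) := by
      refine le_trans ?_ (Real.add_one_le_exp _)
      rw [abs_of_pos ht0] at ht4
      nlinarith
    rw [show ω * (n * t) = n * (ω * t) by ring, Real.exp_nat_mul]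
    gcongr
  obtain ⟨M', hM'⟩ := (isCompact_Icc (a := (0 : ℝ)) (b := t)).exists_bound_of_continuousOn
    (continuous_exp_smul a).continuousOn
  have hM'0 : 0 ≤ M' := (norm_nonneg _).trans (hM' 0 ⟨le_rfl, ht0.le⟩)
  -- A general `s` is a multiple of `t` plus a rest in `[0, t)`. The rest costs `M'` by compactness,
  -- and the factor `exp(|ω| t)` turns `exp(ω n t)` into `exp(ω s)` for either sign of `ω`.
  refine ⟨M * (1 + ‖(1 : 𝒜)‖) * Real.exp (|ω| * t) * M' + 1, by positivity, fun s hs => ?_⟩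
  set n := ⌊s / t⌋₊ with hn
  have hn1 : n * t ≤ s := by
    have := Nat.floor_le (div_nonneg hs ht0.le)
    rwa [le_div_iff₀ ht0] at this
  have hn2 : s < (n + 1) * t := by
    have := Nat.lt_floor_add_one (s / t)
    rwa [div_lt_iff₀ ht0] at this
  have e : s = n * t + (s - n * t) := by ring
  have h1 : ‖NormedSpace.exp (((s - n * t : ℝ) : ℂ) • a)‖ ≤ M' :=
    hM' _ ⟨by linarith, by linarith⟩
  have h2 : Real.exp (ω * (n * t)) ≤ Real.exp (|ω| * t) * Real.exp (ω * s) := by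
    rw [← Real.exp_add]
    refine Real.exp_le_exp.2 ?_
    have : -(ω * (s - n * t)) ≤ |ω| * t := by
      calc -(ω * (s - n * t)) ≤ |ω * (s - n * t)| := neg_le_abs _
        _ = |ω| * (s - n * t) := by rw [abs_mul, abs_of_nonneg (by linarith : 0 ≤ s - n * t)]
        _ ≤ |ω| * t := by
          gcongr
          linarith
    linarith
  calc ‖NormedSpace.exp ((s : ℂ) • a)‖
      ≤ ‖NormedSpace.exp (((n * t : ℝ) : ℂ) • a)‖ *
          ‖NormedSpace.exp (((s - n * t : ℝ) : ℂ) • a)‖ := by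
        conv_lhs => rw [e, exp_add_smul]
        exact norm_mul_le _ _
    _ ≤ (M * (1 + ‖(1 : 𝒜)‖) * (Real.exp (|ω| * t) * Real.exp (ω * s))) * M' := by
        gcongr
        exact (hpow n).trans (by gcongr)
    _ ≤ _ := by
        nlinarith [Real.exp_pos (ω * s)]

end Growth

noncomputable section

variable {V : Type*} [NormedAddCommGroup V] [InnerProductSpace ℂ V] [CompleteSpace V]

/-! ### Trace-norm inequalities for products and rank-one operators -/

namespace HilbertTrace

/-- The partial isometry of the polar decomposition of `B A C` and the factor `B` are moved to the
left slot of the inner product. The arithmetic mean of squares comes from Cauchy-Schwarz in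
`tsum_inner_le`; `TraceClass.norm_conj_le` improves it to a product by homogeneity. -/
theorem eTraceNorm_conj_le (A B C : V →L[ℂ] V) :
    eTraceNorm (B * A * C) ≤ (‖B‖ₑ ^ 2 + ‖C‖ₑ ^ 2) / 2 * eTraceNorm A := by
  obtain ⟨U, hU, -, h⟩ := exists_polar (B * A * C)
  rw [eTraceNorm_eq_of_polar h]
  have e : ∀ j, inner ℂ (U (cons V j)) ((B * A * C) (cons V j)) =
      inner ℂ (((ContinuousLinearMap.adjoint B).comp U) (cons V j)) (A (C (cons V j))) := fun j => by
    rw [ContinuousLinearMap.comp_apply, ContinuousLinearMap.adjoint_inner_left]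
    rfl
  simp_rw [e]
  refine (tsum_inner_le (cons V) A ((ContinuousLinearMap.adjoint B).comp U) C).trans ?_
  gcongr
  rw [← ofReal_norm, ← ofReal_norm]
  refine ENNReal.ofReal_le_ofReal ((ContinuousLinearMap.opNorm_comp_le _ _).trans ?_)
  rw [LinearIsometryEquiv.norm_map]
  exact mul_le_of_le_one_right (norm_nonneg _) hU

/-- This quantitative bound makes `X ⊗ Z` Bochner integrable for square-integrable `X` and `Z`. -/
theorem eTraceNorm_rankOne_le (f g : V) :
    eTraceNorm (InnerProductSpace.rankOne ℂ f g) ≤ ‖f‖ₑ ^ 2 + ‖g‖ₑ ^ 2 := by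
  obtain ⟨U, hU, -, h⟩ := exists_polar (InnerProductSpace.rankOne ℂ f g)
  rw [eTraceNorm_eq_of_polar h]
  have key : ∀ j, ‖inner ℂ (U (cons V j)) (InnerProductSpace.rankOne ℂ f g (cons V j))‖ₑ ≤
      ‖inner ℂ (cons V j) (ContinuousLinearMap.adjoint U f)‖ₑ ^ 2 + ‖inner ℂ (cons V j) g‖ₑ ^ 2 := by
    intro j
    rw [InnerProductSpace.rankOne_apply, inner_smul_right,
      ContinuousLinearMap.adjoint_inner_right, ← inner_conj_symm g]
    rw [← ofReal_norm, ← ofReal_norm, ← ofReal_norm,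
      ← ENNReal.ofReal_pow (norm_nonneg _), ← ENNReal.ofReal_pow (norm_nonneg _),
      ← ENNReal.ofReal_add (by positivity) (by positivity), norm_mul, RCLike.norm_conj]
    refine ENNReal.ofReal_le_ofReal ?_
    nlinarith [sq_nonneg (‖inner ℂ (cons V j) g‖ - ‖inner ℂ (U (cons V j)) f‖),
      sq_nonneg (‖inner ℂ (cons V j) g‖), sq_nonneg (‖inner ℂ (U (cons V j)) f‖)]
  refine (ENNReal.tsum_le_tsum key).trans ?_
  rw [ENNReal.tsum_add, tsum_enorm_inner_sq, tsum_enorm_inner_sq]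
  gcongr
  rw [← ofReal_norm, ← ofReal_norm]
  refine ENNReal.ofReal_le_ofReal ((ContinuousLinearMap.le_opNorm _ _).trans ?_)
  rw [LinearIsometryEquiv.norm_map]
  exact mul_le_of_le_one_left (norm_nonneg _) hU

theorem eTraceNorm_of_isPositive {A : V →L[ℂ] V} (hA : A.IsPositive) :
    eTraceNorm A = ∑' j, ENNReal.ofReal (inner ℂ (cons V j) (A (cons V j))).re := by
  have : CFC.abs A = A := CFC.abs_of_nonneg A ((ContinuousLinearMap.nonneg_iff_isPositive A).2 hA)
  rw [eTraceNorm, traceSum, this]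

end HilbertTrace

namespace TraceClass

theorem norm_toCLM_le (A : TraceClass V) : ‖toCLM A‖ ≤ ‖A‖ := by
  have h := enorm_le_eTraceNorm (toCLM A)
  rw [← enorm_def] at h
  simpa using ENNReal.toReal_mono enorm_ne_top h

/-- The embedding of the trace-class operators into the bounded operators, as a continuous map. -/
def toCLML : TraceClass V →L[ℂ] (V →L[ℂ] V) :=
  toCLM.mkContinuous 1 fun A => by rw [one_mul]; exact norm_toCLM_le A

/-- The matrix coefficient `A ↦ ⟨x, A y⟩`. -/
def coeffL (x y : V) : TraceClass V →L[ℂ] ℂ :=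
  (innerSL ℂ x).comp ((ContinuousLinearMap.apply ℂ V y).comp toCLML)

@[simp]
theorem coeffL_apply (x y : V) (A : TraceClass V) : coeffL x y A = inner ℂ x (toCLM A y) := rfl

theorem ext_coeff {A B : TraceClass V}
    (h : ∀ x y, (inner ℂ x (toCLM A y) : ℂ) = inner ℂ x (toCLM B y)) : A = B :=
  toCLM_injective (ContinuousLinearMap.ext fun y => ext_inner_left ℂ fun x => h x y)

@[simp]
theorem toCLM_conj (B : V →L[ℂ] V) (A : TraceClass V) (C : V →L[ℂ] V) :
    toCLM (conj B A C) = B * toCLM A * C := rfl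

@[simp]
theorem toCLM_outer (f g : V) : toCLM (outer f g) = InnerProductSpace.rankOne ℂ f g := rfl

theorem norm_conj_le_half (B : V →L[ℂ] V) (A : TraceClass V) (C : V →L[ℂ] V) :
    ‖conj B A C‖ ≤ (‖B‖ ^ 2 + ‖C‖ ^ 2) / 2 * ‖A‖ := by
  have h := eTraceNorm_conj_le (toCLM A) B C
  rw [← toCLM_conj, ← enorm_def, ← enorm_def] at h
  have := ENNReal.toReal_mono (by finiteness) h
  rw [ENNReal.toReal_mul, ENNReal.toReal_div, ENNReal.toReal_add (by finiteness) (by finiteness)]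
    at this
  simpa using this

theorem conj_smul_left (c : ℂ) (B : V →L[ℂ] V) (A : TraceClass V) (C : V →L[ℂ] V) :
    conj (c • B) A C = c • conj B A C :=
  toCLM_injective (by simp)

theorem conj_smul_right (c : ℂ) (B : V →L[ℂ] V) (A : TraceClass V) (C : V →L[ℂ] V) :
    conj B A (c • C) = c • conj B A C :=
  toCLM_injective (by simp)

/-- Rescaling `B` and `C` to norm one turns the mean of squares in `norm_conj_le_half` into `1`; a
vanishing factor is treated apart. -/
theorem norm_conj_le (B : V →L[ℂ] V) (A : TraceClass V) (C : V →L[ℂ] V) :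
    ‖conj B A C‖ ≤ ‖B‖ * ‖A‖ * ‖C‖ := by
  rcases eq_or_ne B 0 with rfl | hB
  · have : conj 0 A C = 0 := toCLM_injective (by simp)
    simp [this]
  rcases eq_or_ne C 0 with rfl | hC
  · have : conj B A 0 = 0 := toCLM_injective (by simp)
    simp [this]
  have hB' : (‖B‖ : ℂ) ≠ 0 := by exact_mod_cast norm_ne_zero_iff.2 hB
  have hC' : (‖C‖ : ℂ) ≠ 0 := by exact_mod_cast norm_ne_zero_iff.2 hC
  have e : conj B A C = (‖B‖ : ℂ) • (‖C‖ : ℂ) • conj ((‖B‖ : ℂ)⁻¹ • B) A ((‖C‖ : ℂ)⁻¹ • C) := by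
    rw [conj_smul_left, conj_smul_right, smul_comm (‖C‖ : ℂ), smul_inv_smul₀ hB',
      smul_inv_smul₀ hC']
  have h1 : ‖(‖B‖ : ℂ)⁻¹ • B‖ = 1 := by
    rw [norm_smul, norm_inv, Complex.norm_real, norm_norm, inv_mul_cancel₀ (norm_ne_zero_iff.2 hB)]
  have h2 : ‖(‖C‖ : ℂ)⁻¹ • C‖ = 1 := by
    rw [norm_smul, norm_inv, Complex.norm_real, norm_norm, inv_mul_cancel₀ (norm_ne_zero_iff.2 hC)]
  have h3 := norm_conj_le_half ((‖B‖ : ℂ)⁻¹ • B) A ((‖C‖ : ℂ)⁻¹ • C)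
  rw [h1, h2] at h3
  rw [e, norm_smul, norm_smul, Complex.norm_real, Complex.norm_real, norm_norm, norm_norm]
  calc ‖B‖ * (‖C‖ * ‖conj ((‖B‖ : ℂ)⁻¹ • B) A ((‖C‖ : ℂ)⁻¹ • C)‖)
      ≤ ‖B‖ * (‖C‖ * ((1 ^ 2 + 1 ^ 2) / 2 * ‖A‖)) := by gcongr
    _ = _ := by ring

/-- The map `A ↦ B A C` on the trace-class operators. -/
def conjL (B C : V →L[ℂ] V) : TraceClass V →L[ℂ] TraceClass V :=
  LinearMap.mkContinuous
    { toFun := fun A => conj B A C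
      map_add' := fun A A' => toCLM_injective (by simp [mul_add, add_mul])
      map_smul' := fun c A => toCLM_injective (by simp) } (‖B‖ * ‖C‖)
    fun A => (norm_conj_le B A C).trans_eq (by ring)

@[simp]
theorem conjL_apply (B C : V →L[ℂ] V) (A : TraceClass V) : conjL B C A = conj B A C := rfl

theorem conj_conj (B B' C C' : V →L[ℂ] V) (A : TraceClass V) :
    conj B (conj B' A C') C = conj (B * B') A (C' * C) :=
  toCLM_injective (by simp [mul_assoc])

theorem isPositive_conj {A : TraceClass V} (hA : (toCLM A).IsPositive) (B : V →L[ℂ] V) :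
    (toCLM (conj B A (ContinuousLinearMap.adjoint B))).IsPositive := by
  rw [toCLM_conj, mul_assoc]
  exact hA.conj_adjoint B

/-- The trilinear map is a composition of two bounded bilinear ones, multiplication by `B` on the
left and by `C` on the right. Joint continuity yields the measurability of radial integrands, where
all three factors vary with `r`. -/
theorem continuous_conj : Continuous fun p : (V →L[ℂ] V) × TraceClass V × (V →L[ℂ] V) =>
    conj p.1 p.2.1 p.2.2 := by
  have h1 : IsBoundedBilinearMap ℂ fun p : (V →L[ℂ] V) × TraceClass V => conj p.1 p.2 1 :=
    { add_left := fun B B' A => toCLM_injective (by simp [add_mul])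
      smul_left := fun c B A => conj_smul_left c B A 1
      add_right := fun B A A' => (conjL B 1).map_add A A'
      smul_right := fun c B A => (conjL B 1).map_smul c A
      bound := ⟨1, one_pos, fun B A => by
        refine (norm_conj_le B A 1).trans ?_
        rw [one_mul]
        exact mul_le_of_le_one_right (by positivity) norm_one_le⟩ }
  have h2 : IsBoundedBilinearMap ℂ fun p : TraceClass V × (V →L[ℂ] V) => conj 1 p.1 p.2 :=
    { add_left := fun A A' C => (conjL 1 C).map_add A A'
      smul_left := fun c A C => (conjL 1 C).map_smul c A
      add_right := fun A C C' => toCLM_injective (by simp [mul_add])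
      smul_right := fun c A C => conj_smul_right c 1 A C
      bound := ⟨1, one_pos, fun A C => by
        refine (norm_conj_le 1 A C).trans ?_
        gcongr
        exact norm_one_le⟩ }
  have e : (fun p : (V →L[ℂ] V) × TraceClass V × (V →L[ℂ] V) => conj p.1 p.2.1 p.2.2) =
      fun p => conj 1 (conj p.1 p.2.1 1) p.2.2 := by
    funext p
    rw [conj_conj, one_mul, one_mul]
  rw [e]
  exact h2.continuous.comp ((h1.continuous.comp (continuous_fst.prodMk
    (continuous_fst.comp continuous_snd))).prodMk (continuous_snd.comp continuous_snd))

theorem norm_outer_le (f g : V) : ‖outer f g‖ ≤ ‖f‖ ^ 2 + ‖g‖ ^ 2 := by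
  have h := eTraceNorm_rankOne_le f g
  rw [← toCLM_outer, ← enorm_def] at h
  have := ENNReal.toReal_mono (by finiteness) h
  rw [ENNReal.toReal_add (by finiteness) (by finiteness)] at this
  simpa using this

theorem coeff_outer (x y f g : V) :
    (inner ℂ x (toCLM (outer f g) y) : ℂ) = inner ℂ x f * inner ℂ g y := by
  rw [toCLM_outer, InnerProductSpace.rankOne_apply, inner_smul_right, mul_comm]

theorem enorm_of_isPositive {A : TraceClass V} (hA : (toCLM A).IsPositive) :
    ‖A‖ₑ = ∑' j, ENNReal.ofReal (inner ℂ (cons V j) (toCLM A (cons V j))).re := by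
  rw [enorm_def, eTraceNorm_of_isPositive hA]

end TraceClass

/-! ### Positive operator measures have finite variation -/

namespace IsPositiveMeasure

variable {X : Type*} [MeasurableSpace X] {μ : VectorMeasure X (TraceClass V)}

theorem re_coeff_nonneg (hμ : IsPositiveMeasure μ) (x : V) (D : Set X) :
    0 ≤ (inner ℂ x (TraceClass.toCLM (μ D) x) : ℂ).re :=
  (hμ D).re_inner_nonneg_right x

theorem hasSum_re_coeff (x : V) {D : ℕ → Set X} (hD : ∀ i, MeasurableSet (D i))
    (hd : Pairwise (Function.onFun Disjoint D)) :
    HasSum (fun i => (inner ℂ x (TraceClass.toCLM (μ (D i)) x) : ℂ).re)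
      (inner ℂ x (TraceClass.toCLM (μ (⋃ i, D i)) x) : ℂ).re := by
  have h1 := (TraceClass.coeffL x x).hasSum (μ.m_iUnion hD hd)
  exact Complex.hasSum_re h1

/-- The measure `D ↦ ⟨x, μ(D) x⟩`. -/
def quadMeasure (hμ : IsPositiveMeasure μ) (x : V) : Measure X :=
  Measure.ofMeasurable
    (fun D _ => ENNReal.ofReal (inner ℂ x (TraceClass.toCLM (μ D) x) : ℂ).re)
    (by simp) fun D hD hd => by
      rw [← (hasSum_re_coeff x hD hd).tsum_eq, ENNReal.ofReal_tsum_of_nonneg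
        (fun i => hμ.re_coeff_nonneg x _) (hasSum_re_coeff x hD hd).summable]

/-- The measure `D ↦ tr μ(D)`. -/
def traceMeasure (hμ : IsPositiveMeasure μ) : Measure X :=
  Measure.sum fun j => hμ.quadMeasure (cons V j)

/-- A positive operator equals its absolute value, so its trace norm is its trace, which is
additive. -/
theorem traceMeasure_apply (hμ : IsPositiveMeasure μ) {D : Set X} (hD : MeasurableSet D) :
    hμ.traceMeasure D = ‖μ D‖ₑ := by
  rw [traceMeasure, Measure.sum_apply _ hD, TraceClass.enorm_of_isPositive (hμ D)]
  exact tsum_congr fun j => Measure.ofMeasurable_apply _ hD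

/-- The variation lies below any scalar measure that dominates the norms of the values, and the
trace measure is such a measure, of total mass `‖μ(X)‖`. -/
theorem isFiniteMeasure_variation (hμ : IsPositiveMeasure μ) : IsFiniteMeasure μ.variation := by
  have : IsFiniteMeasure hμ.traceMeasure :=
    ⟨by rw [hμ.traceMeasure_apply MeasurableSet.univ]; exact enorm_lt_top⟩
  exact isFiniteMeasure_of_le _
    (μ.variation_le_of_forall_enorm_le fun E hE => (hμ.traceMeasure_apply hE).ge)

end IsPositiveMeasure


/-! ### Integrals of bounded complex functions against a vector measure -/

theorem exists_simpleFunc_tendsto_of_norm_le {X E : Type*} [MeasurableSpace X]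
    [NormedAddCommGroup E] [NormedSpace ℝ E] {f : X → E} (hf : StronglyMeasurable f) {C : ℝ}
    (hC : ∀ x, ‖f x‖ ≤ C) : ∃ F : ℕ → SimpleFunc X E, (∀ n x, ‖F n x‖ ≤ max C 0) ∧
      ∀ x, Tendsto (fun n => F n x) atTop (𝓝 (f x)) :=
  ⟨hf.approxBounded (max C 0), fun n x => hf.norm_approxBounded_le (le_max_right _ _) n x,
    fun x => hf.tendsto_approxBounded_of_norm_le ((hC x).trans (le_max_left _ _))⟩

section CInt

variable {X F : Type*} [MeasurableSpace X] [NormedAddCommGroup F] [NormedSpace ℂ F]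

/-- The integral of a complex function against a vector measure. -/
abbrev cint (μ : VectorMeasure X F) (f : X → ℂ) : F :=
  μ.integral f (ContinuousLinearMap.lsmul ℝ ℂ)

theorem cint_const_mul (μ : VectorMeasure X F) (c : ℂ) (f : X → ℂ) :
    cint μ (fun x => c * f x) = c • cint μ f := by
  have := setToFun_smul (μ := μ.variation)
    (dominatedFinMeasAdditive_cbmApplyMeasure μ (ContinuousLinearMap.lsmul ℝ ℂ))
    (fun c s x => by
      simp only [transpose_eq_cbmApplyMeasure, cbmApplyMeasure_apply,
        ContinuousLinearMap.lsmul_apply, smul_eq_mul, mul_smul]) c f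
  exact this

theorem norm_cint_le (μ : VectorMeasure X F) (f : X → ℂ) :
    ‖cint μ f‖ ≤ ∫ x, ‖f x‖ ∂μ.variation := by
  refine VectorMeasure.norm_integral_le_integral_norm.trans ?_
  exact mul_le_of_le_one_left (by positivity) ContinuousLinearMap.opNorm_lsmul_le

variable [CompleteSpace F] (μ : VectorMeasure X F) [IsFiniteMeasure μ.variation]

theorem integrable_variation_of_norm_le {E : Type*} [NormedAddCommGroup E] {f : X → E} {C : ℝ}
    (hf : StronglyMeasurable f) (hC : ∀ x, ‖f x‖ ≤ C) : Integrable f μ.variation :=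
  Integrable.of_bound hf.aestronglyMeasurable C (Eventually.of_forall hC)

/-- Formulated for a finitely valued map with measurable fibers, so that it applies on the sphere to
`θ ↦ F (r θ)` with `F` simple on `ℝ^d`. -/
theorem cint_eq_sum {E : Type*} (φ : X → E) (s : Finset E) (hs : ∀ x, φ x ∈ s)
    (hm : ∀ z, MeasurableSet (φ ⁻¹' {z})) (g : E → ℂ) :
    cint μ (fun x => g (φ x)) = ∑ z ∈ s, g z • μ (φ ⁻¹' {z}) := by
  classical
  have e : (fun x => g (φ x)) =
      fun x => ∑ z ∈ s, (φ ⁻¹' {z}).indicator (fun _ => g z) x := by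
    funext x
    rw [Finset.sum_eq_single_of_mem (φ x) (hs x)]
    · simp
    · intro z _ hz
      exact Set.indicator_of_notMem (fun h => hz h.symm) _
  rw [cint, e, VectorMeasure.integral_finsetSum s (fun z _ => (integrable_const _).indicator (hm z))]
  refine Finset.sum_congr rfl fun z _ => ?_
  rw [VectorMeasure.integral_indicator_const _ (hm z)]
  rfl

theorem cint_eq_sum_range {E : Type*} (φ : SimpleFunc X E) (g : E → ℂ) :
    cint μ (fun x => g (φ x)) = ∑ z ∈ φ.range, g z • μ (φ ⁻¹' {z}) :=
  cint_eq_sum μ φ φ.range φ.mem_range_self φ.measurableSet_fiber g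

theorem tendsto_cint {f : ℕ → X → ℂ} {g : X → ℂ} {C : ℝ} (hf : ∀ n, StronglyMeasurable (f n))
    (hC : ∀ n x, ‖f n x‖ ≤ C) (h : ∀ x, Tendsto (fun n => f n x) atTop (𝓝 (g x))) :
    Tendsto (fun n => cint μ (f n)) atTop (𝓝 (cint μ g)) :=
  VectorMeasure.tendsto_integral_filter_of_norm_le_const
    (Eventually.of_forall fun n => (hf n).aestronglyMeasurable)
    ⟨C, Eventually.of_forall fun n => Eventually.of_forall (hC n)⟩ (Eventually.of_forall h)

theorem norm_cint_le_of_norm_le {f : X → ℂ} {C : ℝ} (hC : ∀ x, ‖f x‖ ≤ C) :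
    ‖cint μ f‖ ≤ C * μ.variation.real Set.univ := by
  by_cases hf : Integrable f μ.variation
  · refine (norm_cint_le μ f).trans ((integral_mono hf.norm (integrable_const C) hC).trans_eq ?_)
    rw [integral_const, smul_eq_mul, mul_comm]
  -- The integral is `0` by convention here. The constant `C` is nonnegative unless `X` is empty,
  -- and then the variation of `X` is zero.
  · rw [cint, VectorMeasure.integral_undef hf, norm_zero]
    rcases isEmpty_or_nonempty X with hX | ⟨⟨x⟩⟩
    · rw [Set.univ_eq_empty_iff.2 hX]
      simp
    · have := (norm_nonneg _).trans (hC x)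
      positivity

end CInt

/-! ### Positivity and symmetry of integrals against a positive operator measure -/

section Positive

variable {V : Type*} [NormedAddCommGroup V] [InnerProductSpace ℂ V] [CompleteSpace V]
  {X : Type*} [MeasurableSpace X] {μ : VectorMeasure X (TraceClass V)}

/-- The integrals of `φ_i \bar φ_j` form a positive semidefinite operator matrix. -/
theorem IsPositiveMeasure.re_sum_inner_nonneg (hμ : IsPositiveMeasure μ) {ι : Type*} [Fintype ι]
    {φ : X → ι → ℂ} (hφ : StronglyMeasurable φ) {C : ℝ} (hC : ∀ x, ‖φ x‖ ≤ C) (v : ι → V) :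
    0 ≤ (∑ i, ∑ j, inner ℂ (v i) (TraceClass.toCLM
      (cint μ fun x => φ x i * (starRingEnd ℂ) (φ x j)) (v j)) : ℂ).re := by
  have := hμ.isFiniteMeasure_variation
  -- The vector-valued function `φ` is approximated as a whole, so all its components are constant
  -- on a common finite partition.
  obtain ⟨F, hF, hlim⟩ := exists_simpleFunc_tendsto_of_norm_le hφ hC
  have hpos : ∀ n, 0 ≤ (∑ i, ∑ j, TraceClass.coeffL (v i) (v j)
      (cint μ fun x => F n x i * (starRingEnd ℂ) (F n x j)) : ℂ).re := by
    intro n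
    -- For a simple function the double sum collapses to values of quadratic forms: the fiber over
    -- `z` contributes `⟨x, μ(F⁻¹{z}) x⟩` with `x = ∑ \bar{z_i} v_i`.
    have e : (∑ i, ∑ j, TraceClass.coeffL (v i) (v j)
        (cint μ fun x => F n x i * (starRingEnd ℂ) (F n x j)) : ℂ) =
        ∑ z ∈ (F n).range, inner ℂ (∑ i, (starRingEnd ℂ) (z i) • v i)
          (TraceClass.toCLM (μ (F n ⁻¹' {z})) (∑ i, (starRingEnd ℂ) (z i) • v i)) := by
      have e1 : ∀ i j, (cint μ fun x => F n x i * (starRingEnd ℂ) (F n x j)) =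
          ∑ z ∈ (F n).range, (z i * (starRingEnd ℂ) (z j)) • μ (F n ⁻¹' {z}) := fun i j =>
        cint_eq_sum_range μ (F n) fun z => z i * (starRingEnd ℂ) (z j)
      simp_rw [e1, map_sum, map_smul, sum_inner, inner_sum, inner_smul_left, inner_smul_right,
        smul_eq_mul, TraceClass.coeffL_apply, RCLike.conj_conj]
      rw [Finset.sum_comm' (t' := Finset.univ) (s' := fun _ => (F n).range) (by simp)]
      refine Finset.sum_congr rfl fun i _ => ?_
      rw [Finset.sum_comm]
      refine Finset.sum_congr rfl fun j _ => Finset.sum_congr rfl fun z _ => ?_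
      ring
    rw [e, Complex.re_sum]
    exact Finset.sum_nonneg fun z _ => hμ.re_coeff_nonneg _ _
  have hmeas : ∀ n i, StronglyMeasurable fun x => F n x i := fun n i =>
    (continuous_apply i).comp_stronglyMeasurable (F n).stronglyMeasurable
  refine ge_of_tendsto' (x := atTop) (f := fun n => (∑ i, ∑ j, TraceClass.coeffL (v i) (v j)
      (cint μ fun x => F n x i * (starRingEnd ℂ) (F n x j)) : ℂ).re) ?_ hpos
  refine (Complex.continuous_re.tendsto _).comp ?_
  refine tendsto_finsetSum _ fun i _ => tendsto_finsetSum _ fun j _ => ?_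
  refine ((TraceClass.coeffL (v i) (v j)).continuous.tendsto _).comp ?_
  refine tendsto_cint μ (C := max C 0 * max C 0)
    (fun n => (hmeas n i).mul (Complex.continuous_conj.comp_stronglyMeasurable (hmeas n j)))
    (fun n x => ?_) fun x => ?_
  · rw [norm_mul, RCLike.norm_conj]
    gcongr
    · exact (norm_le_pi_norm _ i).trans (hF n x)
    · exact (norm_le_pi_norm _ j).trans (hF n x)
  · have h1 := fun i => (tendsto_pi_nhds.1 (hlim x)) i
    exact (h1 i).mul ((Complex.continuous_conj.tendsto _).comp (h1 j))

/-- The integrals of conjugate functions are adjoint operators. -/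
theorem IsPositiveMeasure.inner_cint_conj (hμ : IsPositiveMeasure μ) {f : X → ℂ}
    (hf : StronglyMeasurable f) {C : ℝ} (hC : ∀ x, ‖f x‖ ≤ C) (x y : V) :
    inner ℂ x (TraceClass.toCLM (cint μ fun u => (starRingEnd ℂ) (f u)) y) =
      inner ℂ (TraceClass.toCLM (cint μ f) x) y := by
  have := hμ.isFiniteMeasure_variation
  obtain ⟨F, hF, hlim⟩ := exists_simpleFunc_tendsto_of_norm_le hf hC
  -- For simple functions this is the self-adjointness of the values of `μ`.
  have e : ∀ n, TraceClass.coeffL x y (cint μ fun u => (starRingEnd ℂ) (F n u)) =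
      (starRingEnd ℂ) (TraceClass.coeffL y x (cint μ fun u => F n u)) := fun n => by
    rw [cint_eq_sum_range μ (F n) (starRingEnd ℂ), show
      (cint μ fun u => F n u) = _ from cint_eq_sum_range μ (F n) id]
    simp only [map_sum, map_smul, smul_eq_mul, map_mul, id, TraceClass.coeffL_apply]
    refine Finset.sum_congr rfl fun z _ => ?_
    rw [inner_conj_symm, (hμ _).isSymmetric.apply_clm]
  rw [← inner_conj_symm (TraceClass.toCLM (cint μ f) x)]
  refine tendsto_nhds_unique (f := fun n => TraceClass.coeffL x y
    (cint μ fun u => (starRingEnd ℂ) (F n u))) (l := atTop) ?_ ?_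
  · refine ((TraceClass.coeffL x y).continuous.tendsto _).comp ?_
    exact tendsto_cint μ (C := max C 0)
      (fun n => Complex.continuous_conj.comp_stronglyMeasurable (F n).stronglyMeasurable)
      (fun n u => by rw [RCLike.norm_conj]; exact hF n u)
      fun u => (Complex.continuous_conj.tendsto _).comp (hlim u)
  · simp_rw [e]
    refine (Complex.continuous_conj.tendsto _).comp
      (((TraceClass.coeffL y x).continuous.tendsto _).comp ?_)
    exact tendsto_cint μ (fun n => (F n).stronglyMeasurable) hF hlim

end Positive


variable {V : Type*} [NormedAddCommGroup V] [InnerProductSpace ℂ V] [CompleteSpace V]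

/-! ### Operator powers and integrability of the radial density -/

section OpPow

theorem opPow_neg_adjoint (r : ℝ) (H : V →L[ℂ] V) :
    opPow r (-ContinuousLinearMap.adjoint H) = ContinuousLinearMap.adjoint (opPow r (-H)) := by
  let _ : NormedAlgebra ℚ (V →L[ℂ] V) := NormedAlgebra.restrictScalars ℚ ℂ _
  rw [opPow, opPow, ← ContinuousLinearMap.star_eq_adjoint, ← ContinuousLinearMap.star_eq_adjoint,
    NormedSpace.star_exp, star_smul, star_neg]
  simp

theorem opPow_mul {r s : ℝ} (hr : 0 < r) (hs : 0 < s) (A : V →L[ℂ] V) :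
    opPow (r * s) A = opPow r A * opPow s A := by
  rw [opPow, opPow, opPow, Real.log_mul hr.ne' hs.ne', exp_add_smul]

theorem opPow_inv_neg (r : ℝ) (A : V →L[ℂ] V) : opPow r⁻¹ (-A) = opPow r A := by
  rw [opPow, opPow, Real.log_inv, Complex.ofReal_neg, smul_neg, neg_smul, neg_neg]

theorem stronglyMeasurable_opPow (A : V →L[ℂ] V) : StronglyMeasurable fun r => opPow r A :=
  (continuous_exp_smul A).stronglyMeasurable.comp_measurable Real.measurable_log

/-- The spectral condition makes the radial density integrable. -/
theorem integrableOn_weight_mul_norm_opPow_sq (k : ℕ) (H : V →L[ℂ] V)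
    (hH : Complex.re '' spectrum ℂ H ⊆ Set.Ioo (0 : ℝ) (k + 1)) :
    IntegrableOn (fun r : ℝ => min 1 (r ^ (2 * k + 2)) * r⁻¹ * ‖opPow r (-H)‖ ^ 2)
      (Set.Ioi 0) := by
  -- By compactness the extreme real parts are attained, inside the open interval; half the smaller
  -- distance to the endpoints is a strict margin. An empty spectrum allows any margin.
  obtain ⟨ε, hε0, hε⟩ : ∃ ε > 0, ∀ z ∈ spectrum ℂ H, ε < z.re ∧ z.re < k + 1 - ε := by
    rcases (spectrum ℂ H).eq_empty_or_nonempty with he | hne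
    · exact ⟨1, one_pos, by simp [he]⟩
    · obtain ⟨z, hz, hmin⟩ := (spectrum.isCompact H).exists_isMinOn hne
        Complex.continuous_re.continuousOn
      obtain ⟨w, hw, hmax⟩ := (spectrum.isCompact H).exists_isMaxOn hne
        Complex.continuous_re.continuousOn
      have h1 := hH ⟨z, hz, rfl⟩
      have h2 := hH ⟨w, hw, rfl⟩
      refine ⟨min z.re (k + 1 - w.re) / 2,
        half_pos (lt_min h1.1 (by linarith [h2.2])), fun y hy => ?_⟩
      have h3 : z.re ≤ y.re := hmin hy
      have h4 : y.re ≤ w.re := hmax hy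
      have := min_le_left z.re (k + 1 - w.re)
      have := min_le_right z.re (k + 1 - w.re)
      have : 0 < min z.re (k + 1 - w.re) := lt_min h1.1 (by linarith [h2.2])
      constructor <;> linarith
  -- For `r ≤ 1`, `r^{-H} = exp(s H)` with `s = -log r ≥ 0`, so the upper edge of the spectrum
  -- matters. For `r > 1` it is `exp(s (-H))` with `s = log r`, and the lower edge matters.
  obtain ⟨M₁, hM₁, h₁⟩ := exists_norm_exp_smul_le H fun z hz => (hε z hz).2
  obtain ⟨M₂, hM₂, h₂⟩ := exists_norm_exp_smul_le (-H) (ω := -ε) fun z hz => by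
    have hz' : -z ∈ spectrum ℂ H := by
      rw [← spectrum.neg_eq] at hz
      simpa using hz
    have := (hε _ hz').1
    rw [Complex.neg_re] at this
    linarith
  have hmeas : StronglyMeasurable
      (fun r : ℝ => min 1 (r ^ (2 * k + 2)) * r⁻¹ * ‖opPow r (-H)‖ ^ 2) := by
    refine StronglyMeasurable.mul ?_ ((stronglyMeasurable_opPow _).norm.pow 2)
    exact Measurable.stronglyMeasurable (by fun_prop)
  rw [← Set.Ioc_union_Ioi_eq_Ioi zero_le_one]
  refine IntegrableOn.union ?_ ?_
  -- The exponent is `(2k + 2) - 1 - 2(k + 1 - ε)`.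
  · have hint : IntegrableOn (fun r : ℝ => M₁ ^ 2 * r ^ (2 * ε - 1)) (Set.Ioc 0 1) := by
      have := (intervalIntegral.intervalIntegrable_rpow' (a := 0) (b := 1)
        (r := 2 * ε - 1) (by linarith)).1
      exact this.const_mul _
    refine hint.mono' hmeas.aestronglyMeasurable ?_
    refine (ae_restrict_iff' measurableSet_Ioc).2 (Eventually.of_forall fun r hr => ?_)
    have hr0 : 0 < r := hr.1
    have hn : ‖opPow r (-H)‖ ≤ M₁ * r ^ (-(k + 1 - ε)) := by
      have := h₁ (-Real.log r) (by linarith [Real.log_nonpos hr0.le hr.2])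
      rw [opPow, smul_neg, ← neg_smul, ← Complex.ofReal_neg, Real.rpow_def_of_pos hr0]
      convert this using 3
      ring
    rw [Real.norm_of_nonneg (by positivity)]
    calc min 1 (r ^ (2 * k + 2)) * r⁻¹ * ‖opPow r (-H)‖ ^ 2
        ≤ r ^ (2 * k + 2) * r⁻¹ * (M₁ * r ^ (-(k + 1 - ε))) ^ 2 := by
          gcongr
          exact min_le_right _ _
      _ = M₁ ^ 2 * (r ^ ((2 * k + 2 : ℕ) : ℝ) * r ^ (-1 : ℝ) *
            (r ^ (-(k + 1 - ε)) * r ^ (-(k + 1 - ε)))) := by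
          rw [Real.rpow_natCast, Real.rpow_neg_one]
          ring
      _ = M₁ ^ 2 * r ^ (2 * ε - 1) := by
          rw [← Real.rpow_add hr0, ← Real.rpow_add hr0, ← Real.rpow_add hr0]
          congr 2
          push_cast
          ring
  · have hint : IntegrableOn (fun r : ℝ => M₂ ^ 2 * r ^ (-1 - 2 * ε)) (Set.Ioi 1) :=
      (integrableOn_Ioi_rpow_of_lt (by linarith) one_pos).const_mul _
    refine hint.mono' hmeas.aestronglyMeasurable ?_
    refine (ae_restrict_iff' measurableSet_Ioi).2 (Eventually.of_forall fun r hr => ?_)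
    have hr1 : 1 < r := hr
    have hr0 : 0 < r := one_pos.trans hr1
    have hn : ‖opPow r (-H)‖ ≤ M₂ * r ^ (-ε) := by
      have := h₂ (Real.log r) (Real.log_nonneg hr1.le)
      rw [opPow, Real.rpow_def_of_pos hr0]
      rwa [mul_comm (-ε)] at this
    rw [Real.norm_of_nonneg (by positivity)]
    calc min 1 (r ^ (2 * k + 2)) * r⁻¹ * ‖opPow r (-H)‖ ^ 2
        ≤ 1 * r⁻¹ * (M₂ * r ^ (-ε)) ^ 2 := by
          gcongr
          exact min_le_left _ _
      _ = M₂ ^ 2 * (r ^ (-1 : ℝ) * (r ^ (-ε) * r ^ (-ε))) := by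
          rw [Real.rpow_neg_one]
          ring
      _ = M₂ ^ 2 * r ^ (-1 - 2 * ε) := by
          rw [← Real.rpow_add hr0, ← Real.rpow_add hr0]
          congr 2
          ring

end OpPow

/-! ### The measure in polar coordinates and integration against it -/

section Polar

variable {d : ℕ} (k : ℕ) (H : V →L[ℂ] V)
  (σ : VectorMeasure (Metric.sphere (0 : Rd d) 1) (TraceClass V))

/-- The operator `A ↦ (1 ∧ r^{2k+2}) r^{-1} r^{-H} A r^{-H*}`. -/
def radialWeight (r : ℝ) (A : TraceClass V) : TraceClass V :=
  (min 1 (r ^ (2 * k + 2)) * r⁻¹) •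
    TraceClass.conj (opPow r (-H)) A (opPow r (-ContinuousLinearMap.adjoint H))

/-- A bound for the norm of `radialWeight`. -/
def radialBound (r : ℝ) : ℝ := min 1 (r ^ (2 * k + 2)) * r⁻¹ * ‖opPow r (-H)‖ ^ 2

theorem radialWeight_eq_conjL (r : ℝ) (A : TraceClass V) : radialWeight k H r A =
    (((min 1 (r ^ (2 * k + 2)) * r⁻¹ : ℝ) : ℂ) •
      TraceClass.conjL (opPow r (-H)) (opPow r (-ContinuousLinearMap.adjoint H))) A := by
  rw [radialWeight, ← Complex.coe_smul]
  rfl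

theorem tendsto_radialWeight {ι : Type*} {l : Filter ι} (r : ℝ) {f : ι → TraceClass V}
    {A : TraceClass V} (h : Tendsto f l (𝓝 A)) :
    Tendsto (fun i => radialWeight k H r (f i)) l (𝓝 (radialWeight k H r A)) := by
  simp_rw [radialWeight_eq_conjL]
  exact ((((min 1 (r ^ (2 * k + 2)) * r⁻¹ : ℝ) : ℂ) • TraceClass.conjL (opPow r (-H))
    (opPow r (-ContinuousLinearMap.adjoint H))).continuous.tendsto A).comp h

theorem radialWeight_sum_smul {ι : Type*} (r : ℝ) (s : Finset ι) (c : ι → ℂ)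
    (A : ι → TraceClass V) : radialWeight k H r (∑ i ∈ s, c i • A i) =
      ∑ i ∈ s, c i • radialWeight k H r (A i) := by
  simp_rw [radialWeight_eq_conjL, map_sum, map_smul]

theorem norm_radialWeight_le {r : ℝ} (hr : 0 < r) (A : TraceClass V) :
    ‖radialWeight k H r A‖ ≤ radialBound k H r * ‖A‖ := by
  rw [radialWeight, norm_smul, radialBound, Real.norm_of_nonneg (by positivity),
    mul_assoc (min 1 (r ^ (2 * k + 2)) * r⁻¹)]
  refine mul_le_mul_of_nonneg_left ?_ (by positivity)
  rw [opPow_neg_adjoint]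
  refine (TraceClass.norm_conj_le (opPow r (-H)) A
    (ContinuousLinearMap.adjoint (opPow r (-H)))).trans_eq ?_
  rw [LinearIsometryEquiv.norm_map]
  ring

theorem stronglyMeasurable_radialWeight {A : ℝ → TraceClass V} (hA : StronglyMeasurable A) :
    StronglyMeasurable fun r => radialWeight k H r (A r) := by
  refine StronglyMeasurable.smul (f := fun r : ℝ => min 1 (r ^ (2 * k + 2)) * r⁻¹)
    (Measurable.stronglyMeasurable (by fun_prop)) ?_
  exact TraceClass.continuous_conj.comp_stronglyMeasurable
    ((stronglyMeasurable_opPow _).prodMk (hA.prodMk (stronglyMeasurable_opPow _)))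

theorem integrableOn_radialWeight (hH : IntegrableOn (radialBound k H) (Set.Ioi 0))
    {A : ℝ → TraceClass V} (hA : StronglyMeasurable A) {C : ℝ} (hC : ∀ r, ‖A r‖ ≤ C) :
    IntegrableOn (fun r => radialWeight k H r (A r)) (Set.Ioi 0) := by
  refine (hH.mul_const C).mono' (stronglyMeasurable_radialWeight k H hA).aestronglyMeasurable ?_
  refine (ae_restrict_iff' measurableSet_Ioi).2 (Eventually.of_forall fun r hr => ?_)
  have hr0 : 0 < r := hr
  refine (norm_radialWeight_le k H hr0 _).trans ?_
  have : 0 ≤ radialBound k H r := by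
    rw [radialBound]
    positivity
  gcongr
  exact hC r

/-- The set of the directions `θ` with `r θ ∈ D`. -/
def rayInter (D : Set (Rd d)) (r : ℝ) : Set (Metric.sphere (0 : Rd d) 1) :=
  {θ | r • (θ : Rd d) ∈ D}

theorem continuous_polar :
    Continuous fun p : ℝ × Metric.sphere (0 : Rd d) 1 => p.1 • (p.2 : Rd d) := by
  fun_prop

theorem measurableSet_rayInter {D : Set (Rd d)} (hD : MeasurableSet D) (r : ℝ) :
    MeasurableSet (rayInter D r) :=
  (continuous_polar.comp (continuous_const.prodMk continuous_id)).measurable hD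

/-- The sets `rayInter D r` are the sections at `r` of the preimage of `D` under `(r, θ) ↦ r θ`. -/
theorem stronglyMeasurable_rayInter {D : Set (Rd d)} (hD : MeasurableSet D) :
    StronglyMeasurable fun r => σ (rayInter D r) :=
  VectorMeasure.stronglyMeasurable_vectorMeasure_prodMk_left (continuous_polar.measurable hD)

theorem polarIntegrand_eq (D : Set (Rd d)) (r : ℝ) :
    polarIntegrand k H σ D r = radialWeight k H r (σ (rayInter D r)) := rfl

theorem integrableOn_polarIntegrand (hH : IntegrableOn (radialBound k H) (Set.Ioi 0))
    {D : Set (Rd d)} (hD : MeasurableSet D) :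
    IntegrableOn (polarIntegrand k H σ D) (Set.Ioi 0) :=
  integrableOn_radialWeight k H hH (stronglyMeasurable_rayInter σ hD)
    fun _ => VectorMeasure.norm_apply_le_bound

open Classical in
/-- The measure `(1 ∧ r^{2k+2}) r^{-H} σ(dθ) r^{-H*} r^{-1} dr`. -/
def polarMeasure (hH : IntegrableOn (radialBound k H) (Set.Ioi 0)) :
    VectorMeasure (Rd d) (TraceClass V) where
  measureOf' D := if MeasurableSet D then ∫ r in Set.Ioi (0 : ℝ), polarIntegrand k H σ D r else 0
  empty' := by
    have : ∀ r, polarIntegrand k H σ ∅ r = 0 := fun r => by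
      have : rayInter (∅ : Set (Rd d)) r = ∅ := rfl
      rw [polarIntegrand_eq, this, VectorMeasure.empty, radialWeight_eq_conjL, map_zero]
    simp [this]
  not_measurable' D hD := if_neg hD
  m_iUnion' D hD hd := by
    simp only [hD, ↓reduceIte, implies_true, MeasurableSet.iUnion]
    have hint := fun i => integrableOn_polarIntegrand k H σ hH (hD i)
    -- Countable additivity in trace norm is dominated convergence along the finite subsets of `ℕ`.
    rw [HasSum, SummationFilter.unconditional_filter]
    simp_rw [← integral_finsetSum _ fun i _ => hint i]
    have hray : ∀ r, (⋃ i, rayInter (D i) r) = rayInter (⋃ i, D i) r := fun r => by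
      ext θ
      simp [rayInter]
    have hrd : ∀ r, Pairwise (Function.onFun Disjoint fun i => rayInter (D i) r) :=
      fun r => hd.mono fun _ _ h => h.preimage _
    have hsum : ∀ (s : Finset ℕ) r, ∑ i ∈ s, polarIntegrand k H σ (D i) r =
        radialWeight k H r (∑ i ∈ s, σ (rayInter (D i) r)) := fun s r => by
      simp_rw [polarIntegrand_eq, radialWeight_eq_conjL, map_sum]
    simp_rw [hsum]
    refine tendsto_integral_filter_of_dominated_convergence
      (fun r => radialBound k H r * σ.bound) ?_ ?_ (hH.mul_const _) ?_
    · refine Eventually.of_forall fun s => ?_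
      refine (stronglyMeasurable_radialWeight k H ?_).aestronglyMeasurable
      exact Finset.stronglyMeasurable_fun_sum _ fun i _ => stronglyMeasurable_rayInter σ (hD i)
    · refine Eventually.of_forall fun s => (ae_restrict_iff' measurableSet_Ioi).2
        (Eventually.of_forall fun r hr => ?_)
      have hr0 : 0 < r := hr
      refine (norm_radialWeight_le k H hr0 _).trans ?_
      -- A finite partial sum is the value of `σ` on a finite union, so `σ.bound` bounds it
      -- independently of the number of terms.
      rw [← VectorMeasure.of_biUnion_finset (fun i _ j _ h => hrd r h)
        fun i _ => measurableSet_rayInter (hD i) r]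
      have : 0 ≤ radialBound k H r := by
        rw [radialBound]
        positivity
      gcongr
      exact VectorMeasure.norm_apply_le_bound
    · refine Eventually.of_forall fun r => ?_
      rw [polarIntegrand_eq, ← hray]
      exact tendsto_radialWeight k H r
        (σ.m_iUnion (fun i => measurableSet_rayInter (hD i) r) (hrd r))

variable (hH : IntegrableOn (radialBound k H) (Set.Ioi 0))

theorem polarMeasure_apply {D : Set (Rd d)} (hD : MeasurableSet D) :
    polarMeasure k H σ hH D = ∫ r in Set.Ioi (0 : ℝ), polarIntegrand k H σ D r :=
  if_pos hD

theorem isPolarMeasure_polarMeasure : IsPolarMeasure k H σ (polarMeasure k H σ hH) :=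
  fun _ hD => ⟨integrableOn_polarIntegrand k H σ hH hD, polarMeasure_apply k H σ hH hD⟩

theorem polarMeasure_singleton_zero : polarMeasure k H σ hH {0} = 0 := by
  rw [polarMeasure_apply k H σ hH (measurableSet_singleton 0)]
  refine setIntegral_eq_zero_of_forall_eq_zero fun r hr => ?_
  have hr0 : r ≠ 0 := ne_of_gt hr
  -- No nonzero multiple of a unit vector vanishes.
  have : rayInter ({0} : Set (Rd d)) r = ∅ := by
    ext θ
    simp [rayInter, hr0]
    intro h
    have := θ.2
    rw [h] at this
    simp at this
  rw [polarIntegrand_eq, this, VectorMeasure.empty, radialWeight_eq_conjL, map_zero]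

-- Since `r^{-H*}` is the adjoint of `r^{-H}`, every integrand is a nonnegative multiple of some `B
-- A B*` with `A` positive, and quadratic forms pass through the Bochner integral.
open scoped ComplexOrder in
theorem isPositiveMeasure_polarMeasure (hσ : IsPositiveMeasure σ) :
    IsPositiveMeasure (polarMeasure k H σ hH) := by
  intro D
  by_cases hD : MeasurableSet D
  swap
  · rw [VectorMeasure.not_measurable _ hD, map_zero]
    exact ContinuousLinearMap.isPositive_zero
  have hnonneg : ∀ x : V, 0 ≤ TraceClass.coeffL x x (polarMeasure k H σ hH D) := fun x => by
    rw [polarMeasure_apply k H σ hH hD,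
      ← ContinuousLinearMap.integral_comp_comm _ (integrableOn_polarIntegrand k H σ hH hD)]
    refine integral_nonneg_of_ae ((ae_restrict_iff' measurableSet_Ioi).2
      (Eventually.of_forall fun r hr => ?_))
    have hr0 : 0 < r := hr
    change 0 ≤ TraceClass.coeffL x x (polarIntegrand k H σ D r)
    rw [polarIntegrand_eq, radialWeight, opPow_neg_adjoint, ← Complex.coe_smul,
      map_smul, smul_eq_mul]
    refine mul_nonneg (Complex.zero_le_real.2 (by positivity)) ?_
    exact (TraceClass.isPositive_conj (hσ _) _).inner_nonneg_right x
  refine (ContinuousLinearMap.isPositive_iff_complex _).2 fun x => ?_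
  have h1 : inner ℂ (TraceClass.toCLM (polarMeasure k H σ hH D) x) x =
      TraceClass.coeffL x x (polarMeasure k H σ hH D) := by
    rw [← inner_conj_symm, ← TraceClass.coeffL_apply]
    exact Complex.conj_eq_iff_im.2 (Complex.nonneg_iff.1 (hnonneg x)).2.symm
  rw [h1]
  have h2 := Complex.nonneg_iff.1 (hnonneg x)
  exact ⟨Complex.ext (by simp) (by simpa using h2.2), h2.1⟩

theorem stronglyMeasurable_cint_ray [IsFiniteMeasure σ.variation] {f : Rd d → ℂ}
    (hf : StronglyMeasurable f) {C : ℝ} (hC : ∀ u, ‖f u‖ ≤ C) :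
    StronglyMeasurable fun r : ℝ => cint σ fun θ => f (r • (θ : Rd d)) := by
  obtain ⟨F, hF, hlim⟩ := exists_simpleFunc_tendsto_of_norm_le hf hC
  have hcont : ∀ r : ℝ, Measurable fun θ : Metric.sphere (0 : Rd d) 1 => r • (θ : Rd d) :=
    fun r => (continuous_polar.comp (continuous_const.prodMk continuous_id)).measurable
  refine stronglyMeasurable_of_tendsto atTop
    (f := fun n (r : ℝ) => cint σ fun θ => F n (r • (θ : Rd d))) (fun n => ?_)
    (tendsto_pi_nhds.2 fun r => tendsto_cint σ
      (fun n => (F n).stronglyMeasurable.comp_measurable (hcont r)) (fun n θ => hF n _)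
      fun θ => hlim _)
  have e : (fun r : ℝ => cint σ fun θ => F n (r • (θ : Rd d))) =
      fun r => ∑ z ∈ (F n).range, z • σ (rayInter (F n ⁻¹' {z}) r) := funext fun r =>
    cint_eq_sum σ (fun θ => F n (r • (θ : Rd d))) (F n).range (fun θ => (F n).mem_range_self _)
      (fun z => hcont r ((F n).measurableSet_fiber z)) id
  rw [e]
  exact Finset.stronglyMeasurable_fun_sum _ fun z _ =>
    (stronglyMeasurable_rayInter σ ((F n).measurableSet_fiber z)).const_smul z

/-- Integration against the polar measure is an iterated integral. -/
theorem cint_polarMeasure (hσ : IsPositiveMeasure σ) {f : Rd d → ℂ}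
    (hf : StronglyMeasurable f) {C : ℝ} (hC : ∀ u, ‖f u‖ ≤ C) :
    IntegrableOn (fun r : ℝ => radialWeight k H r (cint σ fun θ => f (r • (θ : Rd d)))) (Set.Ioi 0) ∧
    cint (polarMeasure k H σ hH) f =
      ∫ r in Set.Ioi (0 : ℝ), radialWeight k H r (cint σ fun θ => f (r • (θ : Rd d))) := by
  have := hσ.isFiniteMeasure_variation
  have := (isPositiveMeasure_polarMeasure k H σ hH hσ).isFiniteMeasure_variation
  refine ⟨integrableOn_radialWeight k H hH (stronglyMeasurable_cint_ray σ hf hC)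
    fun r => norm_cint_le_of_norm_le σ fun θ => hC _, ?_⟩
  obtain ⟨F, hF, hlim⟩ := exists_simpleFunc_tendsto_of_norm_le hf hC
  have hcont : ∀ r : ℝ, Measurable fun θ : Metric.sphere (0 : Rd d) 1 => r • (θ : Rd d) :=
    fun r => (continuous_polar.comp (continuous_const.prodMk continuous_id)).measurable
  have hsimple : ∀ n, cint (polarMeasure k H σ hH) (F n) =
      ∫ r in Set.Ioi (0 : ℝ), radialWeight k H r (cint σ fun θ => F n (r • (θ : Rd d))) := by
    intro n
    have e : ∀ r : ℝ, (cint σ fun θ => F n (r • (θ : Rd d))) =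
        ∑ z ∈ (F n).range, z • σ (rayInter (F n ⁻¹' {z}) r) := fun r =>
      cint_eq_sum σ (fun θ => F n (r • (θ : Rd d))) (F n).range (fun θ => (F n).mem_range_self _)
        (fun z => hcont r ((F n).measurableSet_fiber z)) id
    have e' : cint (polarMeasure k H σ hH) (F n) =
        ∑ z ∈ (F n).range, z • polarMeasure k H σ hH (F n ⁻¹' {z}) :=
      cint_eq_sum_range _ (F n) id
    simp_rw [e, radialWeight_sum_smul, ← polarIntegrand_eq]
    rw [integral_finsetSum (f := fun z r => z • polarIntegrand k H σ (F n ⁻¹' {z}) r) _ fun z _ =>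
      (integrableOn_polarIntegrand k H σ hH ((F n).measurableSet_fiber z)).smul z, e']
    refine Finset.sum_congr rfl fun z _ => ?_
    rw [integral_smul, polarMeasure_apply k H σ hH ((F n).measurableSet_fiber z)]
  refine tendsto_nhds_unique (tendsto_cint _ (fun n => (F n).stronglyMeasurable) hF hlim) ?_
  simp_rw [hsimple]
  refine tendsto_integral_of_dominated_convergence
    (fun r => radialBound k H r * (max C 0 * σ.variation.real Set.univ))
    (fun n => (stronglyMeasurable_radialWeight k H
      (stronglyMeasurable_cint_ray σ (F n).stronglyMeasurable (hF n))).aestronglyMeasurable)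
    (hH.mul_const _) (fun n => ?_) ?_
  · refine (ae_restrict_iff' measurableSet_Ioi).2 (Eventually.of_forall fun r hr => ?_)
    have hr0 : 0 < r := hr
    refine (norm_radialWeight_le k H hr0 _).trans ?_
    have : 0 ≤ radialBound k H r := by
      rw [radialBound]
      positivity
    gcongr
    exact norm_cint_le_of_norm_le σ fun θ => hF n _
  · refine Eventually.of_forall fun r => tendsto_radialWeight k H r ?_
    exact tendsto_cint σ (fun n => (F n).stronglyMeasurable.comp_measurable (hcont r))
      (fun n θ => hF n _) fun θ => hlim _

end Polar


/-! ### Fourier transforms of elements of `Λ_k` and the spectral integrand -/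

/-- Taylor's formula for `x ↦ e^{ix}`, with a remainder bounded on the whole line. -/
theorem norm_exp_I_mul_sub_taylor_le (n : ℕ) (x : ℝ) :
    ‖Complex.exp (Complex.I * x) - ∑ j ∈ Finset.range n, (Complex.I * x) ^ j / (j.factorial : ℂ)‖ ≤
      (n + 4) * |x| ^ n := by
  have hx : ‖Complex.I * (x : ℂ)‖ = |x| := by simp
  -- For `|x| ≤ 1` the exponential remainder has constant at most `e < 3`. For `|x| > 1` the
  -- exponential and the `n` Taylor terms are each at most `|x|^n`. The constant `n + 4` exceeds
  -- both `3` and `n + 1`.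
  rcases le_or_gt |x| 1 with h | h
  · have h1 := Complex.norm_exp_sub_sum_le_norm_mul_exp (Complex.I * x) n
    rw [hx] at h1
    refine h1.trans ?_
    rw [mul_comm]
    gcongr
    calc Real.exp |x| ≤ Real.exp 1 := Real.exp_le_exp.2 h
      _ ≤ n + 4 := by
        have := Real.exp_one_lt_three
        have : (0 : ℝ) ≤ n := n.cast_nonneg
        linarith
  · have h2 : ∀ j ∈ Finset.range n, ‖(Complex.I * (x : ℂ)) ^ j / (j.factorial : ℂ)‖ ≤ |x| ^ n := by
      intro j hj
      rw [norm_div, norm_pow, hx, Complex.norm_natCast]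
      refine (div_le_self (by positivity) ?_).trans
        (pow_le_pow_right₀ h.le (Finset.mem_range.1 hj).le)
      exact_mod_cast Nat.one_le_iff_ne_zero.2 j.factorial_ne_zero
    have h3 : ‖Complex.exp (Complex.I * x)‖ = 1 := by
      rw [mul_comm]
      exact Complex.norm_exp_ofReal_mul_I x
    have h4 : 1 ≤ |x| ^ n := one_le_pow₀ h.le
    refine (norm_sub_le _ _).trans ?_
    rw [h3]
    have h5 := (norm_sum_le _ _).trans (Finset.sum_le_card_nsmul _ _ _ h2)
    rw [Finset.card_range, nsmul_eq_mul] at h5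
    nlinarith

/-- Writing the weight as a square lets the covariance integrand factor as `specFun k l` times the
conjugate of `specFun k m`. -/
theorem min_one_pow_two (a : ℝ) (k : ℕ) (ha : 0 ≤ a) :
    min 1 (a ^ (2 * k + 2)) = min 1 (a ^ (k + 1)) * min 1 (a ^ (k + 1)) := by
  have e : a ^ (2 * k + 2) = a ^ (k + 1) * a ^ (k + 1) := by ring
  have h0 : 0 ≤ a ^ (k + 1) := by positivity
  rw [e]
  rcases le_total (a ^ (k + 1)) 1 with h | h
  · rw [min_eq_right h, min_eq_right (by nlinarith)]
  · rw [min_eq_left h, min_eq_left (by nlinarith), one_mul]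

section Fourier

variable {d : ℕ}

/-- The character `u ↦ e^{i u·t}`. -/
def char (t u : Rd d) : ℂ := Complex.exp (Complex.I * (inner ℝ u t : ℝ))

theorem norm_char (t u : Rd d) : ‖char t u‖ = 1 := by
  rw [char, mul_comm]
  exact Complex.norm_exp_ofReal_mul_I _

theorem continuous_char : Continuous fun p : Rd d × Rd d => char p.1 p.2 := by
  unfold char
  fun_prop

theorem char_add (s t u : Rd d) : char (s + t) u = char s u * char t u := by
  rw [char, char, char, ← Complex.exp_add, inner_add_right]
  congr 1
  push_cast
  ring

theorem conj_char (t u : Rd d) : (starRingEnd ℂ) (char t u) = char (-t) u := by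
  rw [char, char, ← Complex.exp_conj, map_mul, Complex.conj_I, Complex.conj_ofReal,
    inner_neg_right]
  congr 1
  push_cast
  ring

theorem char_smul (c : ℝ) (t u : Rd d) : char (c • t) u = char t (c • u) := by
  rw [char, char, inner_smul_left, inner_smul_right]
  rfl

/-- The Fourier transform of a finitely supported measure. -/
def lamHat (l : FinMeas d) (u : Rd d) : ℂ := l.sum fun t c => c * char t u

theorem lamHat_add (a b : FinMeas d) (u : Rd d) : lamHat (a + b) u = lamHat a u + lamHat b u :=
  Finsupp.sum_add_index' (by simp) (by intros; ring)

theorem lamHat_smul (c : ℂ) (a : FinMeas d) (u : Rd d) : lamHat (c • a) u = c * lamHat a u := by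
  rw [lamHat, Finsupp.sum_smul_index (by simp)]
  simp_rw [mul_assoc]
  rw [← Finsupp.mul_sum]
  rfl

theorem lamHat_sub (a b : FinMeas d) (u : Rd d) : lamHat (a - b) u = lamHat a u - lamHat b u :=
  Finsupp.sum_sub_index (by intros; ring)

theorem lamHat_shiftMeas {k : ℕ} (w : Rd d) (l : Lam d k) (u : Rd d) :
    lamHat (shiftMeas w l).1 u = char w u * lamHat l.1 u := by
  rw [lamHat, shiftMeas, Finsupp.sum_mapDomain_index (by simp) (by intros; ring), lamHat,
    Finsupp.mul_sum]
  refine Finsupp.sum_congr fun t _ => ?_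
  rw [char_add]
  ring

theorem lamHat_scaleMeas {k : ℕ} (c : ℝ) (l : Lam d k) (u : Rd d) :
    lamHat (scaleMeas c l).1 u = lamHat l.1 (c • u) := by
  rw [lamHat, scaleMeas, Finsupp.sum_mapDomain_index (by simp) (by intros; ring), lamHat]
  refine Finsupp.sum_congr fun t _ => ?_
  rw [char_smul]

theorem continuous_lamHat (l : FinMeas d) : Continuous (lamHat l) := by
  unfold lamHat Finsupp.sum
  exact continuous_finsetSum _ fun t _ => continuous_const.mul
    (continuous_char.comp (continuous_const.prodMk continuous_id))

/-- For fixed `u`, `t ↦ (u·t)^j` is a polynomial in `t` of degree at most `j ≤ k`. -/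
theorem sum_mul_inner_pow_eq_zero {k : ℕ} (l : Lam d k) (u : Rd d) {j : ℕ} (hj : j ≤ k) :
    (l.1.sum fun t c => c * ((inner ℝ u t : ℝ) : ℂ) ^ j) = 0 := by
  rw [← l.2 ((∑ i, MvPolynomial.C (u i : ℂ) * MvPolynomial.X i) ^ j) ?_]
  · refine Finsupp.sum_congr fun t _ => ?_
    congr 1
    rw [polyEval, map_pow, map_sum]
    congr 1
    rw [PiLp.inner_apply]
    push_cast
    refine Finset.sum_congr rfl fun i _ => ?_
    simp [mul_comm]
  · refine (MvPolynomial.totalDegree_pow _ _).trans ?_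
    refine le_trans (mul_le_of_le_one_right (Nat.zero_le j) ?_) hj
    refine MvPolynomial.totalDegree_finsetSum_le fun i _ => ?_
    exact (MvPolynomial.totalDegree_mul _ _).trans (by simp)

/-- A bound for the Fourier transform of `l ∈ Λ_k`, relative to `1 ∧ ‖u‖^{k+1}`. -/
def lamBound (k : ℕ) (l : FinMeas d) : ℝ := ∑ t ∈ l.support, ‖l t‖ * (1 + (k + 5) * ‖t‖ ^ (k + 1))

theorem norm_lamHat_le_sum (l : FinMeas d) (u : Rd d) : ‖lamHat l u‖ ≤ ∑ t ∈ l.support, ‖l t‖ := by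
  refine (norm_sum_le _ _).trans_eq (Finset.sum_congr rfl fun t _ => ?_)
  rw [norm_mul, norm_char, mul_one]

/-- Subtracting from each character its Taylor polynomial of degree `k` does not change the sum, as
`l` annihilates such polynomials; the remainders are of order `‖u‖^{k+1}`. The constant `k + 5` is
`(k + 1) + 4`. -/
theorem norm_lamHat_le_pow {k : ℕ} (l : Lam d k) (u : Rd d) :
    ‖lamHat l.1 u‖ ≤ (∑ t ∈ l.1.support, ‖l.1 t‖ * ((k + 5) * ‖t‖ ^ (k + 1))) * ‖u‖ ^ (k + 1) := by
  have h0 : (∑ t ∈ l.1.support, l.1 t * ∑ j ∈ Finset.range (k + 1),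
      (Complex.I * (inner ℝ u t : ℝ)) ^ j / (j.factorial : ℂ)) = 0 := by
    simp_rw [Finset.mul_sum]
    rw [Finset.sum_comm]
    refine Finset.sum_eq_zero fun j hj => ?_
    have := sum_mul_inner_pow_eq_zero l u (Nat.lt_succ_iff.1 (Finset.mem_range.1 hj))
    rw [Finsupp.sum] at this
    calc ∑ t ∈ l.1.support, l.1 t * ((Complex.I * (inner ℝ u t : ℝ)) ^ j / (j.factorial : ℂ))
        = Complex.I ^ j / (j.factorial : ℂ) *
            ∑ t ∈ l.1.support, l.1 t * ((inner ℝ u t : ℝ) : ℂ) ^ j := by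
          rw [Finset.mul_sum]
          exact Finset.sum_congr rfl fun t _ => by ring
      _ = 0 := by rw [this, mul_zero]
  have e : lamHat l.1 u = ∑ t ∈ l.1.support, l.1 t * (char t u - ∑ j ∈ Finset.range (k + 1),
      (Complex.I * (inner ℝ u t : ℝ)) ^ j / (j.factorial : ℂ)) := by
    simp_rw [mul_sub, Finset.sum_sub_distrib]
    rw [h0, sub_zero]
    rfl
  rw [e, Finset.sum_mul]
  refine (norm_sum_le _ _).trans (Finset.sum_le_sum fun t _ => ?_)
  rw [norm_mul, mul_assoc]
  gcongr
  refine (norm_exp_I_mul_sub_taylor_le (k + 1) _).trans ?_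
  calc ((k + 1 : ℕ) + 4 : ℝ) * |inner ℝ u t| ^ (k + 1)
      ≤ ((k + 1 : ℕ) + 4 : ℝ) * (‖u‖ * ‖t‖) ^ (k + 1) := by
        gcongr
        exact abs_real_inner_le_norm u t
    _ = _ := by
        push_cast
        ring

/-- The function `u ↦ \hat l(u) / (1 ∧ ‖u‖^{k+1})`. -/
def specFun (k : ℕ) (l : FinMeas d) (u : Rd d) : ℂ := lamHat l u / (min 1 (‖u‖ ^ (k + 1)) : ℝ)

theorem stronglyMeasurable_specFun (k : ℕ) (l : FinMeas d) : StronglyMeasurable (specFun k l) := by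
  have h1 := (continuous_lamHat l).measurable
  have h2 : Measurable fun u : Rd d => ((min 1 (‖u‖ ^ (k + 1)) : ℝ) : ℂ) := by fun_prop
  exact (h1.div h2).stronglyMeasurable

/-- The trivial bound serves where the weight is `1`, the bound by `‖u‖^{k+1}` elsewhere. At `u = 0`
the quotient is `0` by convention. -/
theorem norm_specFun_le {k : ℕ} (l : Lam d k) (u : Rd d) : ‖specFun k l.1 u‖ ≤ lamBound k l.1 := by
  have hb : lamBound k l.1 = ∑ t ∈ l.1.support, ‖l.1 t‖ +
      ∑ t ∈ l.1.support, ‖l.1 t‖ * ((k + 5) * ‖t‖ ^ (k + 1)) := by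
    rw [← Finset.sum_add_distrib]
    exact Finset.sum_congr rfl fun t _ => by ring
  have h1 : 0 ≤ ∑ t ∈ l.1.support, ‖l.1 t‖ := by positivity
  have h2 : 0 ≤ ∑ t ∈ l.1.support, ‖l.1 t‖ * ((k + 5) * ‖t‖ ^ (k + 1)) := by positivity
  rw [specFun, norm_div, Complex.norm_real, Real.norm_of_nonneg (by positivity)]
  rcases le_total 1 (‖u‖ ^ (k + 1)) with h | h
  · rw [min_eq_left h, div_one]
    exact (norm_lamHat_le_sum _ _).trans (by linarith)
  · rw [min_eq_right h]
    refine (div_le_of_le_mul₀ (by positivity) h2 (norm_lamHat_le_pow l u)).trans (by linarith)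

theorem stronglyMeasurable_spectralIntegrand (k : ℕ) {B : Set (Rd d)} (hB : MeasurableSet B)
    (h : Rd d) : StronglyMeasurable (spectralIntegrand k B h) := by
  refine Measurable.stronglyMeasurable ?_
  unfold spectralIntegrand
  refine Measurable.div (Measurable.sub (by fun_prop) (Measurable.indicator ?_ hB)) (by fun_prop)
  exact Finset.measurable_fun_sum _ fun j _ => by fun_prop

/-- Near `0` the point lies in `B`, and the Taylor remainder of order `2k + 2` compensates the
weight. Away from `0` the weight is bounded below, and the Taylor polynomial is only evaluated on
the bounded set `B`. -/
theorem exists_norm_spectralIntegrand_le (k : ℕ) {B : Set (Rd d)} (hB : Bornology.IsBounded B)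
    (hB0 : B ∈ 𝓝 (0 : Rd d)) (h : Rd d) : ∃ C, ∀ u, ‖spectralIntegrand k B h u‖ ≤ C := by
  obtain ⟨R, hR⟩ := hB.exists_norm_le
  obtain ⟨δ, hδ, hball⟩ := Metric.mem_nhds_iff.1 hB0
  set S := ∑ j ∈ Finset.range (2 * k + 2), (|R| * ‖h‖) ^ j with hS
  have hS0 : 0 ≤ S := by positivity
  set C₁ : ℝ := (2 * k + 6) * ‖h‖ ^ (2 * k + 2) with hC₁
  have hC₁0 : 0 ≤ C₁ := by positivity
  set m : ℝ := min 1 (δ ^ (2 * k + 2)) with hm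
  have hm0 : 0 < m := lt_min one_pos (by positivity)
  have hnum : ∀ u, ‖char h u - B.indicator (fun v => ∑ j ∈ Finset.range (2 * k + 2),
      (Complex.I * (inner ℝ v h : ℝ)) ^ j / (j.factorial : ℂ)) u‖ ≤ 1 + S := by
    intro u
    refine (norm_sub_le _ _).trans ?_
    rw [norm_char]
    gcongr
    by_cases hu : u ∈ B
    · rw [Set.indicator_of_mem hu]
      refine (norm_sum_le _ _).trans (Finset.sum_le_sum fun j _ => ?_)
      rw [norm_div, norm_pow, Complex.norm_natCast]
      refine (div_le_self (by positivity) ?_).trans ?_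
      · exact_mod_cast Nat.one_le_iff_ne_zero.2 j.factorial_ne_zero
      · gcongr
        rw [norm_mul, Complex.norm_I, one_mul, Complex.norm_real]
        refine (norm_inner_le_norm u h).trans ?_
        gcongr
        exact (hR u hu).trans (le_abs_self R)
    · rw [Set.indicator_of_notMem hu, norm_zero]
      exact hS0
  refine ⟨C₁ + (1 + S) / m, fun u => ?_⟩
  rw [spectralIntegrand, norm_div, Complex.norm_real, Real.norm_of_nonneg (by positivity)]
  -- Below `δ` the point is in `B`; below `1` the weight is exactly `‖u‖^{2k+2}`. Otherwise the
  -- weight is at least `m`.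
  rcases lt_or_ge ‖u‖ (min δ 1) with hu | hu
  · have huB : u ∈ B := hball (by simpa using hu.trans_le (min_le_left _ _))
    have hu1 : ‖u‖ ≤ 1 := (hu.trans_le (min_le_right _ _)).le
    rw [Set.indicator_of_mem huB, min_eq_right (pow_le_one₀ (norm_nonneg _) hu1)]
    have : 0 ≤ (1 + S) / m := by positivity
    refine (div_le_of_le_mul₀ (by positivity) hC₁0 ?_).trans (by linarith)
    refine (norm_exp_I_mul_sub_taylor_le (2 * k + 2) _).trans ?_
    calc ((2 * k + 2 : ℕ) + 4 : ℝ) * |inner ℝ u h| ^ (2 * k + 2)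
        ≤ ((2 * k + 2 : ℕ) + 4 : ℝ) * (‖u‖ * ‖h‖) ^ (2 * k + 2) := by
          gcongr
          exact abs_real_inner_le_norm u h
      _ = _ := by
          rw [hC₁]
          push_cast
          ring
  · have hmu : m ≤ min 1 (‖u‖ ^ (2 * k + 2)) := by
      refine le_min (min_le_left _ _) ?_
      rcases le_total δ 1 with h1 | h1
      · rw [min_eq_left h1] at hu
        exact (min_le_right _ _).trans (by gcongr)
      · rw [min_eq_right h1] at hu
        exact (min_le_left _ _).trans (one_le_pow₀ hu)
    refine le_trans ?_ (le_add_of_nonneg_left hC₁0)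
    exact div_le_div₀ (by positivity) (hnum u) hm0 hmu

/-- In the binomial expansion of `(u·t - u·s)^j` with `j ≤ 2k + 1`, each term has degree at most `k`
in `t` or in `s`, so it is annihilated by `l` or by `m`. This is why the correction may reach degree
`2k + 1`. -/
theorem sum_sum_mul_inner_pow_eq_zero {k : ℕ} (l m : Lam d k) (u : Rd d) {j : ℕ}
    (hj : j < 2 * k + 2) :
    ∑ t ∈ l.1.support, ∑ s ∈ m.1.support, l.1 t * (starRingEnd ℂ) (m.1 s) *
      ((Complex.I * (inner ℝ u (t - s) : ℝ)) ^ j / (j.factorial : ℂ)) = 0 := by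
  have hm : ∀ i ≤ k, ∑ s ∈ m.1.support, (starRingEnd ℂ) (m.1 s) *
      ((inner ℝ u s : ℝ) : ℂ) ^ i = 0 := fun i hi => by
    have := congrArg (starRingEnd ℂ) (sum_mul_inner_pow_eq_zero m u hi)
    rw [Finsupp.sum, map_sum, map_zero] at this
    simpa using this
  have hl : ∀ i ≤ k, ∑ t ∈ l.1.support, l.1 t * ((inner ℝ u t : ℝ) : ℂ) ^ i = 0 :=
    fun i hi => sum_mul_inner_pow_eq_zero l u hi
  have e : ∀ t s : Rd d, l.1 t * (starRingEnd ℂ) (m.1 s) *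
      ((Complex.I * (inner ℝ u (t - s) : ℝ)) ^ j / (j.factorial : ℂ)) =
      ∑ i ∈ Finset.range (j + 1), (Complex.I ^ j / (j.factorial : ℂ) * (-1) ^ (j - i) *
        (j.choose i : ℂ)) * ((l.1 t * ((inner ℝ u t : ℝ) : ℂ) ^ i) *
          ((starRingEnd ℂ) (m.1 s) * ((inner ℝ u s : ℝ) : ℂ) ^ (j - i))) := by
    intro t s
    rw [inner_sub_right, Complex.ofReal_sub, mul_pow, sub_eq_add_neg, add_pow, Finset.mul_sum,
      Finset.sum_div, Finset.mul_sum]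
    refine Finset.sum_congr rfl fun i _ => ?_
    rw [neg_pow]
    ring
  simp_rw [e]
  rw [Finset.sum_congr rfl fun t _ => Finset.sum_comm, Finset.sum_comm]
  refine Finset.sum_eq_zero fun i hi => ?_
  simp_rw [← Finset.mul_sum, ← Finset.sum_mul]
  have hij := Finset.mem_range.1 hi
  rcases le_or_gt i k with h | h
  · rw [hl i h, zero_mul, mul_zero]
  · rw [hm (j - i) (by omega), mul_zero, mul_zero]

/-- The Taylor correction cancels on `B` and is absent off `B`, so the result does not depend on
`B`; the exponential part factors because `e^{i u·(t-s)}` does. -/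
theorem sum_sum_spectralIntegrand {k : ℕ} (B : Set (Rd d)) (l m : Lam d k) (u : Rd d) :
    ∑ t ∈ l.1.support, ∑ s ∈ m.1.support, l.1 t * (starRingEnd ℂ) (m.1 s) *
      spectralIntegrand k B (t - s) u = specFun k l.1 u * (starRingEnd ℂ) (specFun k m.1 u) := by
  have h1 : ∑ t ∈ l.1.support, ∑ s ∈ m.1.support, l.1 t * (starRingEnd ℂ) (m.1 s) *
      char (t - s) u = lamHat l.1 u * (starRingEnd ℂ) (lamHat m.1 u) := by
    rw [lamHat, lamHat, Finsupp.sum, Finsupp.sum, map_sum, Finset.sum_mul_sum]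
    refine Finset.sum_congr rfl fun t _ => Finset.sum_congr rfl fun s _ => ?_
    rw [map_mul, conj_char, sub_eq_add_neg, char_add]
    ring
  have h2 : ∑ t ∈ l.1.support, ∑ s ∈ m.1.support, l.1 t * (starRingEnd ℂ) (m.1 s) *
      B.indicator (fun v => ∑ j ∈ Finset.range (2 * k + 2),
        (Complex.I * (inner ℝ v (t - s) : ℝ)) ^ j / (j.factorial : ℂ)) u = 0 := by
    by_cases hu : u ∈ B
    · simp_rw [Set.indicator_of_mem hu, Finset.mul_sum]
      rw [Finset.sum_congr rfl fun t _ => Finset.sum_comm, Finset.sum_comm]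
      exact Finset.sum_eq_zero fun j hj =>
        sum_sum_mul_inner_pow_eq_zero l m u (Finset.mem_range.1 hj)
    · simp [Set.indicator_of_notMem hu]
  have h3 : ∀ t s : Rd d, l.1 t * (starRingEnd ℂ) (m.1 s) * spectralIntegrand k B (t - s) u =
      (l.1 t * (starRingEnd ℂ) (m.1 s) * char (t - s) u - l.1 t * (starRingEnd ℂ) (m.1 s) *
        B.indicator (fun v => ∑ j ∈ Finset.range (2 * k + 2),
          (Complex.I * (inner ℝ v (t - s) : ℝ)) ^ j / (j.factorial : ℂ)) u) /
        ((min 1 (‖u‖ ^ (2 * k + 2)) : ℝ) : ℂ) := fun t s => by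
    rw [spectralIntegrand, char]
    ring
  simp_rw [h3, ← Finset.sum_div, Finset.sum_sub_distrib]
  rw [h1, h2, sub_zero, specFun, specFun, map_div₀, Complex.conj_ofReal, div_mul_div_comm,
    min_one_pow_two _ _ (norm_nonneg _), Complex.ofReal_mul]

end Fourier


/-! ### The measures `λ_t`: locally uniform bounds and spanning -/

section EvalMeas

variable {d k : ℕ}

/-- The weight of a point in `lamBound`. -/
def ptBound (k : ℕ) (t : Rd d) : ℝ := 1 + (k + 5) * ‖t‖ ^ (k + 1)

theorem ptBound_nonneg (k : ℕ) (t : Rd d) : 0 ≤ ptBound k t := by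
  unfold ptBound
  positivity

theorem lamBound_eq_sum (k : ℕ) (l : FinMeas d) {S : Finset (Rd d)} (hS : l.support ⊆ S) :
    lamBound k l = ∑ t ∈ S, ‖l t‖ * ptBound k t :=
  Finset.sum_subset hS fun t _ ht => by simp [Finsupp.notMem_support_iff.1 ht]

theorem lamBound_add_le (k : ℕ) (a b : FinMeas d) :
    lamBound k (a + b) ≤ lamBound k a + lamBound k b := by
  classical
  rw [lamBound_eq_sum k (a + b) Finsupp.support_add,
    lamBound_eq_sum k a Finset.subset_union_left, lamBound_eq_sum k b Finset.subset_union_right,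
    ← Finset.sum_add_distrib]
  refine Finset.sum_le_sum fun t _ => ?_
  rw [← add_mul]
  exact mul_le_mul_of_nonneg_right (norm_add_le _ _) (ptBound_nonneg k t)

theorem lamBound_neg (k : ℕ) (a : FinMeas d) : lamBound k (-a) = lamBound k a := by
  rw [lamBound, lamBound, Finsupp.support_neg]
  simp

theorem lamBound_sub_le (k : ℕ) (a b : FinMeas d) :
    lamBound k (a - b) ≤ lamBound k a + lamBound k b := by
  rw [sub_eq_add_neg, ← lamBound_neg k b]
  exact lamBound_add_le k a (-b)

theorem lamBound_sum_le (k : ℕ) {ι : Type*} (S : Finset ι) (a : ι → FinMeas d) :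
    lamBound k (∑ i ∈ S, a i) ≤ ∑ i ∈ S, lamBound k (a i) :=
  Finset.le_sum_of_subadditive (lamBound k) (by simp [lamBound]) (lamBound_add_le k) S a

theorem lamBound_single (k : ℕ) (t : Rd d) (c : ℂ) :
    lamBound k (Finsupp.single t c) = ‖c‖ * ptBound k t := by
  rw [lamBound_eq_sum k _ Finsupp.support_single_subset]
  simp

variable (pt : Exponents d k → Rd d) (hpt : (monomialMatrix pt).det ≠ 0)

theorem continuous_monomialCoeff (j : Exponents d k) :
    Continuous fun t => monomialCoeff pt t j := by
  have h : ∀ m : Exponents d k, Continuous (monomialFun m) := fun m => by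
    unfold monomialFun
    fun_prop
  unfold monomialCoeff Matrix.mulVec dotProduct
  fun_prop

theorem lamHat_single (t : Rd d) (c : ℂ) (u : Rd d) :
    lamHat (Finsupp.single t c) u = c * char t u :=
  Finsupp.sum_single_index (by simp)

theorem lamHat_finsetSum {ι : Type*} (S : Finset ι) (a : ι → FinMeas d) (u : Rd d) :
    lamHat (∑ i ∈ S, a i) u = ∑ i ∈ S, lamHat (a i) u :=
  (Finsupp.sum_finsetSum_index (by simp) (by intros; ring)).symm

theorem lamHat_evalMeas (t u : Rd d) : lamHat (evalMeas pt hpt t).1 u =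
    char t u - ∑ j, (monomialCoeff pt t j : ℂ) * char (pt j) u := by
  rw [evalMeas, lamHat_sub, lamHat_finsetSum, lamHat_single, one_mul]
  simp_rw [lamHat_single]

theorem continuous_lamHat_evalMeas (u : Rd d) :
    Continuous fun t => lamHat (evalMeas pt hpt t).1 u := by
  simp_rw [lamHat_evalMeas]
  have h := continuous_monomialCoeff pt
  refine (continuous_char.comp (continuous_id.prodMk continuous_const)).sub ?_
  exact continuous_finsetSum _ fun j _ =>
    (Complex.continuous_ofReal.comp (h j)).mul continuous_const

/-- The right side is continuous in `t`, so the functions `specFun k λ_s` are uniformly bounded for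
`s` near a given point. -/
theorem lamBound_evalMeas_le (t : Rd d) : lamBound k (evalMeas pt hpt t).1 ≤
    ptBound k t + ∑ j, |monomialCoeff pt t j| * ptBound k (pt j) := by
  rw [evalMeas]
  refine (lamBound_sub_le k _ _).trans (add_le_add ?_ ?_)
  · rw [lamBound_single, norm_one, one_mul]
  · refine (lamBound_sum_le k _ _).trans_eq (Finset.sum_congr rfl fun j _ => ?_)
    rw [lamBound_single, Complex.norm_real, Real.norm_eq_abs]

/-- Every element of `Λ_k` is a combination of the measures `λ_t`. -/
theorem eq_sum_smul_evalMeas (l : Lam d k) :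
    l = ∑ t ∈ l.1.support, l.1 t • evalMeas pt hpt t := by
  -- The coefficients `B⁻¹ b(t)` are combinations of monomials of degree at most `k`, which `l`
  -- annihilates; hence the masses at the points `pt j` cancel.
  have hcoef : ∀ j, ∑ t ∈ l.1.support, l.1 t * (monomialCoeff pt t j : ℂ) = 0 := by
    intro j
    have hm : ∀ m : Exponents d k, ∑ t ∈ l.1.support, l.1 t * (monomialFun m t : ℂ) = 0 := by
      intro m
      have h := l.2 (∏ i, MvPolynomial.X i ^ (m.1 i : ℕ)) (by
        refine (MvPolynomial.totalDegree_finsetProd _ _).trans (le_trans ?_ m.2)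
        refine Finset.sum_le_sum fun i _ => ?_
        refine (MvPolynomial.totalDegree_pow _ _).trans ?_
        rw [MvPolynomial.totalDegree_X, mul_one])
      rw [← h, Finsupp.sum]
      refine Finset.sum_congr rfl fun t _ => ?_
      rw [polyEval, map_prod, monomialFun]
      simp
    have e : ∀ t : Rd d, l.1 t * (monomialCoeff pt t j : ℂ) =
        ∑ m, ((monomialMatrix pt)⁻¹ j m : ℂ) * (l.1 t * (monomialFun m t : ℂ)) := fun t => by
      rw [monomialCoeff, Matrix.mulVec, dotProduct]
      push_cast
      rw [Finset.mul_sum]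
      exact Finset.sum_congr rfl fun m _ => by ring
    simp_rw [e]
    rw [Finset.sum_comm]
    refine Finset.sum_eq_zero fun m _ => ?_
    rw [← Finset.mul_sum, hm m, mul_zero]
  apply Subtype.ext
  rw [Submodule.coe_sum]
  simp_rw [Submodule.coe_smul, evalMeas, smul_sub, Finset.smul_sum, Finsupp.smul_single,
    smul_eq_mul, mul_one]
  rw [Finset.sum_sub_distrib, Finset.sum_comm]
  simp_rw [← Finsupp.single_finsetSum, hcoef]
  simp only [Finsupp.single_zero, Finset.sum_const_zero, sub_zero]
  exact (Finsupp.sum_single l.1).symm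

end EvalMeas

/-! ### The covariance kernel: invariance, continuity, positive definiteness -/

section CovKernel

variable {V : Type*} [NormedAddCommGroup V] [InnerProductSpace ℂ V] [CompleteSpace V]
  {d k : ℕ} (χ : VectorMeasure (Rd d) (TraceClass V))

/-- The covariance `∫ \hat l \bar{\hat m} / (1 ∧ ‖u‖^{2k+2}) χ(du)`. -/
def covKer (l m : Lam d k) : TraceClass V :=
  cint χ fun u => specFun k l.1 u * (starRingEnd ℂ) (specFun k m.1 u)

theorem specFun_add (a b : FinMeas d) (u : Rd d) :
    specFun k (a + b) u = specFun k a u + specFun k b u := by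
  rw [specFun, lamHat_add, add_div, specFun, specFun]

theorem specFun_smul (c : ℂ) (a : FinMeas d) (u : Rd d) :
    specFun k (c • a) u = c * specFun k a u := by
  rw [specFun, lamHat_smul, mul_div_assoc, specFun]

theorem stronglyMeasurable_specFun_mul_conj (l m : Lam d k) :
    StronglyMeasurable fun u => specFun k l.1 u * (starRingEnd ℂ) (specFun k m.1 u) :=
  (stronglyMeasurable_specFun k _).mul
    (Complex.continuous_conj.comp_stronglyMeasurable (stronglyMeasurable_specFun k _))

theorem norm_specFun_mul_conj_le (l m : Lam d k) (u : Rd d) :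
    ‖specFun k l.1 u * (starRingEnd ℂ) (specFun k m.1 u)‖ ≤ lamBound k l.1 * lamBound k m.1 := by
  rw [norm_mul, RCLike.norm_conj]
  exact mul_le_mul (norm_specFun_le l u) (norm_specFun_le m u) (norm_nonneg _)
    ((norm_nonneg _).trans (norm_specFun_le l u))

/-- A translation multiplies both Fourier transforms by the same unimodular character, which cancels
against its conjugate. -/
theorem covKer_shiftMeas (w : Rd d) (l m : Lam d k) :
    covKer χ (shiftMeas w l) (shiftMeas w m) = covKer χ l m := by
  rw [covKer, covKer]
  congr 1
  funext u
  rw [specFun, specFun, lamHat_shiftMeas, lamHat_shiftMeas, mul_div_assoc, mul_div_assoc, map_mul,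
    mul_mul_mul_comm, Complex.mul_conj, Complex.normSq_eq_norm_sq, norm_char]
  simp [specFun]

variable [IsFiniteMeasure χ.variation]

theorem covKer_add_right (l m m' : Lam d k) :
    covKer χ l (m + m') = covKer χ l m + covKer χ l m' := by
  rw [covKer, covKer, covKer, cint, cint, cint, ← VectorMeasure.integral_fun_add
    (integrable_variation_of_norm_le χ (stronglyMeasurable_specFun_mul_conj l m)
      (norm_specFun_mul_conj_le l m))
    (integrable_variation_of_norm_le χ (stronglyMeasurable_specFun_mul_conj l m')
      (norm_specFun_mul_conj_le l m'))]
  congr 1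
  funext u
  rw [Submodule.coe_add, specFun_add, map_add, mul_add]

theorem covKer_smul_right (c : ℂ) (l m : Lam d k) :
    covKer χ l (c • m) = (starRingEnd ℂ) c • covKer χ l m := by
  rw [covKer, covKer, ← cint_const_mul]
  congr 1
  funext u
  rw [Submodule.coe_smul, specFun_smul, map_mul]
  ring

/-- The finite double sum moves inside the integral, where `sum_sum_spectralIntegrand` applies. Each
term is integrable because the spectral integrand is bounded. -/
theorem kernelForm_spectralKernel {B : Set (Rd d)} (hBm : MeasurableSet B)
    (hB : Bornology.IsBounded B) (hB0 : B ∈ 𝓝 (0 : Rd d)) (l m : Lam d k) :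
    kernelForm (spectralKernel k B χ 0) l.1 m.1 = covKer χ l m := by
  have hint : ∀ (h : Rd d) (c : ℂ),
      Integrable (fun u => c * spectralIntegrand k B h u) χ.variation := fun h c => by
    obtain ⟨C, hC⟩ := exists_norm_spectralIntegrand_le k hB hB0 h
    exact (integrable_variation_of_norm_le χ (stronglyMeasurable_spectralIntegrand k hBm h)
      hC).const_mul c
  have hint' : ∀ t : Rd d, Integrable (fun u => ∑ s ∈ m.1.support,
      l.1 t * (starRingEnd ℂ) (m.1 s) * spectralIntegrand k B (t - s) u) χ.variation := fun t =>
    MeasureTheory.integrable_finsetSum _ fun s _ => hint _ _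
  rw [covKer, cint, ← funext (sum_sum_spectralIntegrand B l m),
    VectorMeasure.integral_finsetSum _ fun t _ => hint' t, kernelForm, Finsupp.sum]
  refine Finset.sum_congr rfl fun t _ => ?_
  rw [VectorMeasure.integral_finsetSum _ fun s _ => hint _ _, Finsupp.sum]
  refine Finset.sum_congr rfl fun s _ => ?_
  rw [spectralKernel, Pi.zero_apply, add_zero]
  exact (cint_const_mul χ _ _).symm

theorem norm_covKer_self_le (l : Lam d k) :
    ‖covKer χ l l‖ ≤ ∫ u, ‖specFun k l.1 u‖ ^ 2 ∂χ.variation := by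
  refine (norm_cint_le χ _).trans_eq (integral_congr_ae (Eventually.of_forall fun u => ?_))
  simp only [norm_mul, RCLike.norm_conj]
  ring

/-- Dominated convergence with respect to the variation: the integrand is continuous in `s`,
vanishes at `s = t`, and is bounded uniformly for `s` near `t`. It yields both mean-square
continuity and separability of the factor space. -/
theorem tendsto_norm_covKer_evalMeas (pt : Exponents d k → Rd d)
    (hpt : (monomialMatrix pt).det ≠ 0) (t : Rd d) :
    Tendsto (fun s => ‖covKer χ (evalMeas pt hpt s - evalMeas pt hpt t)
      (evalMeas pt hpt s - evalMeas pt hpt t)‖) (𝓝 t) (𝓝 0) := by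
  refine squeeze_zero (fun _ => norm_nonneg _) (fun s => norm_covKer_self_le χ _) ?_
  set b : Rd d → ℝ := fun t => ptBound k t + ∑ j, |monomialCoeff pt t j| * ptBound k (pt j) with hb
  have hbc : Continuous b := by
    have h := continuous_monomialCoeff pt
    have h' : Continuous fun t : Rd d => ptBound k t := by
      unfold ptBound
      fun_prop
    refine h'.add (continuous_finsetSum _ fun j _ => ?_)
    exact (h j).abs.mul continuous_const
  have hev : ∀ᶠ s in 𝓝 t, b s < b t + 1 :=
    (hbc.tendsto t).eventually (gt_mem_nhds (lt_add_one _))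
  have hlim := tendsto_integral_filter_of_dominated_convergence (μ := χ.variation) (l := 𝓝 t)
    (F := fun s u => ‖specFun k (evalMeas pt hpt s - evalMeas pt hpt t).1 u‖ ^ 2)
    (f := fun _ => (0 : ℝ)) (fun _ => (b t + 1 + b t) ^ 2) ?_ ?_ (integrable_const _) ?_
  · simpa using hlim
  · exact Eventually.of_forall fun s =>
      ((stronglyMeasurable_specFun k _).norm.pow 2).aestronglyMeasurable
  · filter_upwards [hev] with s hs
    refine Eventually.of_forall fun u => ?_
    rw [norm_pow, norm_norm]
    gcongr
    refine (norm_specFun_le _ u).trans ((lamBound_sub_le k _ _).trans ?_)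
    exact add_le_add ((lamBound_evalMeas_le pt hpt s).trans hs.le) (lamBound_evalMeas_le pt hpt t)
  · refine Eventually.of_forall fun u => ?_
    have h1 : Continuous fun s => ‖specFun k (evalMeas pt hpt s - evalMeas pt hpt t).1 u‖ ^ 2 := by
      have : ∀ s, specFun k (evalMeas pt hpt s - evalMeas pt hpt t).1 u =
          (lamHat (evalMeas pt hpt s).1 u - lamHat (evalMeas pt hpt t).1 u) /
            (min 1 (‖u‖ ^ (k + 1)) : ℝ) := fun s => by
        rw [specFun, Submodule.coe_sub, lamHat_sub]
      simp_rw [this]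
      exact ((((continuous_lamHat_evalMeas pt hpt u).sub continuous_const).div_const _).norm).pow 2
    have h2 := h1.tendsto t
    simpa [specFun, lamHat] using h2

theorem re_sum_inner_covKer_nonneg (hχ : IsPositiveMeasure χ) {ι : Type*} [Fintype ι]
    (l : ι → Lam d k) (v : ι → V) :
    0 ≤ (∑ i, ∑ j, inner ℂ (v i) (TraceClass.toCLM (covKer χ (l i) (l j)) (v j)) : ℂ).re := by
  have hφm : StronglyMeasurable fun (u : Rd d) (i : ι) => specFun k (l i).1 u :=
    (measurable_pi_iff.2 fun i => (stronglyMeasurable_specFun k (l i).1).measurable).stronglyMeasurable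
  have h0 : ∀ i, 0 ≤ lamBound k (l i).1 := fun i =>
    (norm_nonneg _).trans (norm_specFun_le (l i) 0)
  have hφ : ∀ u : Rd d, ‖fun i => specFun k (l i).1 u‖ ≤ ∑ i, lamBound k (l i).1 := by
    intro u
    refine (pi_norm_le_iff_of_nonneg (Finset.sum_nonneg fun i _ => h0 i)).2 fun i => ?_
    exact (norm_specFun_le (l i) u).trans
      (Finset.single_le_sum (f := fun i => lamBound k (l i).1) (fun i _ => h0 i)
        (Finset.mem_univ i))
  exact hχ.re_sum_inner_nonneg hφm hφ v

-- Hermitian symmetry comes from exchanging `l` and `m` under conjugation, positivity from applying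
-- `IsPositiveMeasure.re_sum_inner_nonneg` to the family `specFun k (l i)`.
open scoped ComplexOrder in
theorem posSemidef_covKer (hχ : IsPositiveMeasure χ) :
    (Matrix.of fun l m : Lam d k => TraceClass.toCLM (covKer χ l m)).PosSemidef := by
  have htfae := (RKHS.posSemidef_tfae (𝕜 := ℂ)
    (K := Matrix.of fun l m : Lam d k => TraceClass.toCLM (covKer χ l m))).out 0 2
  refine htfae.2 ⟨?_, fun vv => ?_⟩
  · ext l m y
    rw [Matrix.conjTranspose_apply, Matrix.of_apply, Matrix.of_apply,
      ContinuousLinearMap.star_eq_adjoint]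
    refine ext_inner_left ℂ fun x => ?_
    rw [ContinuousLinearMap.adjoint_inner_right, covKer, ← hχ.inner_cint_conj
      (stronglyMeasurable_specFun_mul_conj m l) (norm_specFun_mul_conj_le m l), covKer]
    congr 5
    funext u
    rw [map_mul, RCLike.conj_conj, mul_comm]
  · have h := re_sum_inner_covKer_nonneg χ hχ (fun i : vv.support => i.1) fun i => vv i.1
    refine h.trans_eq ?_
    rw [Finsupp.sum]
    simp_rw [Finsupp.sum]
    -- Conjugation leaves the real part alone and swaps the arguments of the inner products, which
    -- matches the two forms of the sum.
    have hre : ∀ z : ℂ, RCLike.re z = ((starRingEnd ℂ) z).re := fun z => by simp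
    rw [hre, map_sum]
    simp_rw [map_sum, inner_conj_symm]
    have e : ∀ g : Lam d k → Lam d k → ℂ, ∑ i : vv.support, ∑ j : vv.support, g j i =
        ∑ x ∈ vv.support, ∑ y ∈ vv.support, g y x := fun g => by
      exact (Finset.sum_congr rfl fun (i : vv.support) _ =>
        Finset.sum_coe_sort vv.support fun y => g y i).trans
        (Finset.sum_coe_sort vv.support fun x => ∑ y ∈ vv.support, g y x)
    rw [Finset.sum_comm]
    exact congrArg Complex.re
      (e fun y x => inner ℂ (vv y) (TraceClass.toCLM (covKer χ y x) (vv x)))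

end CovKernel


/-! ### Parseval sequences in separable Hilbert spaces -/

section Sequence

variable {ℋ : Type*} [NormedAddCommGroup ℋ] [InnerProductSpace ℂ ℋ]

/-- Distinct orthonormal vectors are at distance `√2`, so balls of radius `1/2` around them are
disjoint. -/
theorem countable_of_hilbertBasis [TopologicalSpace.SeparableSpace ℋ] {ι : Type*} (b : HilbertBasis ι ℂ ℋ) : Countable ι := by
  refine Pairwise.countable_of_isOpen_disjoint (s := fun i => Metric.ball (b i) (1 / 2))
    (fun i j hij => Metric.ball_disjoint_ball ?_) (fun i => Metric.isOpen_ball)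
    fun i => Metric.nonempty_ball.2 one_half_pos
  have h : ‖b i - b j‖ ^ 2 = 2 := by
    rw [norm_sub_sq (𝕜 := ℂ), b.orthonormal.1, b.orthonormal.1, b.orthonormal.2 hij]
    norm_num
  rw [dist_eq_norm]
  nlinarith [norm_nonneg (b i - b j)]

/-- A sequence that satisfies Parseval's identity. -/
theorem exists_parseval_seq (ℋ : Type*) [NormedAddCommGroup ℋ] [InnerProductSpace ℂ ℋ]
    [CompleteSpace ℋ] [TopologicalSpace.SeparableSpace ℋ] : ∃ f : ℕ → ℋ, ∀ x y : ℋ,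
      HasSum (fun n => inner ℂ x (f n) * inner ℂ (f n) y : ℕ → ℂ) (inner ℂ x y) := by
  obtain ⟨w, b, -⟩ := exists_hilbertBasis ℂ ℋ
  have := countable_of_hilbertBasis b
  obtain ⟨e, he⟩ := exists_injective_nat w
  -- The basis is padded with zero vectors, so that finite-dimensional spaces are covered by the
  -- same index set `ℕ`.
  refine ⟨Function.extend e b 0, fun x y => ?_⟩
  have h : (fun n => inner ℂ x (Function.extend e b 0 n) * inner ℂ (Function.extend e b 0 n) y) =
      Function.extend e (fun i => (inner ℂ x (b i) * inner ℂ (b i) y : ℂ)) 0 := by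
    funext n
    rw [Function.apply_extend (fun z => (inner ℂ x z * inner ℂ z y : ℂ))]
    congr 1
    funext n
    simp
  rw [h, hasSum_extend_zero he]
  exact b.hasSum_inner_mul_inner x y

theorem tsum_enorm_inner_sq_of_parseval {f : ℕ → ℋ} (hf : ∀ x y : ℋ,
    HasSum (fun n => inner ℂ x (f n) * inner ℂ (f n) y : ℕ → ℂ) (inner ℂ x y)) (x : ℋ) :
    ∑' n, ‖inner ℂ x (f n)‖ₑ ^ 2 = ‖x‖ₑ ^ 2 := by
  have h2 : HasSum (fun n => ‖inner ℂ x (f n)‖ ^ 2) (‖x‖ ^ 2) := by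
    have h3 := Complex.hasSum_re (hf x x)
    have e1 : ∀ j, (inner ℂ x (f j) * inner ℂ (f j) x : ℂ).re = ‖inner ℂ x (f j)‖ ^ 2 := by
      intro j
      rw [← inner_conj_symm (f j) x, Complex.mul_conj, Complex.ofReal_re,
        Complex.normSq_eq_norm_sq]
    have e2 : (inner ℂ x x : ℂ).re = ‖x‖ ^ 2 := by
      have := inner_self_eq_norm_sq (𝕜 := ℂ) x
      simpa using this
    simpa only [e1, e2] using h3
  have h4 : ∀ y : ℂ, ‖y‖ₑ ^ 2 = ENNReal.ofReal (‖y‖ ^ 2) := fun y => by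
    rw [ENNReal.ofReal_pow (norm_nonneg _), ofReal_norm]
  simp_rw [h4]
  rw [← ENNReal.ofReal_tsum_of_nonneg (fun j => by positivity) h2.summable, h2.tsum_eq,
    ENNReal.ofReal_pow (norm_nonneg _), ofReal_norm]

end Sequence

/-! ### A discrete random index with a random sign -/

section SignedSequence

/-- A probability on `ℕ × {±1}`: a geometric variable and an independent random sign. -/
def geomSign : PMF (ℕ × Bool) :=
  ⟨fun ω => (2⁻¹ : ℝ≥0∞) ^ (ω.1 + 2), by
    have h : ∑' ω : ℕ × Bool, (2⁻¹ : ℝ≥0∞) ^ (ω.1 + 2) = 1 := by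
      rw [ENNReal.tsum_prod']
      have h1 : ∀ n : ℕ, ∑' _ : Bool, (2⁻¹ : ℝ≥0∞) ^ (n + 2) = 2⁻¹ * 2⁻¹ ^ n := fun n => by
        rw [tsum_bool, ← two_mul, show n + 2 = n + 1 + 1 from rfl, pow_succ', ← mul_assoc,
          ENNReal.mul_inv_cancel two_ne_zero ENNReal.ofNat_ne_top, one_mul, pow_succ']
      simp_rw [h1]
      rw [ENNReal.tsum_mul_left, ENNReal.tsum_geometric, ENNReal.one_sub_inv_two, inv_inv,
        ENNReal.inv_mul_cancel two_ne_zero ENNReal.ofNat_ne_top]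
    rw [← h]
    exact ENNReal.summable.hasSum⟩

/-- The measure of `geomSign`. -/
def geomSignMeasure : Measure (ℕ × Bool) := geomSign.toMeasure

instance : IsProbabilityMeasure geomSignMeasure :=
  inferInstanceAs (IsProbabilityMeasure geomSign.toMeasure)

theorem geomSignMeasure_singleton (ω : ℕ × Bool) : geomSignMeasure {ω} = 2⁻¹ ^ (ω.1 + 2) :=
  geomSign.toMeasure_apply_singleton ω (measurableSet_singleton ω)

theorem geomSignMeasure_real_singleton (ω : ℕ × Bool) :
    geomSignMeasure.real {ω} = 2⁻¹ ^ (ω.1 + 2) := by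
  rw [Measure.real, geomSignMeasure_singleton]
  simp

/-- The signed normalizing factor `± 2^{(n+1)/2}`. -/
def signCoeff (ω : ℕ × Bool) : ℝ := (if ω.2 then 1 else -1) * √(2 ^ (ω.1 + 1))

theorem signCoeff_sq (ω : ℕ × Bool) : signCoeff ω * signCoeff ω = 2 ^ (ω.1 + 1) := by
  rw [signCoeff, mul_mul_mul_comm, Real.mul_self_sqrt (by positivity)]
  split_ifs <;> ring

/-- The normalization makes every index count with weight `1` in second moments, one half for each
sign. -/
theorem real_singleton_mul_signCoeff_sq (ω : ℕ × Bool) :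
    geomSignMeasure.real {ω} * (signCoeff ω * signCoeff ω) = 2⁻¹ := by
  rw [geomSignMeasure_real_singleton, signCoeff_sq, pow_succ, mul_right_comm, ← mul_pow]
  norm_num

theorem enorm_signCoeff_sq_mul (ω : ℕ × Bool) :
    ‖signCoeff ω‖ₑ ^ 2 * geomSignMeasure {ω} = 2⁻¹ := by
  have h : geomSignMeasure {ω} = ENNReal.ofReal (geomSignMeasure.real {ω}) := by
    rw [Measure.real, ENNReal.ofReal_toReal (measure_ne_top _ _)]
  rw [h, ← ofReal_norm, ← ENNReal.ofReal_pow (norm_nonneg _), ← ENNReal.ofReal_mul (by positivity),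
    Real.norm_eq_abs, sq_abs, mul_comm, sq, real_singleton_mul_signCoeff_sq,
    ENNReal.ofReal_inv_of_pos two_pos, ENNReal.ofReal_ofNat]

variable {E : Type*} [NormedAddCommGroup E] [NormedSpace ℂ E]

theorem lintegral_enorm_sq_signCoeff_smul (g : ℕ → E) :
    ∫⁻ ω, ‖(signCoeff ω : ℂ) • g ω.1‖ₑ ^ 2 ∂geomSignMeasure = ∑' n, ‖g n‖ₑ ^ 2 := by
  rw [lintegral_countable']
  have h : ∀ ω : ℕ × Bool, ‖(signCoeff ω : ℂ) • g ω.1‖ₑ ^ 2 * geomSignMeasure {ω} =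
      2⁻¹ * ‖g ω.1‖ₑ ^ 2 := fun ω => by
    rw [enorm_smul, mul_pow, mul_right_comm, ← enorm_signCoeff_sq_mul ω]
    congr 3
    rw [← ofReal_norm, ← ofReal_norm, Complex.norm_real]
  simp_rw [h]
  rw [ENNReal.tsum_prod']
  refine tsum_congr fun n => ?_
  rw [tsum_bool, ← two_mul, ← mul_assoc, ENNReal.mul_inv_cancel two_ne_zero ENNReal.ofNat_ne_top,
    one_mul]

theorem memLp_signCoeff_smul {g : ℕ → E} (hg : ∑' n, ‖g n‖ₑ ^ 2 ≠ ∞) :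
    MemLp (fun ω => (signCoeff ω : ℂ) • g ω.1) 2 geomSignMeasure := by
  refine ⟨(StronglyMeasurable.of_discrete).aestronglyMeasurable, ?_⟩
  rw [eLpNorm_lt_top_iff_lintegral_rpow_enorm_lt_top two_ne_zero ENNReal.ofNat_ne_top]
  have h : ∫⁻ ω, ‖(signCoeff ω : ℂ) • g ω.1‖ₑ ^ (2 : ℝ≥0∞).toReal ∂geomSignMeasure =
      ∫⁻ ω, ‖(signCoeff ω : ℂ) • g ω.1‖ₑ ^ 2 ∂geomSignMeasure := by
    simp
  rw [h, lintegral_enorm_sq_signCoeff_smul]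
  exact hg.lt_top

/-- Flipping the sign preserves the probability and negates the integrand, so the integral equals
its opposite. -/
theorem integral_signCoeff_smul [CompleteSpace E] {g : ℕ → E} (hg : ∑' n, ‖g n‖ₑ ^ 2 ≠ ∞) :
    ∫ ω, (signCoeff ω : ℂ) • g ω.1 ∂geomSignMeasure = 0 := by
  rw [integral_countable ((memLp_signCoeff_smul hg).integrable one_le_two)]
  set T := ∑' ω : ℕ × Bool, geomSignMeasure.real {ω} • (signCoeff ω : ℂ) • g ω.1 with hT
  have h : T = -T := by
    conv_lhs => rw [hT, ← (Equiv.prodCongr (Equiv.refl ℕ) Equiv.boolNot).tsum_eq]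
    rw [hT, ← tsum_neg]
    refine tsum_congr fun ω => ?_
    obtain ⟨n, b⟩ := ω
    rw [geomSignMeasure_real_singleton, geomSignMeasure_real_singleton]
    cases b <;> simp [signCoeff]
  have h2 : (2 : ℂ) • T = 0 := by
    rw [two_smul]
    nth_rw 2 [h]
    exact add_neg_cancel T
  exact (smul_eq_zero.1 h2).resolve_left two_ne_zero

end SignedSequence

/-! ### Realizing a factorized covariance by a process -/

section Realization

variable {V : Type*} [NormedAddCommGroup V] [InnerProductSpace ℂ V] [CompleteSpace V]

theorem integrable_outer {Ω : Type*} [MeasurableSpace Ω] [Countable Ω] [MeasurableSingletonClass Ω]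
    {P : Measure Ω} {X Z : Ω → V} (hX : MemLp X 2 P) (hZ : MemLp Z 2 P) :
    Integrable (fun ω => TraceClass.outer (X ω) (Z ω)) P := by
  refine (hX.integrable_norm_pow two_ne_zero |>.add (hZ.integrable_norm_pow two_ne_zero)).mono'
    (StronglyMeasurable.of_discrete).aestronglyMeasurable (Eventually.of_forall fun ω => ?_)
  exact TraceClass.norm_outer_le _ _

variable {ℋ : Type*} [NormedAddCommGroup ℋ] [InnerProductSpace ℂ ℋ] [CompleteSpace ℋ]
  {L : Type*} [AddCommGroup L] [Module ℂ L]

/-- The process `ω = (n, ±) ↦ ± 2^{(n+1)/2} W(l) f_n`. -/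
def signedSeq (W : L →ₗ[ℂ] ℋ →L[ℂ] V) (f : ℕ → ℋ) (ω : ℕ × Bool) : L →ₗ[ℂ] V :=
  (signCoeff ω : ℂ) • (ContinuousLinearMap.apply ℂ V (f ω.1)).toLinearMap.comp W

theorem signedSeq_apply (W : L →ₗ[ℂ] ℋ →L[ℂ] V) (f : ℕ → ℋ) (ω : ℕ × Bool) (l : L) :
    signedSeq W f ω l = (signCoeff ω : ℂ) • W l (f ω.1) := rfl

variable {f : ℕ → ℋ} (hf : ∀ x y : ℋ,
    HasSum (fun n => inner ℂ x (f n) * inner ℂ (f n) y : ℕ → ℂ) (inner ℂ x y))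
  {W : L →ₗ[ℂ] ℋ →L[ℂ] V} {C : L → L → TraceClass V}
  (hC : ∀ l m, TraceClass.toCLM (C l m) = (W l).comp (ContinuousLinearMap.adjoint (W m)))

-- Both sides are the squared Hilbert-Schmidt norm of `W l`: the double sum of `|⟨e_j, W(l) f_n⟩|²`,
-- taken over `j` first or over `n` first. As `C l l` is of trace class, the second moments are
-- finite.
include hf hC in
theorem tsum_enorm_sq_eval (l : L) : ∑' n, ‖W l (f n)‖ₑ ^ 2 = ‖C l l‖ₑ := by
  have hpos : (TraceClass.toCLM (C l l)).IsPositive := by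
    rw [hC]
    exact ContinuousLinearMap.isPositive_self_comp_adjoint _
  rw [TraceClass.enorm_of_isPositive hpos]
  simp_rw [← tsum_enorm_inner_sq (cons V) (W l _)]
  rw [ENNReal.tsum_comm]
  refine tsum_congr fun j => ?_
  simp_rw [← ContinuousLinearMap.adjoint_inner_left (W l)]
  rw [tsum_enorm_inner_sq_of_parseval hf, hC, ContinuousLinearMap.comp_apply,
    ← ContinuousLinearMap.adjoint_inner_left (W l), ← ofReal_norm,
    ← ENNReal.ofReal_pow (norm_nonneg _)]
  congr 1
  have := inner_self_eq_norm_sq (𝕜 := ℂ) (ContinuousLinearMap.adjoint (W l) (cons V j))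
  simpa using this.symm

include hf hC in
theorem memLp_signedSeq (l : L) :
    MemLp (fun ω => signedSeq W f ω l) 2 geomSignMeasure :=
  memLp_signCoeff_smul (g := fun n => W l (f n)) (by
    rw [tsum_enorm_sq_eval hf hC]
    exact enorm_ne_top)

include hf hC in
theorem integral_signedSeq (l : L) : ∫ ω, signedSeq W f ω l ∂geomSignMeasure = 0 :=
  integral_signCoeff_smul (g := fun n => W l (f n)) (by
    rw [tsum_enorm_sq_eval hf hC]
    exact enorm_ne_top)

include hf hC in
theorem lintegral_enorm_sq_signedSeq (l : L) :
    ∫⁻ ω, ‖signedSeq W f ω l‖ₑ ^ 2 ∂geomSignMeasure = ‖C l l‖ₑ := by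
  rw [← tsum_enorm_sq_eval hf hC]
  exact lintegral_enorm_sq_signCoeff_smul fun n => W l (f n)

-- By matrix coefficients: `⟨x, C(l, m) y⟩ = ⟨W(l)* x, W(m)* y⟩` is expanded by Parseval's identity,
-- and each term is the total contribution of the two outcomes with index `n`.
include hf hC in
theorem crossCov_signedSeq (l m : L) : crossCov geomSignMeasure
    (fun ω => signedSeq W f ω l) (fun ω => signedSeq W f ω m) = C l m := by
  have hint := integrable_outer (memLp_signedSeq hf hC l) (memLp_signedSeq hf hC m)
  refine TraceClass.ext_coeff fun x y => ?_
  rw [crossCov, ← TraceClass.coeffL_apply, ← ContinuousLinearMap.integral_comp_comm _ hint,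
    integral_countable ((TraceClass.coeffL x y).integrable_comp hint)]
  set x' := ContinuousLinearMap.adjoint (W l) x with hx'
  set y' := ContinuousLinearMap.adjoint (W m) y with hy'
  -- The weight `1/2` is written as a function of the sign so that the sum over `ℕ × Bool` splits as
  -- a product of two sums.
  have h : ∀ ω : ℕ × Bool, geomSignMeasure.real {ω} • TraceClass.coeffL x y
      (TraceClass.outer (signedSeq W f ω l) (signedSeq W f ω m)) =
      (inner ℂ x' (f ω.1) * inner ℂ (f ω.1) y') * (fun _ : Bool => (2⁻¹ : ℂ)) ω.2 := fun ω => by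
    have h1 : ((geomSignMeasure.real {ω} * (signCoeff ω * signCoeff ω) : ℝ) : ℂ) = 2⁻¹ := by
      rw [real_singleton_mul_signCoeff_sq]
      simp
    rw [TraceClass.coeffL_apply, TraceClass.coeff_outer, signedSeq_apply, signedSeq_apply,
      inner_smul_left, inner_smul_right, Complex.conj_ofReal, Complex.real_smul, hx', hy',
      ContinuousLinearMap.adjoint_inner_left, ContinuousLinearMap.adjoint_inner_right, ← h1]
    push_cast
    ring
  have hs := hf x' y'
  simp_rw [h]
  rw [← tsum_mul_tsum_of_summable_norm (f := fun n => (inner ℂ x' (f n) * inner ℂ (f n) y' : ℂ))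
    (g := fun _ : Bool => (2⁻¹ : ℂ)) hs.summable.norm (Summable.of_finite), hs.tsum_eq, tsum_bool,
    hC, ContinuousLinearMap.comp_apply, hx', ContinuousLinearMap.adjoint_inner_left,
    hy']
  norm_num

end Realization


/-! ### Factorization through the reproducing kernel Hilbert space -/

section Factorization

variable {V : Type*} [NormedAddCommGroup V] [InnerProductSpace ℂ V] [CompleteSpace V]
  {L : Type*} [AddCommGroup L] [Module ℂ L] {K : Matrix L L (V →L[ℂ] V)}

open scoped ComplexOrder in
/-- The evaluation maps of the reproducing kernel Hilbert space of a sesquilinear kernel. -/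
def kernelFactor [Fact K.PosSemidef] (hadd : ∀ l m m', K l (m + m') = K l m + K l m')
    (hsmul : ∀ (c : ℂ) l m, K l (c • m) = (starRingEnd ℂ) c • K l m) :
    L →ₗ[ℂ] RKHS.OfKernel K →L[ℂ] V where
  -- The kernel section at `l` depends conjugate-linearly on `l`, as `K` does on its second
  -- argument; taking adjoints makes the dependence linear.
  toFun l := ContinuousLinearMap.adjoint (RKHS.kerFun (RKHS.OfKernel K) l)
  map_add' l m := by
    rw [← map_add]
    congr 1
    refine ContinuousLinearMap.ext fun v => RKHS.ext fun x => ?_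
    rw [add_apply, RKHS.coe_add, Pi.add_apply, RKHS.kerFun_apply, RKHS.kerFun_apply,
      RKHS.kerFun_apply, RKHS.OfKernel.kernel_ofKernel, hadd, add_apply]
  map_smul' c l := by
    have h : RKHS.kerFun (RKHS.OfKernel K) (c • l) =
        (starRingEnd ℂ) c • RKHS.kerFun (RKHS.OfKernel K) l := by
      refine ContinuousLinearMap.ext fun v => RKHS.ext fun x => ?_
      rw [smul_apply, RKHS.coe_smul, Pi.smul_apply, RKHS.kerFun_apply,
        RKHS.kerFun_apply, RKHS.OfKernel.kernel_ofKernel, hsmul, smul_apply]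
    rw [h, map_smulₛₗ, RCLike.conj_conj, RingHom.id_apply]

open scoped ComplexOrder in
theorem adjoint_kernelFactor [Fact K.PosSemidef]
    (hadd : ∀ l m m', K l (m + m') = K l m + K l m')
    (hsmul : ∀ (c : ℂ) l m, K l (c • m) = (starRingEnd ℂ) c • K l m) (l : L) :
    ContinuousLinearMap.adjoint (kernelFactor hadd hsmul l) =
      RKHS.kerFun (RKHS.OfKernel K) l :=
  ContinuousLinearMap.adjoint_adjoint _

open scoped ComplexOrder in
theorem kernelFactor_comp_adjoint [Fact K.PosSemidef]
    (hadd : ∀ l m m', K l (m + m') = K l m + K l m')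
    (hsmul : ∀ (c : ℂ) l m, K l (c • m) = (starRingEnd ℂ) c • K l m) (l m : L) :
    (kernelFactor hadd hsmul l).comp (ContinuousLinearMap.adjoint (kernelFactor hadd hsmul m)) =
      K l m := by
  have h := RKHS.kernel_apply (RKHS.OfKernel K) l m
  rw [RKHS.OfKernel.kernel_ofKernel] at h
  rw [h, adjoint_kernelFactor]
  rfl

end Factorization

/-! ### The process with a given positive spectral measure -/

section SpectralProcess

variable {V : Type*} [NormedAddCommGroup V] [InnerProductSpace ℂ V] [CompleteSpace V]
  [TopologicalSpace.SeparableSpace V] {d k : ℕ} {χ : VectorMeasure (Rd d) (TraceClass V)}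

variable (k) in
/-- The kernel `covKer` as a matrix of bounded operators. -/
def covMatrix (χ : VectorMeasure (Rd d) (TraceClass V)) :
    Matrix (Lam d k) (Lam d k) (V →L[ℂ] V) :=
  Matrix.of fun l m => TraceClass.toCLM (covKer χ l m)

/-- Every `l` is a combination of the `λ_t`, so the vectors `W(λ_t)* v` already span a dense
subspace. They form the continuous image of the separable space `ℝ^d × V`. -/
theorem separableSpace_of_factorization [IsFiniteMeasure χ.variation] {ℋ : Type*}
    [NormedAddCommGroup ℋ] [InnerProductSpace ℂ ℋ] [CompleteSpace ℋ]
    {W : Lam d k →ₗ[ℂ] ℋ →L[ℂ] V}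
    (hW : ∀ l m, TraceClass.toCLM (covKer χ l m) =
      (W l).comp (ContinuousLinearMap.adjoint (W m)))
    (hd : (Submodule.span ℂ {ContinuousLinearMap.adjoint (W l) v |
      (l) (v)}).topologicalClosure = ⊤) : TopologicalSpace.SeparableSpace ℋ := by
  obtain ⟨pt, hpt⟩ := exists_det_monomialMatrix_ne_zero d k
  have hc : Continuous fun t => W (evalMeas pt hpt t) := by
    refine continuous_iff_continuousAt.2 fun t => ?_
    rw [ContinuousAt, tendsto_iff_norm_sub_tendsto_zero]
    have h := (Real.continuous_sqrt.tendsto 0).comp (tendsto_norm_covKer_evalMeas χ pt hpt t)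
    rw [Real.sqrt_zero] at h
    refine squeeze_zero (fun _ => norm_nonneg _) (fun s => Real.le_sqrt_of_sq_le ?_) h
    -- `‖W‖² = ‖W W*‖` is the operator norm of the covariance of the increment, hence at most its
    -- trace norm.
    rw [← map_sub, sq, ← LinearIsometryEquiv.norm_map ContinuousLinearMap.adjoint (W _),
      ← ContinuousLinearMap.norm_adjoint_comp_self, ContinuousLinearMap.adjoint_adjoint, ← hW]
    exact TraceClass.norm_toCLM_le _
  have hr : Continuous fun p : Rd d × V =>
      ContinuousLinearMap.adjoint (W (evalMeas pt hpt p.1)) p.2 :=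
    ((ContinuousLinearMap.adjoint.continuous.comp hc).comp continuous_fst).clm_apply continuous_snd
  have hsep := ((TopologicalSpace.isSeparable_range hr).span (R := ℂ)).closure
  refine TopologicalSpace.isSeparable_univ_iff.1 (hsep.mono fun x _ => ?_)
  have hx : x ∈ (Submodule.span ℂ {ContinuousLinearMap.adjoint (W l) v |
      (l) (v)}).topologicalClosure := by
    rw [hd]
    trivial
  refine closure_mono (Submodule.span_le.2 ?_) hx
  rintro _ ⟨l, v, rfl⟩
  rw [eq_sum_smul_evalMeas pt hpt l, map_sum, map_sum, sum_apply]
  refine Submodule.sum_mem _ fun t _ => ?_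
  rw [map_smul, map_smulₛₗ, smul_apply]
  exact Submodule.smul_mem _ _ (Submodule.subset_span ⟨(t, v), rfl⟩)

open scoped ComplexOrder in
/-- The covariance kernel of a positive spectral measure is the covariance function of a
second-order process. -/
theorem IsPositiveMeasure.exists_secondOrder (hχ : IsPositiveMeasure χ) :
    ∃ Y : ℕ × Bool → Lam d k →ₗ[ℂ] V, IsSecondOrder geomSignMeasure Y ∧
      (∀ l m, covFun geomSignMeasure Y l m = covKer χ l m) ∧
      ∀ l, ∫⁻ ω, ‖Y ω l‖ₑ ^ 2 ∂geomSignMeasure = ‖covKer χ l l‖ₑ := by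
  have := hχ.isFiniteMeasure_variation
  have : Fact (covMatrix k χ).PosSemidef := ⟨posSemidef_covKer χ hχ⟩
  have hadd : ∀ l m m', covMatrix k χ l (m + m') = covMatrix k χ l m + covMatrix k χ l m' :=
    fun l m m' => by simp [covMatrix, covKer_add_right]
  have hsmul : ∀ (c : ℂ) l m, covMatrix k χ l (c • m) = (starRingEnd ℂ) c • covMatrix k χ l m :=
    fun c l m => by simp [covMatrix, covKer_smul_right]
  have hC : ∀ l m, TraceClass.toCLM (covKer χ l m) = (kernelFactor hadd hsmul l).comp
      (ContinuousLinearMap.adjoint (kernelFactor hadd hsmul m)) := fun l m =>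
    (kernelFactor_comp_adjoint hadd hsmul l m).symm
  have := separableSpace_of_factorization hC (by
    simp_rw [adjoint_kernelFactor]
    exact RKHS.kerFun_dense (RKHS.OfKernel (covMatrix k χ)))
  obtain ⟨f, hf⟩ := exists_parseval_seq (RKHS.OfKernel (covMatrix k χ))
  exact ⟨signedSeq (kernelFactor hadd hsmul) f,
    fun l => ⟨StronglyMeasurable.of_discrete, memLp_signedSeq hf hC l, integral_signedSeq hf hC l⟩,
    crossCov_signedSeq hf hC, lintegral_enorm_sq_signedSeq hf hC⟩

theorem isMeanSquareContinuous_of_covKer {Ω : Type*} [MeasurableSpace Ω] {P : Measure Ω}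
    {Y : Ω → Lam d k →ₗ[ℂ] V} [IsFiniteMeasure χ.variation]
    (hY : ∀ l, ∫⁻ ω, ‖Y ω l‖ₑ ^ 2 ∂P = ‖covKer χ l l‖ₑ) : IsMeanSquareContinuous P Y := by
  intro pt hpt t
  simp_rw [← map_sub, hY, ← ofReal_norm]
  have h := ENNReal.tendsto_ofReal (tendsto_norm_covKer_evalMeas χ pt hpt t)
  rwa [ENNReal.ofReal_zero] at h

theorem hasSpectralCharacteristics_of_covKer {Ω : Type*} [MeasurableSpace Ω] {P : Measure Ω}
    {Y : Ω → Lam d k →ₗ[ℂ] V} (hχ : IsPositiveMeasure χ) (h0 : χ {0} = 0)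
    (hY : ∀ l m, covFun P Y l m = covKer χ l m) : HasSpectralCharacteristics P Y χ 0 := by
  have := hχ.isFiniteMeasure_variation
  refine ⟨hχ, h0, ⟨0, fun h => by simp⟩, fun l => ?_, fun B hBm hB hB0 h => ?_,
    fun B hBm hB hB0 l m => ?_⟩
  · simp [kernelForm, Finsupp.sum]
  · obtain ⟨C, hC⟩ := exists_norm_spectralIntegrand_le k hB hB0 h
    exact integrable_variation_of_norm_le χ (stronglyMeasurable_spectralIntegrand k hBm h) hC
  · rw [hY, kernelForm_spectralKernel χ hBm hB hB0]

end SpectralProcess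

/-! ### Self-similarity through the substitution `r ↦ c r` -/

section SelfSimilar

variable {V : Type*} [NormedAddCommGroup V] [InnerProductSpace ℂ V] [CompleteSpace V]

theorem outer_map (B : V →L[ℂ] V) (x y : V) : TraceClass.outer (B x) (B y) =
    TraceClass.conjL B (ContinuousLinearMap.adjoint B) (TraceClass.outer x y) := by
  refine TraceClass.ext_coeff fun u v => ?_
  rw [TraceClass.coeff_outer,
    TraceClass.conjL_apply, TraceClass.toCLM_conj, mul_apply_eq_comp, mul_apply_eq_comp,
    ← ContinuousLinearMap.adjoint_inner_left B (TraceClass.toCLM _ _), TraceClass.coeff_outer,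
    ContinuousLinearMap.adjoint_inner_left, ContinuousLinearMap.adjoint_inner_right]

theorem crossCov_map {Ω : Type*} [MeasurableSpace Ω] {P : Measure Ω} {X Z : Ω → V}
    (h : Integrable (fun ω => TraceClass.outer (X ω) (Z ω)) P) (B : V →L[ℂ] V) :
    crossCov P (fun ω => B (X ω)) (fun ω => B (Z ω)) =
      TraceClass.conjL B (ContinuousLinearMap.adjoint B) (crossCov P X Z) := by
  simp_rw [crossCov, outer_map]
  exact ContinuousLinearMap.integral_comp_comm _ h

variable {d k : ℕ} {H : V →L[ℂ] V}
  {σ : VectorMeasure (Metric.sphere (0 : Rd d) 1) (TraceClass V)}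
  (hH : IntegrableOn (radialBound k H) (Set.Ioi 0))

variable (H σ) in
/-- The radial density of `covKer` for a polar measure. -/
def radialCov (l m : Lam d k) (r : ℝ) : TraceClass V :=
  r⁻¹ • TraceClass.conj (opPow r (-H))
    (cint σ fun θ => lamHat l.1 (r • (θ : Rd d)) * (starRingEnd ℂ) (lamHat m.1 (r • (θ : Rd d))))
    (opPow r (-ContinuousLinearMap.adjoint H))

/-- On the sphere of radius `r` the denominators of the two `specFun` multiply to `1 ∧ r^{2k+2}`,
which cancels the weight of the polar measure. The remaining density scales exactly. -/
theorem radialWeight_cint_specFun (l m : Lam d k) {r : ℝ} (hr : 0 < r) :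
    radialWeight k H r (cint σ fun θ => specFun k l.1 (r • (θ : Rd d)) *
      (starRingEnd ℂ) (specFun k m.1 (r • (θ : Rd d)))) = radialCov H σ l m r := by
  have hpos : 0 < min 1 (r ^ (2 * k + 2)) := lt_min one_pos (by positivity)
  have e : ∀ θ : Metric.sphere (0 : Rd d) 1, specFun k l.1 (r • (θ : Rd d)) *
      (starRingEnd ℂ) (specFun k m.1 (r • (θ : Rd d))) =
      ((min 1 (r ^ (2 * k + 2)) : ℝ)⁻¹ : ℝ) * (lamHat l.1 (r • (θ : Rd d)) *
        (starRingEnd ℂ) (lamHat m.1 (r • (θ : Rd d)))) := fun θ => by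
    have hn : ‖r • (θ : Rd d)‖ = r := by
      rw [norm_smul, Real.norm_of_nonneg hr.le, norm_eq_of_mem_sphere, mul_one]
    rw [specFun, specFun, map_div₀, Complex.conj_ofReal, hn, div_mul_div_comm,
      ← Complex.ofReal_mul, ← min_one_pow_two r k hr.le, Complex.ofReal_inv, div_eq_inv_mul]
  simp_rw [e]
  rw [cint_const_mul, radialWeight, radialCov, Complex.coe_smul, ← TraceClass.conjL_apply,
    ← TraceClass.conjL_apply, ContinuousLinearMap.map_smul_of_tower, smul_smul, mul_right_comm,
    mul_inv_cancel₀ hpos.ne', one_mul]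

theorem covKer_polarMeasure (hσ : IsPositiveMeasure σ) (l m : Lam d k) :
    IntegrableOn (radialCov H σ l m) (Set.Ioi 0) ∧
      covKer (polarMeasure k H σ hH) l m = ∫ r in Set.Ioi (0 : ℝ), radialCov H σ l m r := by
  obtain ⟨h1, h2⟩ := cint_polarMeasure k H σ hH hσ (stronglyMeasurable_specFun_mul_conj l m)
    (norm_specFun_mul_conj_le l m)
  exact ⟨h1.congr_fun (fun r hr => radialWeight_cint_specFun l m hr) measurableSet_Ioi,
    h2.trans (setIntegral_congr_fun measurableSet_Ioi fun r hr =>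
      radialWeight_cint_specFun l m hr)⟩

/-- Three identities combine: `\hat{c·l}(rθ) = \hat l(crθ)`, `r^{-H} = c^H (cr)^{-H}` together with
its adjoint, and `r^{-1} = c (cr)^{-1}`. -/
theorem radialCov_scaleMeas (l m : Lam d k) {c r : ℝ} (hc : 0 < c) (hr : 0 < r) :
    radialCov H σ (scaleMeas c l) (scaleMeas c m) r =
      c • TraceClass.conjL (opPow c H) (ContinuousLinearMap.adjoint (opPow c H))
        (radialCov H σ l m (c * r)) := by
  have h : opPow r (-H) = opPow c H * opPow (c * r) (-H) := by
    rw [← opPow_inv_neg c H, ← opPow_mul (inv_pos.2 hc) (mul_pos hc hr),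
      inv_mul_cancel_left₀ hc.ne']
  have h' : opPow r (-ContinuousLinearMap.adjoint H) =
      opPow (c * r) (-ContinuousLinearMap.adjoint H) *
        ContinuousLinearMap.adjoint (opPow c H) := by
    rw [opPow_neg_adjoint, opPow_neg_adjoint, h]
    exact ContinuousLinearMap.adjoint_comp _ _
  rw [radialCov, radialCov, ContinuousLinearMap.map_smul_of_tower, TraceClass.conjL_apply, TraceClass.conj_conj, ← h,
    ← h', smul_smul, mul_inv, mul_inv_cancel_left₀ hc.ne']
  simp_rw [lamHat_scaleMeas, smul_smul]

/-- The factor `c` from `radialCov_scaleMeas` is absorbed by the Jacobian of the dilation, which is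
the invariance of `dr/r`. -/
theorem covKer_polarMeasure_scaleMeas (hσ : IsPositiveMeasure σ) (l m : Lam d k) {c : ℝ}
    (hc : 0 < c) : covKer (polarMeasure k H σ hH) (scaleMeas c l) (scaleMeas c m) =
      TraceClass.conjL (opPow c H) (ContinuousLinearMap.adjoint (opPow c H))
        (covKer (polarMeasure k H σ hH) l m) := by
  obtain ⟨h1, h2⟩ := covKer_polarMeasure hH hσ l m
  rw [(covKer_polarMeasure hH hσ _ _).2, h2, ← ContinuousLinearMap.integral_comp_comm _ h1,
    setIntegral_congr_fun measurableSet_Ioi fun r hr => radialCov_scaleMeas l m hc hr,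
    integral_smul, integral_comp_mul_left_Ioi (fun r => TraceClass.conjL (opPow c H)
      (ContinuousLinearMap.adjoint (opPow c H)) (radialCov H σ l m r)) 0 hc, smul_smul,
    mul_inv_cancel₀ hc.ne', one_smul, mul_zero]

end SelfSimilar

end

/-! ### The proposition -/

theorem proposition5p1 {V : Type*} [NormedAddCommGroup V] [InnerProductSpace ℂ V]
    [CompleteSpace V] [TopologicalSpace.SeparableSpace V] (d k : ℕ) (H : V →L[ℂ] V)
    (hH : Complex.re '' spectrum ℂ H ⊆ Set.Ioo (0 : ℝ) (k + 1))
    (σ : MeasureTheory.VectorMeasure (Metric.sphere (0 : Rd d) 1) (TraceClass V))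
    (hσ : IsPositiveMeasure σ) :
    ∃ χ : MeasureTheory.VectorMeasure (Rd d) (TraceClass V), IsPolarMeasure k H σ χ ∧
      ∃ (Ω : Type) (_ : MeasurableSpace Ω) (P : MeasureTheory.Measure Ω)
        (Y : Ω → Lam d k →ₗ[ℂ] V),
        MeasureTheory.IsProbabilityMeasure P ∧ IsIRF P Y ∧ IsMeanSquareContinuous P Y ∧
          HasSpectralCharacteristics P Y χ 0 ∧ IsCovSelfSimilar H P Y := by
  have hint : IntegrableOn (radialBound k H) (Set.Ioi 0) :=
    integrableOn_weight_mul_norm_opPow_sq k H hH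
  have hχ := isPositiveMeasure_polarMeasure k H σ hint hσ
  have := hχ.isFiniteMeasure_variation
  obtain ⟨Y, hY2, hcov, hvar⟩ := hχ.exists_secondOrder (k := k)
  refine ⟨polarMeasure k H σ hint, isPolarMeasure_polarMeasure k H σ hint, ℕ × Bool, inferInstance,
    geomSignMeasure, Y, inferInstance, ⟨hY2, fun w l m => ?_⟩,
    isMeanSquareContinuous_of_covKer hvar,
    hasSpectralCharacteristics_of_covKer hχ (polarMeasure_singleton_zero k H σ hint) hcov,
    fun c hc l m => ?_⟩
  · rw [hcov, hcov, covKer_shiftMeas]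
  · rw [hcov, covKer_polarMeasure_scaleMeas hint hσ l m hc, ← hcov]
    -- The operator `c^H` acting on the process passes through the Bochner integral as conjugation
    -- by `c^H`.
    exact (crossCov_map (integrable_outer (hY2 l).2.1 (hY2 m).2.1) _).symm
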